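/- Let $F$ be a finite extension of $\mathbb{Q}_p$ with valuation ring $\mathcal{O}_F$, maximal ideal $\mathfrak{p}$, unit group $U_F$ and higher unit groups $U_F^{(n)}=1+\mathfrak{p}^n$ ($n\ge 1$), and let $\varpi$ be a uniformizer. Put $G=\mathrm{PGL}_2(F)$. For $x\in F^*$ let $\delta(x)\in G$ be the class of $\mathrm{diag}(x,1)$, and let $T=\delta(F^*)$, $T^0=\delta(U_F)$, $T^+=\delta(\mathcal{O}_F\setminus\{0\})$. Let $N_0\subseteq G$ be the group of classes of the matrices $\begin{pmatrix}1&y\\0&1\end{pmatrix}$, $y\in\mathcal{O}_F$, and put $N_0^t=tN_0t^{-1}$ for $t\in T^+$. For $n\ge 1$ let $K(n)$ (resp. $K_0(n)$) be the image in $G$ of the group of matrices in $\mathrm{GL}_2(\mathcal{O}_F)$ that are congruent to $1$ (resp. upper triangular) modulo $\mathfrak{p}^n$. Let $H$ be an open subgroup of $T^0$ and let $n\ge 1$ be an integer with $\delta(U_F^{(n)})\subseteq H$. Put $K_H(n)=K(n)HN_0$, $\overline{T}=T/H$, $\overline{T}^+=T^+/H$, $\overline{T}^0=T^0/H$, and let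 $t_0\in\overline{T}^+$ be the class of $\delta(\varpi)$. Let $\mathcal{O}$ be a complete noetherian local ring with $\dim(\mathcal{O})\le 1$, and let $\mathrm{Mod}^{\mathrm{sm}}_{\mathcal{O}}(G)$ be the category of smooth $\mathcal{O}[G]$-modules (the stabilizer of every element is open in $G$). For an $\mathcal{O}[\overline{T}^+]$-module $V$ let $$\Gamma^{\mathrm{ord}}(V)=\mathrm{Hom}_{\mathcal{O}[\overline{T}^+]}(\mathcal{O}[\overline{T}],V)_{t_0^{\pm1}\text{-fin}}$$ be the $\mathcal{O}[\overline{T}]$-module of those $\Psi\in\mathrm{Hom}_{\mathcal{O}[\overline{T}^+]}(\mathcal{O}[\overline{T}],V)$ for which $\mathcal{O}[t_0^{\pm1}]\Psi$ is a finitely generated $\mathcal{O}$-module. Let $R^q\Gamma^{\mathrm{ord}}$ be its right derived functors; $V$ is called $\Gamma^{\mathrm{ord}}$-acyclic if $R^q\Gamma^{\mathrm{ord}}(V)=0$ for all $q\ge1$. For $V\in\mathrm{Mod}^{\mathrm{sm}}_{\mathcal{O}}(G)$ the monoid $T^+$ acts on $V^{N_0}$ by $t\cdot v=\sum_{n'\in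 N_0/N_0^t}n'tv$. This action preserves $V^{K_H(n)}$ and makes it an $\mathcal{O}[\overline{T}^+]$-module. Let $H^s(K_H(n),\cdot)$ be the $s$-th right derived functor of $\mathrm{Mod}^{\mathrm{sm}}_{\mathcal{O}}(G)\to\mathrm{Mod}_{\mathcal{O}[\overline{T}^+]}$, $V\mapsto V^{K_H(n)}$. Let $\mathrm{Ord}(V)$ be the $\mathcal{O}[T]$-module of all $\Psi\in\mathrm{Hom}_{\mathcal{O}[T^+]}(\mathcal{O}[T],V^{N_0})$ for which $\mathcal{O}[\delta(\varpi)^{\pm1}]\Psi$ is a finitely generated $\mathcal{O}$-module, let $\mathrm{Ord}^H(V)=\mathrm{Ord}(V)^H$, an $\mathcal{O}[\overline{T}]$-module, and let $\mathrm{Ord}^{H,m}$ be the $m$-th right derived functor of $\mathrm{Ord}^H$. For an $\mathcal{O}[\overline{T}^0]$-module $W$, viewed as an $\mathcal{O}[K_0(n)]$-module through $K_0(n)\to K_0(n)/K_H(n)\cong\overline{T}^0$, let $$\mathrm{cInd}_{K_0(n)}^GW=\{\Phi:G\to W\mid \mathrm{supp}(\Phi)\text{ is compact and }\Phi(kg)=k\Phi(g)\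 \forall\,k\in K_0(n),\,g\in G\},$$ with $G$ acting by right translation. It carries a commuting action of $\overline{T}^+$: the class of $t\in T^+$ acts by $(t\cdot\Phi)(g)=\sum_{i}\Phi(t^{-1}n_i^{-1}g)$, where $\{n_i\}$ is a system of representatives of $N_0/N_0^t$. Via $(t\cdot f)(\Phi)=f(t\cdot\Phi)$, $\mathrm{Hom}_{\mathcal{O}[G]}(\mathrm{cInd}_{K_0(n)}^GW,I)$ is an $\mathcal{O}[\overline{T}^+]$-module for every $\mathcal{O}[G]$-module $I$. Then the following hold. (1) If $I$ is an injective object of $\mathrm{Mod}^{\mathrm{sm}}_{\mathcal{O}}(G)$ and $W$ is a finitely generated $\mathcal{O}[\overline{T}^0]$-module, then the $\mathcal{O}[\overline{T}^+]$-module $\mathrm{Hom}_{\mathcal{O}[G]}(\mathrm{cInd}_{K_0(n)}^GW,I)$ is $\Gamma^{\mathrm{ord}}$-acyclic. (2) For every $V\in\mathrm{Mod}^{\mathrm{sm}}_{\mathcal{O}}(G)$ there is a first quadrant cohomological spectral sequence of $\mathcal{O}[\overline{T}]$-modules $$E_2^{rs}=R^r\Gamma^{\mathrm{ord}}\bigl(H^s(K_H(n),V)\bigr)\Longrightarrow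 \mathrm{Ord}^{H,r+s}(V).$$ -/

import Mathlib

open CategoryTheory Limits ValuativeRel

universe u

set_option linter.unusedSectionVars false

namespace PGLOrd

noncomputable section

section Groups

variable (F : Type u) [Field F] [ValuativeRel F] [TopologicalSpace F]
  [IsNonarchimedeanLocalField F]

/-- The group `G = PGL₂(F) = GL₂(F) / Z`, with the quotient topology. -/
abbrev PGL2 : Type u := GL (Fin 2) F ⧸ Subgroup.center (GL (Fin 2) F)

/-- The map `GL₂(𝒪_F) → GL₂(F) → G`. -/
def toG : GL (Fin 2) 𝒪[F] →* PGL2 F :=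
  (QuotientGroup.mk' (Subgroup.center (GL (Fin 2) F))).comp
    (Matrix.GeneralLinearGroup.map (𝒪[F]).subtype)

variable {F} in
/-- `δ(x)`, the class of `diag(x, 1)`. It identifies `Fˣ` with the torus `T` of `G`; below the
torus `T` is `Fˣ`. -/
def dia : Fˣ →* PGL2 F :=
  (QuotientGroup.mk' (Subgroup.center (GL (Fin 2) F))).comp
    { toFun := fun x => ⟨!![(x : F), 0; 0, 1], !![((x⁻¹ : Fˣ) : F), 0; 0, 1],
        by simp [Matrix.one_fin_two], by simp [Matrix.one_fin_two]⟩
      map_one' := by ext i j; fin_cases i <;> fin_cases j <;> simp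
      map_mul' := fun x y => by ext i j; fin_cases i <;> fin_cases j <;> simp }

variable {F} in
/-- `n(y)`, the class of the unipotent matrix with rows `(1, y)` and `(0, 1)`. -/
def unip (y : F) : PGL2 F :=
  QuotientGroup.mk' (Subgroup.center (GL (Fin 2) F)) (Matrix.GeneralLinearGroup.upperRightHom y)

variable {F} in
lemma unip_add (y z : F) : unip (y + z) = unip y * unip z := by
  simp [unip, AddChar.map_add_eq_mul]

variable {F} in
lemma unip_zero : unip (0 : F) = 1 := by
  simp [unip]

/-- The group `N₀ = {n(y) : y ∈ 𝒪_F}`. -/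
def N0 : Subgroup (PGL2 F) where
  carrier := {g | ∃ y : 𝒪[F], g = unip (y : F)}
  one_mem' := ⟨0, by simp [unip_zero]⟩
  mul_mem' := by
    rintro _ _ ⟨y, rfl⟩ ⟨z, rfl⟩
    exact ⟨y + z, by simp [unip_add]⟩
  inv_mem' := by
    rintro _ ⟨y, rfl⟩
    refine ⟨-y, ?_⟩
    rw [inv_eq_iff_mul_eq_one, ← unip_add]
    simp [unip_zero]

/-- The monoid `T⁺`, which corresponds to `𝒪_F ∖ {0}`. -/
def TPlus : Submonoid Fˣ where
  carrier := {x | (x : F) ∈ 𝒪[F]}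
  one_mem' := by simp [one_mem]
  mul_mem' := fun ha hb => by
    simpa using mul_mem (S := Subring F) ha hb

/-- The group `T⁰`, which corresponds to `U_F = 𝒪_Fˣ`. -/
def T0 : Subgroup Fˣ where
  carrier := {x | (x : F) ∈ 𝒪[F] ∧ ((x⁻¹ : Fˣ) : F) ∈ 𝒪[F]}
  one_mem' := by simp [one_mem]
  mul_mem' := fun {a b} ha hb => by
    refine ⟨by simpa using mul_mem ha.1 hb.1, ?_⟩
    have := mul_mem ha.2 hb.2
    rwa [← Units.val_mul, ← mul_inv] at this
  inv_mem' := fun h => ⟨h.2, by simpa using h.1⟩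

/-- The higher unit group `U_F⁽ⁿ⁾ = 1 + 𝔭ⁿ`, for `n ≥ 1`, as a set of elements of `Fˣ`. -/
def higherUnits (n : ℕ) : Set Fˣ := {x | ∃ z : 𝒪[F], z ∈ 𝓂[F] ^ n ∧ (x : F) = 1 + z}

/-- `K(𝔭ⁿ) = ker (GL₂(𝒪_F) → GL₂(𝒪_F / 𝔭ⁿ))`. -/
def congruenceGL (n : ℕ) : Subgroup (GL (Fin 2) 𝒪[F]) :=
  (Matrix.GeneralLinearGroup.map (n := Fin 2) (Ideal.Quotient.mk (𝓂[F] ^ n))).ker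

/-- `K₀(𝔭ⁿ)`, the matrices in `GL₂(𝒪_F)` that are upper triangular modulo `𝔭ⁿ`. -/
def iwahoriGL (n : ℕ) : Subgroup (GL (Fin 2) 𝒪[F]) where
  carrier := {A | A.val 1 0 ∈ 𝓂[F] ^ n}
  one_mem' := by simp
  mul_mem' := fun {A B} hA hB => by
    simp only [Set.mem_ofPred_eq, Units.val_mul, Matrix.mul_apply, Fin.sum_univ_two] at *
    exact add_mem (Ideal.mul_mem_right _ _ hA) (Ideal.mul_mem_left _ _ hB)
  inv_mem' := fun {A} hA => by
    simp only [Set.mem_ofPred_eq, Matrix.coe_units_inv, Matrix.inv_def, Matrix.adjugate_fin_two,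
      Matrix.smul_apply, Matrix.of_apply, Matrix.cons_val', Matrix.cons_val_zero,
      Matrix.cons_val_one, Matrix.cons_val_fin_one, smul_eq_mul] at *
    exact Ideal.mul_mem_left _ _ (neg_mem hA)

/-- The principal congruence subgroup `K(n)` of `G`. -/
def Kn (n : ℕ) : Subgroup (PGL2 F) := (congruenceGL F n).map (toG F)

/-- The subgroup `K₀(n)` of `G`. -/
def K0 (n : ℕ) : Subgroup (PGL2 F) := (iwahoriGL F n).map (toG F)

variable {F}

/-- The subgroup `K_H(n) = K(n) H N₀` of `G`, as the subgroup generated by the three factors. -/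
def KH (H : Subgroup Fˣ) (n : ℕ) : Subgroup (PGL2 F) := Kn F n ⊔ H.map dia ⊔ N0 F

/-- A uniformizer of `F`. -/
def IsUniformizer (ϖ : Fˣ) : Prop := ∃ h : (ϖ : F) ∈ 𝒪[F], Irreducible (⟨ϖ, h⟩ : 𝒪[F])

/-- The torus quotient `T̄ = T / H`. -/
abbrev TBar (H : Subgroup Fˣ) : Type u := Fˣ ⧸ H

/-- The image `T̄⁺ = T⁺ / H` of `T⁺` in `T̄`. -/
def TBarPlus (H : Subgroup Fˣ) : Submonoid (TBar H) := (TPlus F).map (QuotientGroup.mk' H)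

/-- The image `T̄⁰ = T⁰ / H` of `T⁰` in `T̄`. -/
def TBar0 (H : Subgroup Fˣ) : Subgroup (TBar H) := (T0 F).map (QuotientGroup.mk' H)

/-- The class in `T̄⁰` of an element of `T⁰`. -/
def T0.bar (H : Subgroup Fˣ) (x : T0 F) : TBar0 H :=
  ⟨QuotientGroup.mk' H x, x, x.2, rfl⟩

lemma T0_le_TPlus {x : Fˣ} (hx : x ∈ T0 F) : x ∈ TPlus F := hx.1

/-- An element of `T⁺` as an element of `𝒪_F`. -/
def TPlus.int (x : TPlus F) : 𝒪[F] := ⟨((x : Fˣ) : F), x.2⟩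

lemma TPlus.int_ne_zero (x : TPlus F) : TPlus.int x ≠ 0 := fun h =>
  (x : Fˣ).ne_zero (congrArg Subtype.val h)

/-- The finite index set `𝒪_F / x 𝒪_F`, which is `N₀ / t N₀ t⁻¹` for `t = δ(x)`. -/
abbrev Idx (x : TPlus F) : Type u := 𝒪[F] ⧸ Ideal.span {TPlus.int x}

instance (x : TPlus F) : Finite (Idx x) := by
  obtain ⟨ϖ, hϖ⟩ := IsDiscreteValuationRing.exists_irreducible 𝒪[F]
  obtain ⟨n, hn⟩ := IsDiscreteValuationRing.ideal_eq_span_pow_irreducible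
    (s := Ideal.span {TPlus.int x}) (by simpa using TPlus.int_ne_zero x) hϖ
  have hm : 𝓂[F] = Ideal.span {ϖ} := hϖ.maximalIdeal_eq
  have : Finite (𝒪[F] ⧸ 𝓂[F]) := inferInstanceAs (Finite 𝓀[F])
  have h2 := Ideal.finite_quotient_pow (I := 𝓂[F]) (IsNoetherian.noetherian _) n
  rw [Idx, hn, ← Ideal.span_singleton_pow, ← hm]
  exact h2

instance (x : TPlus F) : Fintype (Idx x) := Fintype.ofFinite _

end Groups

section Matrices

variable {F : Type u} [Field F] [ValuativeRel F] [TopologicalSpace F]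
  [IsNonarchimedeanLocalField F]

lemma dia_mul_unip (x : Fˣ) (y : F) : dia x * unip y = unip ((x : F) * y) * dia x := by
  refine congrArg (QuotientGroup.mk' (Subgroup.center (GL (Fin 2) F)))
    (a₁ := (_ : GL (Fin 2) F) * _) (a₂ := _ * _) ?_
  ext i j
  fin_cases i <;> fin_cases j <;>
    simp [Matrix.mul_apply, Fin.sum_univ_two, Matrix.GeneralLinearGroup.upperRightHom]

lemma mem_congruenceGL {n : ℕ} {A : GL (Fin 2) 𝒪[F]} :
    A ∈ congruenceGL F n ↔ A.val 0 0 - 1 ∈ 𝓂[F] ^ n ∧ A.val 0 1 ∈ 𝓂[F] ^ n ∧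
      A.val 1 0 ∈ 𝓂[F] ^ n ∧ A.val 1 1 - 1 ∈ 𝓂[F] ^ n := by
  have key : ∀ a b : 𝒪[F], Ideal.Quotient.mk (𝓂[F] ^ n) a = Ideal.Quotient.mk (𝓂[F] ^ n) b ↔
    a - b ∈ 𝓂[F] ^ n := fun a b => Ideal.Quotient.mk_eq_mk_iff_sub_mem a b
  have k0 := fun a : 𝒪[F] => key a 0
  have k1 := fun a : 𝒪[F] => key a 1
  simp only [map_zero, map_one, sub_zero] at k0 k1
  rw [congruenceGL, MonoidHom.mem_ker, Units.ext_iff, ← Matrix.ext_iff]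
  simp [Fin.forall_fin_two, k0, k1, and_assoc]

/-- How a matrix in `K(𝔭ⁿ)` moves the representative `n(y) δ(x)`. -/
lemma congruence_mul {n : ℕ} (hn : 1 ≤ n) {A : GL (Fin 2) 𝒪[F]} (hA : A ∈ congruenceGL F n)
    (x : TPlus F) : ∃ r : 𝒪[F] → 𝒪[F],
      (∀ y y' : 𝒪[F], r y - r y' ∈ Ideal.span {TPlus.int x} → y - y' ∈ Ideal.span {TPlus.int x}) ∧
      ∀ y : 𝒪[F], ∃ k ∈ Kn F n,
        toG F A * (unip (y : F) * dia x) = unip ((r y : 𝒪[F]) : F) * dia x * k := by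
  obtain ⟨h00, h01, h10, h11⟩ := mem_congruenceGL.1 hA
  have hle : 𝓂[F] ^ n ≤ 𝓂[F] := Ideal.pow_le_self (by omega)
  have hu : ∀ y : 𝒪[F], IsUnit (A.val 1 0 * y + A.val 1 1) := fun y => by
    by_contra h
    have h1 : A.val 1 0 * y + A.val 1 1 ∈ 𝓂[F] := (IsLocalRing.mem_maximalIdeal _).2 h
    have h2 : (A.val 1 0 * y + A.val 1 1) - A.val 1 0 * y - (A.val 1 1 - 1) ∈ 𝓂[F] :=
      sub_mem (sub_mem h1 (Ideal.mul_mem_right _ _ (hle h10))) (hle h11)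
    have h3 : (1 : 𝒪[F]) ∈ 𝓂[F] := by convert h2 using 1; ring
    exact (Ideal.ne_top_iff_one _).1 (IsLocalRing.maximalIdeal.isMaximal _).ne_top h3
  choose w hw using fun y => (hu y).exists_right_inv
  have hdet : IsUnit (A.val 0 0 * A.val 1 1 - A.val 0 1 * A.val 1 0) := by
    rw [← Matrix.det_fin_two]
    exact (Matrix.isUnit_iff_isUnit_det _).1 A.isUnit
  obtain ⟨e, he⟩ := hdet.exists_right_inv
  refine ⟨fun y => (A.val 0 0 * y + A.val 0 1) * w y, fun y y' h => ?_, fun y => ?_⟩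
  · have h1 := Ideal.mul_mem_left _
      ((A.val 1 0 * y + A.val 1 1) * (A.val 1 0 * y' + A.val 1 1) * e) h
    convert h1 using 1
    linear_combination (-(y - y')) * he + ((A.val 1 0 * y + A.val 1 1) * e *
      (A.val 0 0 * y' + A.val 0 1)) * hw y' - ((A.val 1 0 * y' + A.val 1 1) * e *
      (A.val 0 0 * y + A.val 0 1)) * hw y
  · set r := (A.val 0 0 * y + A.val 0 1) * w y with hr
    have hry : r * (A.val 1 0 * y + A.val 1 1) = A.val 0 0 * y + A.val 0 1 := by
      linear_combination (A.val 0 0 * y + A.val 0 1) * hw y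
    let M : Matrix (Fin 2) (Fin 2) 𝒪[F] :=
      !![A.val 0 0 - r * A.val 1 0, 0; TPlus.int x * A.val 1 0, A.val 1 0 * y + A.val 1 1]
    have hM : IsUnit M.det := by
      have : M.det = A.val 0 0 * A.val 1 1 - A.val 0 1 * A.val 1 0 := by
        simp only [M, Matrix.det_fin_two_of]
        linear_combination (-A.val 1 0) * hry
      rw [this]
      exact hdet
    let B : GL (Fin 2) 𝒪[F] := Matrix.GeneralLinearGroup.mk'' M hM
    have hB : B.val = M := rfl
    refine ⟨toG F B, ⟨B, mem_congruenceGL.2 ?_, rfl⟩, ?_⟩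
    · rw [hB]
      refine ⟨?_, by simp [M], ?_, ?_⟩
      · have := sub_mem h00 (Ideal.mul_mem_left _ r h10)
        simp only [M, Matrix.of_apply, Matrix.cons_val', Matrix.cons_val_zero,
          Matrix.cons_val_fin_one]
        convert this using 1; ring
      · simpa [M] using Ideal.mul_mem_left _ (TPlus.int x) h10
      · have := add_mem h11 (Ideal.mul_mem_right y _ h10)
        simp only [M, Matrix.of_apply, Matrix.cons_val', Matrix.cons_val_one,
          Matrix.cons_val_fin_one]
        convert this using 1; ring
    · refine congrArg (QuotientGroup.mk' (Subgroup.center (GL (Fin 2) F)))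
        (a₁ := (_ : GL (Fin 2) F) * (_ * _)) (a₂ := _ * _ * _) ?_
      have e1 : ((r : 𝒪[F]) : F) * ((A.val 1 0 : 𝒪[F]) * (y : F) + (A.val 1 1 : 𝒪[F])) =
          (A.val 0 0 : 𝒪[F]) * (y : F) + (A.val 0 1 : 𝒪[F]) := by
        exact_mod_cast congrArg (Subtype.val) hry
      have e2 : ((TPlus.int x : 𝒪[F]) : F) = ((x : Fˣ) : F) := rfl
      have e3 : ((r : 𝒪[F]) : F) =
          ((A.val 0 0 : 𝒪[F]) * (y : F) + (A.val 0 1 : 𝒪[F])) * (w y : 𝒪[F]) := by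
        exact_mod_cast congrArg (Subtype.val) hr
      ext i j
      fin_cases i <;> fin_cases j <;>
        simp [Matrix.mul_apply, Fin.sum_univ_two, Matrix.GeneralLinearGroup.upperRightHom, hB, M,
          e2]
      · linear_combination (((x : Fˣ) : F) * (A.val 1 0 : 𝒪[F])) * e3
      · linear_combination -e1 + ((A.val 1 1 : 𝒪[F]) + (y : F) * (A.val 1 0 : 𝒪[F])) * e3
      · ring
end Matrices

section Hecke

variable {F : Type u} [Field F] [ValuativeRel F] [TopologicalSpace F]
  [IsNonarchimedeanLocalField F]
variable {O : Type u} [CommRing O] {V : Type u} [AddCommGroup V] [Module O V]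
  (ρ : Representation O (PGL2 F) V)

/-- The vectors of a representation of `G` fixed by a subgroup `K` of `G`. -/
def fixedBy (K : Subgroup (PGL2 F)) : Submodule O V where
  carrier := {v | ∀ k ∈ K, ρ k v = v}
  add_mem' := fun ha hb k hk => by rw [map_add, ha k hk, hb k hk]
  zero_mem' := fun k _ => map_zero _
  smul_mem' := fun c v hv k hk => by rw [map_smul, hv k hk]

lemma fixedBy_anti {K L : Subgroup (PGL2 F)} (h : K ≤ L) : fixedBy ρ L ≤ fixedBy ρ K :=
  fun _ hv k hk => hv k (h hk)

lemma fixedBy_sup (K L : Subgroup (PGL2 F)) : fixedBy ρ (K ⊔ L) = fixedBy ρ K ⊓ fixedBy ρ L := by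
  refine le_antisymm (le_inf (fixedBy_anti ρ le_sup_left) (fixedBy_anti ρ le_sup_right)) ?_
  rintro v ⟨h1, h2⟩
  let S : Subgroup (PGL2 F) :=
    { carrier := {g | ρ g v = v}
      one_mem' := by simp
      mul_mem' := fun {a b} ha hb => by
        change ρ (a * b) v = v
        rw [map_mul, Module.End.mul_apply, hb, ha]
      inv_mem' := fun {a} ha => by
        change ρ a⁻¹ v = v
        conv_lhs => rw [← (show ρ a v = v from ha)]
        rw [← Module.End.mul_apply, ← map_mul, inv_mul_cancel, map_one, Module.End.one_apply] }
  have h3 : K ⊔ L ≤ S := sup_le h1 h2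
  exact fun k hk => h3 hk

/-- The Hecke operator of `t = δ(x) ∈ T⁺`: the sum of `ρ (n t)` over representatives `n` in `N₀` of
`N₀ / t N₀ t⁻¹`. It is used on vectors fixed by `N₀`, where it does not depend on the
representatives. -/
def heckeOp (x : TPlus F) : Module.End O V :=
  ∑ y : Idx x, ρ (unip ((Quotient.out y : 𝒪[F]) : F) * dia (x : Fˣ))

lemma rep_unip_eq {v : V} (hv : v ∈ fixedBy ρ (N0 F)) (x : TPlus F) {y y' : 𝒪[F]}
    (h : y - y' ∈ Ideal.span {TPlus.int x}) :
    ρ (unip (y : F) * dia (x : Fˣ)) v = ρ (unip (y' : F) * dia (x : Fˣ)) v := by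
  obtain ⟨z, hz⟩ := Ideal.mem_span_singleton.1 h
  have h1 : (y : F) = y' + ((x : Fˣ) : F) * z := by
    have := congrArg Subtype.val (sub_eq_iff_eq_add'.1 hz)
    simpa [TPlus.int] using this
  have h2 : unip (y : F) * dia (x : Fˣ) = unip (y' : F) * dia (x : Fˣ) * unip (z : F) := by
    rw [h1, unip_add, mul_assoc, mul_assoc, ← dia_mul_unip]
  rw [h2, map_mul, Module.End.mul_apply, hv _ ⟨z, rfl⟩]

/-- The Hecke operator may be computed with any representatives. -/
lemma heckeOp_eq {v : V} (hv : v ∈ fixedBy ρ (N0 F)) (x : TPlus F) {ι : Type*} [Fintype ι]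
    (r : ι → 𝒪[F])
    (hr : Function.Bijective fun i => Ideal.Quotient.mk (Ideal.span {TPlus.int x}) (r i)) :
    heckeOp ρ x v = ∑ i, ρ (unip ((r i : 𝒪[F]) : F) * dia (x : Fˣ)) v := by
  rw [heckeOp, LinearMap.sum_apply]
  refine (Function.Bijective.sum_comp hr
    (fun y => ρ (unip ((Quotient.out y : 𝒪[F]) : F) * dia (x : Fˣ)) v)).symm.trans ?_
  refine Finset.sum_congr rfl fun i _ => rep_unip_eq ρ hv x ?_
  rw [← Ideal.Quotient.mk_eq_mk_iff_sub_mem]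
  exact Quotient.out_eq _

lemma mk_out (x : TPlus F) (y : Idx x) :
    Ideal.Quotient.mk (Ideal.span {TPlus.int x}) (Quotient.out y) = y := Quotient.out_eq y

lemma heckeOp_mem {v : V} (hv : v ∈ fixedBy ρ (N0 F)) (x : TPlus F) :
    heckeOp ρ x v ∈ fixedBy ρ (N0 F) := by
  rintro _ ⟨z, rfl⟩
  refine Eq.trans ?_ (heckeOp_eq ρ hv x (ι := Idx x) (fun y => z + Quotient.out y) ?_).symm
  · rw [heckeOp, LinearMap.sum_apply, map_sum]
    refine Finset.sum_congr rfl fun y _ => ?_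
    rw [← Module.End.mul_apply, ← map_mul, ← mul_assoc, ← unip_add]
    rfl
  · refine Function.Injective.bijective_of_finite fun a b hab => ?_
    simpa [mk_out] using hab

lemma heckeOp_unit {v : V} (hv : v ∈ fixedBy ρ (N0 F)) (x : TPlus F) (hx : (x : Fˣ) ∈ T0 F) :
    heckeOp ρ x v = ρ (dia (x : Fˣ)) v := by
  have h1 : Ideal.span {TPlus.int x} = ⊤ := by
    refine Ideal.eq_top_of_isUnit_mem _ (Ideal.mem_span_singleton_self _) ?_
    refine IsUnit.of_mul_eq_one ⟨((x : Fˣ)⁻¹ : Fˣ), hx.2⟩ ?_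
    exact Subtype.ext (by simp [TPlus.int])
  rw [heckeOp_eq ρ hv x (ι := Unit) (fun _ => 0)]
  · simp [unip_zero]
  · have : Subsingleton (Idx x) := Ideal.Quotient.subsingleton_iff.2 h1
    exact ⟨fun _ _ _ => rfl, fun y => ⟨(), Subsingleton.elim _ _⟩⟩

lemma heckeOp_mul {v : V} (hv : v ∈ fixedBy ρ (N0 F)) (x x' : TPlus F) :
    heckeOp ρ (x * x') v = heckeOp ρ x (heckeOp ρ x' v) := by
  have hint : TPlus.int (x * x') = TPlus.int x * TPlus.int x' := rfl
  rw [heckeOp_eq ρ hv (x * x') (ι := Idx x × Idx x')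
    (fun y => Quotient.out y.1 + TPlus.int x * Quotient.out y.2)]
  · rw [Fintype.sum_prod_type]
    rw [heckeOp, heckeOp, LinearMap.sum_apply, LinearMap.sum_apply]
    refine Finset.sum_congr rfl fun y _ => ?_
    rw [map_sum]
    refine Finset.sum_congr rfl fun y' _ => ?_
    rw [← Module.End.mul_apply, ← map_mul]
    congr 2
    have := dia_mul_unip (x : Fˣ) ((Quotient.out y' : 𝒪[F]) : F)
    calc _ = unip ((Quotient.out y : 𝒪[F]) : F) *
          (unip (((x : Fˣ) : F) * ((Quotient.out y' : 𝒪[F]) : F)) * dia (x : Fˣ)) *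
          dia (x' : Fˣ) := by
            rw [← mul_assoc, ← unip_add, mul_assoc, ← map_mul]
            rfl
      _ = _ := by
            rw [← this]
            simp only [mul_assoc]
  · constructor
    · rintro ⟨a, a'⟩ ⟨b, b'⟩ h
      have h1 := (Ideal.Quotient.mk_eq_mk_iff_sub_mem _ _).1 h
      obtain ⟨c, hc⟩ := Ideal.mem_span_singleton.1 h1
      simp only [hint] at hc
      have hab : a = b := by
        rw [← mk_out x a, ← mk_out x b]
        refine (Ideal.Quotient.mk_eq_mk_iff_sub_mem _ _).2 (Ideal.mem_span_singleton.2
          ⟨TPlus.int x' * c - Quotient.out a' + Quotient.out b', ?_⟩)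
        linear_combination hc
      subst hab
      have hab' : a' = b' := by
        rw [← mk_out x' a', ← mk_out x' b']
        refine (Ideal.Quotient.mk_eq_mk_iff_sub_mem _ _).2 (Ideal.mem_span_singleton.2 ⟨c, ?_⟩)
        refine mul_left_cancel₀ (TPlus.int_ne_zero x) ?_
        linear_combination hc
      rw [hab']
    · intro q
      obtain ⟨a, rfl⟩ := Ideal.Quotient.mk_surjective q
      have h1 := (Ideal.Quotient.mk_eq_mk_iff_sub_mem _ _).1
        (mk_out x (Ideal.Quotient.mk _ a))
      obtain ⟨b, hb⟩ := Ideal.mem_span_singleton.1 h1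
      have h2 := (Ideal.Quotient.mk_eq_mk_iff_sub_mem _ _).1
        (mk_out x' (Ideal.Quotient.mk _ (-b)))
      obtain ⟨c, hc⟩ := Ideal.mem_span_singleton.1 h2
      refine ⟨(Ideal.Quotient.mk _ a, Ideal.Quotient.mk _ (-b)), ?_⟩
      refine (Ideal.Quotient.mk_eq_mk_iff_sub_mem _ _).2 (Ideal.mem_span_singleton.2 ⟨c, ?_⟩)
      rw [hint]
      linear_combination hb + TPlus.int x * hc

lemma heckeOp_mem_Kn {n : ℕ} (hn : 1 ≤ n) {v : V} (hv : v ∈ fixedBy ρ (N0 F))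
    (hv' : v ∈ fixedBy ρ (Kn F n)) (x : TPlus F) : heckeOp ρ x v ∈ fixedBy ρ (Kn F n) := by
  rintro _ ⟨A, hA, rfl⟩
  obtain ⟨r, hr, hk⟩ := congruence_mul hn hA x
  refine Eq.trans ?_ (heckeOp_eq ρ hv x (ι := Idx x) (fun y => r (Quotient.out y)) ?_).symm
  · rw [heckeOp, LinearMap.sum_apply, map_sum]
    refine Finset.sum_congr rfl fun y _ => ?_
    obtain ⟨k, hk1, hk2⟩ := hk (Quotient.out y)
    rw [← Module.End.mul_apply, ← map_mul, hk2, map_mul, Module.End.mul_apply, hv' k hk1]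
  · refine Function.Injective.bijective_of_finite fun a b hab => ?_
    have := (Ideal.Quotient.mk_eq_mk_iff_sub_mem _ _).2
      (hr _ _ ((Ideal.Quotient.mk_eq_mk_iff_sub_mem _ _).1 hab))
    rwa [mk_out, mk_out] at this

lemma heckeOp_mem_H {H : Subgroup Fˣ} (hH : H ≤ T0 F) {v : V} (hv : v ∈ fixedBy ρ (N0 F))
    (hv' : v ∈ fixedBy ρ (H.map dia)) (x : TPlus F) : heckeOp ρ x v ∈ fixedBy ρ (H.map dia) := by
  rintro _ ⟨h, hh, rfl⟩
  let h' : TPlus F := ⟨h, T0_le_TPlus (hH hh)⟩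
  rw [← heckeOp_unit ρ (heckeOp_mem ρ hv x) h' (hH hh), ← heckeOp_mul ρ hv, mul_comm,
    heckeOp_mul ρ hv, heckeOp_unit ρ hv h' (hH hh), hv' _ ⟨h, hh, rfl⟩]

/-- The action of the monoid `T⁺` by Hecke operators, on a submodule `S` of the vectors fixed by
`N₀` that all Hecke operators preserve. -/
def heckeRep (S : Submodule O V) (hS : S ≤ fixedBy ρ (N0 F))
    (hst : ∀ x : TPlus F, ∀ v ∈ S, heckeOp ρ x v ∈ S) : Representation O (TPlus F) S where
  toFun x := (heckeOp ρ x).restrict (hst x)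
  map_one' := by
    ext v
    change heckeOp ρ 1 (v : V) = v
    rw [heckeOp_unit ρ (hS v.2) 1 (one_mem _)]
    simp
  map_mul' x x' := by
    ext v
    exact heckeOp_mul ρ (hS v.2) x x'

end Hecke

section Descend

variable {F : Type u} [Field F] [ValuativeRel F] [TopologicalSpace F]
  [IsNonarchimedeanLocalField F] {E : Type*} [Monoid E]

lemma descend_aux {H : Subgroup Fˣ} (hH : H ≤ T0 F) (σ : TPlus F →* E)
    (hσ : ∀ h : TPlus F, (h : Fˣ) ∈ H → σ h = 1) {x x' : TPlus F}
    (h : QuotientGroup.mk' H (x : Fˣ) = QuotientGroup.mk' H (x' : Fˣ)) : σ x = σ x' := by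
  obtain ⟨z, hz, hz'⟩ := (QuotientGroup.mk'_eq_mk' H).1 h
  have : x' = x * ⟨z, T0_le_TPlus (hH hz)⟩ := Subtype.ext hz'.symm
  rw [this, map_mul, hσ ⟨z, T0_le_TPlus (hH hz)⟩ hz, mul_one]

/-- A homomorphism from `T⁺` that is trivial on `H` factors over `T̄⁺`. -/
def descend {H : Subgroup Fˣ} (hH : H ≤ T0 F) (σ : TPlus F →* E)
    (hσ : ∀ h : TPlus F, (h : Fˣ) ∈ H → σ h = 1) : TBarPlus H →* E where
  toFun t := σ ⟨t.2.choose, t.2.choose_spec.1⟩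
  map_one' := by
    rw [← map_one σ]
    exact descend_aux hH σ hσ (1 : TBarPlus H).2.choose_spec.2
  map_mul' t t' := by
    rw [← map_mul σ]
    refine descend_aux hH σ hσ ((t * t').2.choose_spec.2.trans ?_)
    exact (congrArg₂ (· * ·) t.2.choose_spec.2 t'.2.choose_spec.2).symm

/-- The class in `T̄⁺` of an element of `T⁺`. -/
def TPlus.bar (H : Subgroup Fˣ) (x : TPlus F) : TBarPlus H := ⟨QuotientGroup.mk' H x, x, x.2, rfl⟩

lemma descend_bar {H : Subgroup Fˣ} (hH : H ≤ T0 F) (σ : TPlus F →* E)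
    (hσ : ∀ h : TPlus F, (h : Fˣ) ∈ H → σ h = 1) (x : TPlus F) :
    descend hH σ hσ (TPlus.bar H x) = σ x :=
  descend_aux hH σ hσ (TPlus.bar H x).2.choose_spec.2

lemma TPlus.bar_surjective (H : Subgroup Fˣ) : Function.Surjective (TPlus.bar (F := F) H) := by
  rintro ⟨_, x, hx, rfl⟩
  exact ⟨⟨x, hx⟩, rfl⟩

end Descend

section Gamma

variable {O : Type u} [CommRing O] [IsNoetherianRing O] {T : Type u} [CommGroup T]

/-- The part of a representation `W` of `T` on which `t₀` acts locally finitely: the `w` such that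
the `O`-module `O[t₀, t₀⁻¹] w` is finitely generated. -/
def finPart {W : Type u} [AddCommGroup W] [Module O W] (ρ : Representation O T W) (t₀ : T) :
    Subrepresentation ρ where
  toSubmodule :=
    { carrier := {w | (Submodule.span O (Set.range fun i : ℤ => ρ (t₀ ^ i) w)).FG}
      zero_mem' := by
        have : Submodule.span O (Set.range fun i : ℤ => ρ (t₀ ^ i) (0 : W)) = ⊥ := by
          rw [Submodule.span_eq_bot]
          rintro _ ⟨i, rfl⟩
          exact map_zero _
        simp only [Set.mem_ofPred_eq, this]
        exact Submodule.fg_bot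
      add_mem' := fun {a b} ha hb => by
        have := isNoetherian_of_fg_of_noetherian _ (Submodule.FG.sup ha hb)
        refine Submodule.FG.of_le (Submodule.FG.sup ha hb) (Submodule.span_le.2 ?_)
        rintro _ ⟨i, rfl⟩
        simp only [map_add]
        exact add_mem (Submodule.mem_sup_left (Submodule.subset_span ⟨i, rfl⟩))
          (Submodule.mem_sup_right (Submodule.subset_span ⟨i, rfl⟩))
      smul_mem' := fun c w hw => by
        refine Submodule.FG.of_le hw (Submodule.span_le.2 ?_)
        rintro _ ⟨i, rfl⟩
        simp only [map_smul]
        exact Submodule.smul_mem _ _ (Submodule.subset_span ⟨i, rfl⟩) }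
  apply_mem_toSubmodule t w hw := by
    change (Submodule.span O (Set.range fun i : ℤ => ρ (t₀ ^ i) (ρ t w))).FG
    have : (Set.range fun i : ℤ => ρ (t₀ ^ i) (ρ t w)) =
        (ρ t) '' (Set.range fun i : ℤ => ρ (t₀ ^ i) w) := by
      rw [← Set.range_comp]
      refine congrArg Set.range (funext fun i => ?_)
      simp only [Function.comp_apply, ← Module.End.mul_apply, ← map_mul, mul_comm]
    rw [this, Submodule.span_image]
    exact Submodule.FG.map _ hw

/-- The map induced by an intertwining map on locally finite parts. -/
def finPartMap {W W' : Type u} [AddCommGroup W] [Module O W] [AddCommGroup W'] [Module O W']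
    {ρ : Representation O T W} {ρ' : Representation O T W'} (f : ρ.IntertwiningMap ρ') (t₀ : T) :
    (finPart ρ t₀).toRepresentation.IntertwiningMap (finPart ρ' t₀).toRepresentation where
  toLinearMap := f.toLinearMap.restrict fun w hw => by
    change (Submodule.span O (Set.range fun i : ℤ => ρ' (t₀ ^ i) (f.toLinearMap w))).FG
    have : (Set.range fun i : ℤ => ρ' (t₀ ^ i) (f.toLinearMap w)) =
        f.toLinearMap '' (Set.range fun i : ℤ => ρ (t₀ ^ i) w) := by
      rw [← Set.range_comp]
      exact congrArg Set.range (funext fun i => (LinearMap.congr_fun (f.isIntertwining' _) w).symm)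
    rw [this, Submodule.span_image]
    exact Submodule.FG.map _ hw
  isIntertwining' t := by
    ext w
    exact LinearMap.congr_fun (f.isIntertwining' t) w.1

/-- The functor `Γ^ord`, which sends a representation `V` of a submonoid `P` of `T` to the part of
`Hom_{O[P]}(O[T], V)` on which `t₀` acts locally finitely. -/
def GammaOrd (P : Submonoid T) (t₀ : T) : Rep.{u} O P ⥤ Rep.{u} O T where
  obj V := Rep.of (finPart (Representation.coind P.subtype V.ρ) t₀).toRepresentation
  map f := Rep.ofHom (finPartMap (Representation.coindMap P.subtype f.hom) t₀)

instance (P : Submonoid T) (t₀ : T) : (GammaOrd (O := O) P t₀).Additive where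
  map_add := rfl

end Gamma

instance {O M : Type u} [CommRing O] [Monoid M] : EnoughInjectives (Rep.{u} O M) :=
  EnoughInjectives.of_equivalence (Rep.equivalenceModuleMonoidAlgebra (k := O) (G := M)).functor

section Smooth

variable (F : Type u) [Field F] [ValuativeRel F] [TopologicalSpace F]
  [IsNonarchimedeanLocalField F] (O : Type u) [CommRing O]

/-- Smoothness of a representation of `G`: every vector has an open stabilizer. -/
def isSmooth : ObjectProperty (Rep.{u} O (PGL2 F)) :=
  fun V => ∀ v : V, IsOpen {g : PGL2 F | V.ρ g v = v}

/-- The category `Mod_O^sm(G)` of smooth representations of `G` on `O`-modules. -/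
abbrev SmoothRep := (isSmooth F O).FullSubcategory

variable {F O}

/-- The stabilizer of a vector. -/
def stab {V : Type u} [AddCommGroup V] [Module O V] (ρ : Representation O (PGL2 F) V) (v : V) :
    Subgroup (PGL2 F) where
  carrier := {g | ρ g v = v}
  one_mem' := by simp
  mul_mem' := fun {a b} ha hb => by
    change ρ (a * b) v = v
    rw [map_mul, Module.End.mul_apply, hb, ha]
  inv_mem' := fun {a} ha => by
    change ρ a⁻¹ v = v
    conv_lhs => rw [← (show ρ a v = v from ha)]
    rw [← Module.End.mul_apply, ← map_mul, inv_mul_cancel, map_one, Module.End.one_apply]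

instance : IsTopologicalGroup (PGL2 F) := inferInstance

/-- The smooth vectors of a representation of `G`. -/
def smoothPart {V : Type u} [AddCommGroup V] [Module O V] (ρ : Representation O (PGL2 F) V) :
    Subrepresentation ρ where
  toSubmodule :=
    { carrier := {v | IsOpen (stab ρ v : Set (PGL2 F))}
      zero_mem' := by
        have : (stab ρ (0 : V) : Set (PGL2 F)) = Set.univ :=
          Set.eq_univ_of_forall fun g => map_zero (ρ g)
        simp only [Set.mem_ofPred_eq, this, isOpen_univ]
      add_mem' := fun {a b} ha hb => by
        refine Subgroup.isOpen_mono (H₁ := stab ρ a ⊓ stab ρ b) ?_ (IsOpen.inter ha hb)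
        rintro g ⟨h1, h2⟩
        change ρ g (a + b) = a + b
        rw [map_add, show ρ g a = a from h1, show ρ g b = b from h2]
      smul_mem' := fun c v hv => by
        refine Subgroup.isOpen_mono (H₁ := stab ρ v) ?_ hv
        intro g h
        change ρ g (c • v) = c • v
        rw [map_smul, show ρ g v = v from h] }
  apply_mem_toSubmodule g v hv := by
    have h1 : (stab ρ (ρ g v) : Set (PGL2 F)) = (fun x => g⁻¹ * x * g) ⁻¹' (stab ρ v) := by
      ext x
      change ρ x (ρ g v) = ρ g v ↔ ρ (g⁻¹ * x * g) v = v
      rw [map_mul, map_mul, Module.End.mul_apply, Module.End.mul_apply]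
      constructor
      · intro h
        rw [h, ← Module.End.mul_apply, ← map_mul, inv_mul_cancel, map_one, Module.End.one_apply]
      · intro h
        conv_rhs => rw [← h]
        rw [← Module.End.mul_apply (ρ g), ← map_mul, mul_inv_cancel, map_one, Module.End.one_apply]
    change IsOpen (stab ρ (ρ g v) : Set (PGL2 F))
    rw [h1]
    exact IsOpen.preimage (by fun_prop) hv

/-- The smooth representation formed by the smooth vectors. -/
def smoothObj (V : Rep.{u} O (PGL2 F)) : SmoothRep F O :=
  ⟨Rep.of (smoothPart V.ρ).toRepresentation, fun v => by
    have : {g : PGL2 F | (smoothPart V.ρ).toRepresentation g v = v} =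
        (stab V.ρ (v : V) : Set (PGL2 F)) := by
      ext g
      exact Subtype.ext_iff
    exact this ▸ v.2⟩

instance : (isSmooth F O).IsClosedUnderSubobjects where
  prop_of_mono {X Y} f hf hY v := by
    have hinj := (Rep.mono_iff_injective f).1 hf
    convert hY (f.hom v) using 1
    ext g
    rw [Set.mem_ofPred_eq, Set.mem_ofPred_eq, ← Rep.hom_comm_apply]
    exact hinj.eq_iff.symm

instance : (isSmooth F O).IsClosedUnderQuotients where
  prop_of_epi {X Y} f hf hX w := by
    obtain ⟨v, rfl⟩ := (Rep.epi_iff_surjective f).1 hf w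
    refine Subgroup.isOpen_mono (H₁ := stab X.ρ v) (H₂ := stab Y.ρ (f.hom v)) ?_ (hX v)
    intro g (h : X.ρ g v = v)
    change Y.ρ g (f.hom v) = f.hom v
    rw [← Rep.hom_comm_apply, h]

instance : (isSmooth F O).ContainsZero where
  exists_zero := ⟨Rep.of (Representation.trivial O (PGL2 F) PUnit.{u + 1}),
    (Rep.isZero_iff _ _ _).2 (inferInstanceAs (Subsingleton PUnit)), fun v => by
      simp⟩

instance : (isSmooth F O).IsClosedUnderFiniteProducts where
  isClosedUnderLimitsOfShape J _ := ⟨by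
    rintro X ⟨h⟩ v
    refine Subgroup.isOpen_mono
      (H₁ := ⨅ j : J, stab (h.diag.obj ⟨j⟩).ρ ((h.π.app ⟨j⟩).hom v)) (H₂ := stab X.ρ v) ?_ ?_
    · intro g hg
      have : PreservesLimitsOfSize.{0, 0} (forget₂ (Rep.{u} O (PGL2 F)) (ModuleCat.{u} O)) :=
        preservesLimitsOfSize_shrink _
      refine Concrete.isLimit_ext _ (isLimitOfPreserves (forget₂ (Rep.{u} O (PGL2 F))
        (ModuleCat.{u} O)) h.isLimit) (X.ρ g v) v fun j => ?_
      have h1 := Subgroup.mem_iInf.1 hg j.as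
      exact (Rep.hom_comm_apply (h.π.app j) g v).trans h1
    · rw [Subgroup.coe_iInf]
      exact isOpen_iInter_of_finite fun j => h.prop_diag_obj ⟨j⟩ _⟩

/-- The functor that takes smooth vectors. -/
def smoothFunctor : Rep.{u} O (PGL2 F) ⥤ SmoothRep F O where
  obj V := smoothObj V
  map {V W} f := ObjectProperty.homMk (Rep.ofHom
    { toLinearMap := f.hom.toLinearMap.restrict fun v hv => by
        refine Subgroup.isOpen_mono (H₁ := stab V.ρ v) (H₂ := stab W.ρ (f.hom v)) ?_ hv
        intro g (h : V.ρ g v = v)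
        change W.ρ g (f.hom v) = f.hom v
        rw [← Rep.hom_comm_apply, h]
      isIntertwining' := fun g => by
        ext v
        exact LinearMap.congr_fun (f.hom.isIntertwining' g) v.1 })

/-- Taking smooth vectors is right adjoint to the inclusion of smooth representations. -/
def smoothAdj : (isSmooth F O).ι ⊣ smoothFunctor :=
  Adjunction.mkOfHomEquiv
    { homEquiv := fun V W =>
        { toFun := fun f => ObjectProperty.homMk (Rep.ofHom
            { toLinearMap := f.hom.toLinearMap.codRestrict _ fun v => by
                refine Subgroup.isOpen_mono (H₁ := stab V.obj.ρ v) (H₂ := stab W.ρ (f.hom v)) ?_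
                  (V.property v)
                intro g (h : V.obj.ρ g v = v)
                change W.ρ g (f.hom v) = f.hom v
                have := Rep.hom_comm_apply f g v
                rw [← this]
                exact congrArg f.hom h
              isIntertwining' := fun g => by
                ext v
                exact LinearMap.congr_fun (f.hom.isIntertwining' g) v })
          invFun := fun f => Rep.ofHom
            { toLinearMap := (Submodule.subtype _).comp f.hom.hom.toLinearMap
              isIntertwining' := fun g => by
                ext v
                exact congrArg Subtype.val (LinearMap.congr_fun (f.hom.hom.isIntertwining' g) v) }
          left_inv := fun f => rfl
          right_inv := fun f => rfl }
      homEquiv_naturality_left_symm := fun _ _ => rfl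
      homEquiv_naturality_right := fun _ _ => rfl }

instance : EnoughInjectives (SmoothRep F O) :=
  have := (isSmooth F O).preservesMonomorphisms_ι_of_isNormalEpiCategory
  EnoughInjectives.of_adjunction smoothAdj

end Smooth

section Functors

variable {F : Type u} [Field F] [ValuativeRel F] [TopologicalSpace F]
  [IsNonarchimedeanLocalField F] {O : Type u} [CommRing O]

lemma map_mem_fixedBy {V W : Rep.{u} O (PGL2 F)} (f : V ⟶ W) {K : Subgroup (PGL2 F)} {v : V}
    (hv : v ∈ fixedBy V.ρ K) : f.hom v ∈ fixedBy W.ρ K := fun k hk => by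
  rw [← Rep.hom_comm_apply, hv k hk]

lemma map_heckeOp {V W : Rep.{u} O (PGL2 F)} (f : V ⟶ W) (x : TPlus F) (v : V) :
    f.hom (heckeOp V.ρ x v) = heckeOp W.ρ x (f.hom v) := by
  rw [heckeOp, heckeOp, LinearMap.sum_apply, LinearMap.sum_apply, map_sum]
  exact Finset.sum_congr rfl fun y _ => Rep.hom_comm_apply f _ v

/-- The functor `V ↦ V^{N₀}`, where `T⁺` acts on `V^{N₀}` by Hecke operators. -/
def invN0 : SmoothRep F O ⥤ Rep.{u} O (TPlus F) where
  obj V := Rep.of (heckeRep V.obj.ρ (fixedBy V.obj.ρ (N0 F)) le_rfl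
    fun x _ hv => heckeOp_mem V.obj.ρ hv x)
  map f := Rep.ofHom
    { toLinearMap := f.hom.hom.toLinearMap.restrict fun _ hv => map_mem_fixedBy f.hom hv
      isIntertwining' := fun x => by
        ext v
        exact map_heckeOp f.hom x v.1 }

instance : (invN0 (F := F) (O := O)).Additive where
  map_add := rfl

lemma fixedBy_KH_le {V : Type u} [AddCommGroup V] [Module O V] (ρ : Representation O (PGL2 F) V)
    (H : Subgroup Fˣ) (n : ℕ) : fixedBy ρ (KH H n) ≤ fixedBy ρ (N0 F) :=
  fixedBy_anti ρ le_sup_right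

lemma heckeOp_mem_KH {V : Type u} [AddCommGroup V] [Module O V]
    (ρ : Representation O (PGL2 F) V) {H : Subgroup Fˣ} (hH : H ≤ T0 F) {n : ℕ} (hn : 1 ≤ n)
    (x : TPlus F) (v : V) (hv : v ∈ fixedBy ρ (KH H n)) :
    heckeOp ρ x v ∈ fixedBy ρ (KH H n) := by
  rw [KH, fixedBy_sup, fixedBy_sup] at hv ⊢
  obtain ⟨⟨h1, h2⟩, h3⟩ := hv
  exact ⟨⟨heckeOp_mem_Kn ρ hn h3 h1 x, heckeOp_mem_H ρ hH h3 h2 x⟩, heckeOp_mem ρ h3 x⟩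

/-- The action of `T̄⁺` on `V^{K_H(n)}` by Hecke operators. -/
def heckeRepKH {V : Type u} [AddCommGroup V] [Module O V] (ρ : Representation O (PGL2 F) V)
    {H : Subgroup Fˣ} (hH : H ≤ T0 F) {n : ℕ} (hn : 1 ≤ n) :
    Representation O (TBarPlus H) (fixedBy ρ (KH H n)) :=
  descend hH (heckeRep ρ (fixedBy ρ (KH H n)) (fixedBy_KH_le ρ H n) (heckeOp_mem_KH ρ hH hn))
    fun h hh => by
      ext v
      exact (heckeOp_unit ρ (fixedBy_KH_le ρ H n v.2) h (hH hh)).trans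
        (v.2 _ (Subgroup.mem_sup_left (Subgroup.mem_sup_right ⟨h, hh, rfl⟩)))

/-- The functor `V ↦ V^{K_H(n)}`, where `T̄⁺` acts on `V^{K_H(n)}` by Hecke operators. -/
def invKH {H : Subgroup Fˣ} (hH : H ≤ T0 F) {n : ℕ} (hn : 1 ≤ n) :
    SmoothRep F O ⥤ Rep.{u} O (TBarPlus H) where
  obj V := Rep.of (heckeRepKH V.obj.ρ hH hn)
  map f := Rep.ofHom
    { toLinearMap := f.hom.hom.toLinearMap.restrict fun _ hv => map_mem_fixedBy f.hom hv
      isIntertwining' := fun t => by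
        ext v
        exact map_heckeOp f.hom _ v.1 }

instance {H : Subgroup Fˣ} (hH : H ≤ T0 F) {n : ℕ} (hn : 1 ≤ n) :
    (invKH (O := O) hH hn).Additive where
  map_add := rfl

/-- Emerton's functor of ordinary parts, `Ord (V) = Γ^ord (V^{N₀})`. -/
def Ord [IsNoetherianRing O] (ϖ : Fˣ) : SmoothRep F O ⥤ Rep.{u} O Fˣ :=
  invN0 ⋙ GammaOrd (TPlus F) ϖ

instance [IsNoetherianRing O] (ϖ : Fˣ) : (Ord (O := O) ϖ).Additive :=
  inferInstanceAs (invN0 ⋙ GammaOrd (TPlus F) ϖ).Additive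

/-- The functor `Ord^H (V) = Ord (V)^H`, with its action of `T̄ = T / H`. -/
def OrdH [IsNoetherianRing O] (H : Subgroup Fˣ) (ϖ : Fˣ) :
    SmoothRep F O ⥤ Rep.{u} O (TBar H) :=
  Ord ϖ ⋙ Rep.quotientToInvariantsFunctor O H

instance (H : Subgroup Fˣ) : (Rep.quotientToInvariantsFunctor.{u} O H).Additive where
  map_add := rfl

instance [IsNoetherianRing O] (H : Subgroup Fˣ) (ϖ : Fˣ) : (OrdH (O := O) H ϖ).Additive :=
  inferInstanceAs (Ord ϖ ⋙ Rep.quotientToInvariantsFunctor.{u} O H).Additive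

end Functors

section CompactInduction

variable {F : Type u} [Field F] [ValuativeRel F] [TopologicalSpace F]
  [IsNonarchimedeanLocalField F] {O : Type u} [CommRing O]

variable (F O) in
/-- Left translation on functions on `G`: `(L g Φ) h = Φ (g⁻¹ h)`. -/
def leftRep (W : Type u) [AddCommGroup W] [Module O W] :
    Representation O (PGL2 F) (PGL2 F → W) where
  toFun g := LinearMap.funLeft O W fun h => g⁻¹ * h
  map_one' := by ext; simp [LinearMap.funLeft_apply]
  map_mul' g g' := by ext; simp [LinearMap.funLeft_apply, mul_assoc]

variable (F O) in
/-- Right translation on functions on `G`: `(R g Φ) h = Φ (h g)`. -/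
def rightRep (W : Type u) [AddCommGroup W] [Module O W] :
    Representation O (PGL2 F) (PGL2 F → W) where
  toFun g := LinearMap.funLeft O W fun h => h * g
  map_one' := by ext; simp [LinearMap.funLeft_apply]
  map_mul' g g' := by ext; simp [LinearMap.funLeft_apply, mul_assoc]

lemma Kn_le_K0 (n : ℕ) : Kn F n ≤ K0 F n :=
  Subgroup.map_mono fun _ hA => (mem_congruenceGL.1 hA).2.2.1

lemma N0_le_K0 (n : ℕ) : N0 F ≤ K0 F n := by
  rintro _ ⟨y, rfl⟩
  refine ⟨Matrix.GeneralLinearGroup.upperRightHom y, ?_, ?_⟩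
  · change (Matrix.GeneralLinearGroup.upperRightHom y).val 1 0 ∈ 𝓂[F] ^ n
    simp [Matrix.GeneralLinearGroup.upperRightHom]
  · refine congrArg (QuotientGroup.mk' (Subgroup.center (GL (Fin 2) F))) ?_
    ext i j
    fin_cases i <;> fin_cases j <;> simp [Matrix.GeneralLinearGroup.upperRightHom]

lemma dia_mem_K0 (n : ℕ) {u : Fˣ} (hu : u ∈ T0 F) : dia u ∈ K0 F n := by
  let M : Matrix (Fin 2) (Fin 2) 𝒪[F] := !![⟨u, hu.1⟩, 0; 0, 1]
  have hM : IsUnit M.det := by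
    simp only [M, Matrix.det_fin_two_of, mul_one, mul_zero, sub_zero]
    refine IsUnit.of_mul_eq_one ⟨(u⁻¹ : Fˣ), hu.2⟩ ?_
    exact Subtype.ext (by simp)
  refine ⟨Matrix.GeneralLinearGroup.mk'' M hM, ?_, ?_⟩
  · change M 1 0 ∈ 𝓂[F] ^ n
    simp [M]
  · refine congrArg (QuotientGroup.mk' (Subgroup.center (GL (Fin 2) F))) ?_
    ext i j
    fin_cases i <;> fin_cases j <;> simp [M]

lemma KH_le_K0 {H : Subgroup Fˣ} (hH : H ≤ T0 F) (n : ℕ) : KH H n ≤ K0 F n := by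
  refine sup_le (sup_le (Kn_le_K0 n) ?_) (N0_le_K0 n)
  rintro _ ⟨h, hh, rfl⟩
  exact dia_mem_K0 n (hH hh)

/-- The underlying module of the compact induction `cInd_{K₀(n)}^G W`: the functions `Φ : G → W`
with compact support such that `Φ (k g) = k Φ (g)` for `k ∈ K₀(n)`. Here `k` acts on `W` through
`K₀(n) → K₀(n) / K_H(n) ≅ T̄⁰`, which sends `k` to the class of `u` if `k ∈ K_H(n) δ(u)`. -/
def cIndV {H : Subgroup Fˣ} (n : ℕ) (W : Rep.{u} O (TBar0 H)) : Submodule O (PGL2 F → W) where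
  carrier := {Φ | HasCompactSupport Φ ∧ ∀ k ∈ K0 F n, ∀ u : T0 F,
    k * (dia (u : Fˣ))⁻¹ ∈ KH H n → ∀ g, Φ (k * g) = W.ρ (T0.bar H u) (Φ g)}
  zero_mem' := ⟨HasCompactSupport.zero, fun k _ u _ g => (map_zero _).symm⟩
  add_mem' := fun {Φ Ψ} hΦ hΨ => ⟨hΦ.1.add hΨ.1, fun k hk u hu g => by
    simp only [Pi.add_apply, map_add, hΦ.2 k hk u hu, hΨ.2 k hk u hu]⟩
  smul_mem' := fun c Φ hΦ => ⟨hΦ.1.mono fun g hg h => hg (by simp [h]), fun k hk u hu g => by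
    simp only [Pi.smul_apply, map_smul, hΦ.2 k hk u hu]⟩

/-- The representation `cInd_{K₀(n)}^G W` of `G`, by right translation. -/
def cInd {H : Subgroup Fˣ} (n : ℕ) (W : Rep.{u} O (TBar0 H)) : Rep.{u} O (PGL2 F) :=
  Rep.of (Subrepresentation.toRepresentation (ρ := rightRep F O W)
    { toSubmodule := cIndV n W
      apply_mem_toSubmodule := fun g Φ hΦ =>
        ⟨hΦ.1.comp_homeomorph (Homeomorph.mulRight g), fun k hk u hu h =>
          (congrArg Φ (mul_assoc k h g)).trans (hΦ.2 k hk u hu (h * g))⟩ })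

/-- Equivariance for `K₀(n)` in terms of left translation. -/
lemma mem_cIndV_iff {H : Subgroup Fˣ} (hH : H ≤ T0 F) {n : ℕ} {W : Rep.{u} O (TBar0 H)}
    {Φ : PGL2 F → W} : Φ ∈ cIndV n W ↔ HasCompactSupport Φ ∧
      Φ ∈ fixedBy (leftRep F O W) (KH H n) ∧
      ∀ u : T0 F, leftRep F O W (dia ((u : Fˣ)⁻¹)) Φ =
        (W.ρ (T0.bar H u)).compLeft (PGL2 F) Φ := by
  have hbar : T0.bar H (1 : T0 F) = 1 := Subtype.ext (map_one (QuotientGroup.mk' H))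
  refine and_congr_right fun _ => ⟨fun h => ⟨fun k hk => ?_, fun u => ?_⟩, ?_⟩
  · ext g
    refine (h k⁻¹ (inv_mem (KH_le_K0 hH n hk)) 1 (by simpa using hk) g).trans ?_
    rw [hbar, map_one, Module.End.one_apply]
  · ext g
    have h1 := h (dia (u : Fˣ)) (dia_mem_K0 n u.2) u (by simp [one_mem]) g
    change Φ ((dia ((u : Fˣ)⁻¹))⁻¹ * g) = _
    rw [map_inv, inv_inv, h1]
    rfl
  · rintro ⟨h1, h2⟩ k _ u hu g
    have h3 := congrFun (h1 _ (inv_mem hu)) (dia (u : Fˣ) * g)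
    have h4 := congrFun (h2 u) g
    change Φ ((dia ((u : Fˣ)⁻¹))⁻¹ * g) = _ at h4
    rw [map_inv, inv_inv] at h4
    change Φ ((k * (dia (u : Fˣ))⁻¹)⁻¹⁻¹ * (dia (u : Fˣ) * g)) = Φ (dia (u : Fˣ) * g) at h3
    rw [inv_inv, ← mul_assoc, inv_mul_cancel_right] at h3
    rw [h3, h4]
    rfl

lemma heckeOp_mem_cIndV {H : Subgroup Fˣ} (hH : H ≤ T0 F) {n : ℕ} (hn : 1 ≤ n)
    {W : Rep.{u} O (TBar0 H)} (x : TPlus F) (Φ : PGL2 F → W) (hΦ : Φ ∈ cIndV n W) :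
    heckeOp (leftRep F O W) x Φ ∈ cIndV n W := by
  rw [mem_cIndV_iff hH] at hΦ ⊢
  obtain ⟨h1, h2, h3⟩ := hΦ
  have hN := fixedBy_KH_le _ H n h2
  refine ⟨?_, heckeOp_mem_KH _ hH hn x Φ h2, fun u => ?_⟩
  · rw [heckeOp, LinearMap.sum_apply]
    refine Finset.sum_induction _ HasCompactSupport (fun _ _ => HasCompactSupport.add)
      HasCompactSupport.zero fun y _ => ?_
    exact h1.comp_homeomorph (Homeomorph.mulLeft
      (unip ((Quotient.out y : 𝒪[F]) : F) * dia (x : Fˣ))⁻¹)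
  · let u' : TPlus F := ⟨(u : Fˣ)⁻¹, T0_le_TPlus (inv_mem u.2)⟩
    have e1 := heckeOp_unit (leftRep F O W) (heckeOp_mem (leftRep F O W) hN x) u' (inv_mem u.2)
    have e2 := heckeOp_unit (leftRep F O W) hN u' (inv_mem u.2)
    have e3 : heckeOp (leftRep F O W) u' (heckeOp (leftRep F O W) x Φ) =
        heckeOp (leftRep F O W) x (heckeOp (leftRep F O W) u' Φ) := by
      rw [← heckeOp_mul (leftRep F O W) hN, ← heckeOp_mul (leftRep F O W) hN, mul_comm]
    refine e1.symm.trans (e3.trans ((congrArg _ (e2.trans (h3 u))).trans ?_))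
    rw [heckeOp, LinearMap.sum_apply, LinearMap.sum_apply, map_sum]
    exact Finset.sum_congr rfl fun y _ => funext fun g => rfl

/-- The Hecke action of `T̄⁺` on `cInd_{K₀(n)}^G W`. For `t = δ(x)` with `x ∈ T⁺` it is given by
`(t Φ)(g) = ∑ᵢ Φ (t⁻¹ nᵢ⁻¹ g)`, where the `nᵢ` represent `N₀ / t N₀ t⁻¹`. -/
def cIndHecke {H : Subgroup Fˣ} (hH : H ≤ T0 F) {n : ℕ} (hn : 1 ≤ n) (W : Rep.{u} O (TBar0 H)) :
    Representation O (TBarPlus H) (cIndV n W) :=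
  descend hH (heckeRep (leftRep F O W) (cIndV n W)
    (fun _ hΦ => fixedBy_KH_le _ H n ((mem_cIndV_iff hH).1 hΦ).2.1)
    (heckeOp_mem_cIndV hH hn)) fun h hh => by
      refine LinearMap.ext fun Φ => Subtype.ext ?_
      have h2 := ((mem_cIndV_iff hH).1 Φ.2).2.1
      exact (heckeOp_unit _ (fixedBy_KH_le _ H n h2) h (hH hh)).trans
        (h2 _ (Subgroup.mem_sup_left (Subgroup.mem_sup_right ⟨h, hh, rfl⟩)))

/-- The formula for the Hecke action. -/
lemma cIndHecke_apply {H : Subgroup Fˣ} (hH : H ≤ T0 F) {n : ℕ} (hn : 1 ≤ n)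
    (W : Rep.{u} O (TBar0 H)) (x : TPlus F) (Φ : cIndV n W) (g : PGL2 F) :
    (cIndHecke hH hn W (TPlus.bar H x) Φ).1 g =
      ∑ y : Idx x, Φ.1 ((dia (x : Fˣ))⁻¹ * (unip ((Quotient.out y : 𝒪[F]) : F))⁻¹ * g) := by
  rw [cIndHecke, descend_bar]
  change heckeOp (leftRep F O W) x Φ.1 g = _
  rw [heckeOp, LinearMap.sum_apply, Finset.sum_apply]
  refine Finset.sum_congr rfl fun y _ => ?_
  rw [← mul_inv_rev]
  rfl

/-- The Hecke action commutes with the action of `G`. -/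
def cIndHeckeHom {H : Subgroup Fˣ} (hH : H ≤ T0 F) {n : ℕ} (hn : 1 ≤ n)
    (W : Rep.{u} O (TBar0 H)) (t : TBarPlus H) : cInd n W ⟶ cInd n W :=
  Rep.ofHom
    { toLinearMap := cIndHecke hH hn W t
      isIntertwining' := fun g => by
        obtain ⟨x, rfl⟩ := TPlus.bar_surjective H t
        refine LinearMap.ext fun Φ => Subtype.ext (funext fun h => ?_)
        refine (cIndHecke_apply hH hn W x _ h).trans
          (Eq.trans ?_ (cIndHecke_apply hH hn W x Φ (h * g)).symm)
        refine Finset.sum_congr rfl fun y _ => ?_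
        rw [← mul_assoc _ h g]
        rfl }

/-- The representation of `T̄⁺` on `Hom_{O[G]}(cInd_{K₀(n)}^G W, V)`, where `t` sends `f` to the map
`Φ ↦ f (t Φ)`. -/
def homRep {H : Subgroup Fˣ} (hH : H ≤ T0 F) {n : ℕ} (hn : 1 ≤ n) (W : Rep.{u} O (TBar0 H))
    (V : Rep.{u} O (PGL2 F)) : Rep.{u} O (TBarPlus H) :=
  Rep.of
    { toFun := fun t =>
        { toFun := fun f : cInd n W ⟶ V => cIndHeckeHom hH hn W t ≫ f
          map_add' := fun f f' => Preadditive.comp_add _ _ _ _ _ _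
          map_smul' := fun c f => Linear.comp_smul _ _ _ _ _ _ }
      map_one' := by
        refine LinearMap.ext fun f => ?_
        have : cIndHeckeHom hH hn W 1 = 𝟙 _ :=
          Rep.hom_ext (Representation.IntertwiningMap.ext (map_one (cIndHecke hH hn W)))
        change cIndHeckeHom hH hn W 1 ≫ f = f
        rw [this, Category.id_comp]
      map_mul' := fun t t' => by
        refine LinearMap.ext fun f => ?_
        have : cIndHeckeHom hH hn W (t * t') =
            cIndHeckeHom hH hn W t ≫ cIndHeckeHom hH hn W t' :=
          Rep.hom_ext (Representation.IntertwiningMap.ext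
            ((congrArg (cIndHecke hH hn W) (mul_comm t t')).trans
              (map_mul (cIndHecke hH hn W) t' t)))
        change cIndHeckeHom hH hn W (t * t') ≫ f = _
        rw [this, Category.assoc]
        rfl }

end CompactInduction

section Convergence

variable {C : Type*} [Category C] [Abelian C]

/-- Convergence of a first quadrant spectral sequence `E` to the objects `A m`: for every `m` there
is a finite decreasing filtration of `A m` whose graded pieces are the `E_∞^{p,q}` with
`p + q = m`. On the antidiagonal `p + q = m` the pages `E_r` with `r ≥ m + 2` are `E_∞`. -/
def ConvergesTo (E : E₂CohomologicalSpectralSequenceNat C) (A : ℕ → C) : Prop :=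
  ∀ m : ℕ, ∃ (Fil : ℕ → Subobject (A m)) (hFil : Antitone Fil), Fil 0 = ⊤ ∧ Fil (m + 1) = ⊥ ∧
    ∀ p q : ℕ, p + q = m → ∀ (r : ℤ) (hr : 2 ≤ r), (m : ℤ) + 2 ≤ r →
      Nonempty (cokernel (Subobject.ofLE (Fil (p + 1)) (Fil p) (hFil p.le_succ)) ≅
        (E.page r hr).X (p, q))

end Convergence
end
end PGLOrd

/-! Call a polynomial over `O` admissible if it is monic with constant coefficient `1`. Modulo an
admissible `Q` the variable is invertible, and `O[X]/(Q)` is finite over `O`. Conversely,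
Cayley–Hamilton for `t₀` and for its inverse shows that every `t₀`-finite element is killed by some
admissible `Q(t₀)`. As `t₀` is bijective on the kernel of `Q(t₀)`, and every element of `T̄` lies in
`T̄⁺` after multiplication by a power of `t₀`, evaluation at `1` identifies `Γ^ord(V)` with the
union of the kernels of all admissible `Q(t₀)` on `V`.

Call `V` divisible if every admissible `Q(t₀)` is surjective on `V`. Quotients of divisible objects
are divisible. Injective objects are divisible, because `Q(t₀)` is injective on `O[T̄⁺]`. A snake
argument makes `Γ^ord` exact on short exact sequences with divisible kernel
(`gammaOrd_isAcyclicClass`). Hence divisible objects are acyclic; and since all later cosyzygies in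
an injective resolution are quotients of injectives, `R^q Γ^ord = 0` for `q ≥ 2`.

Injectivity of `Q(a)` always comes from `aeval_injective_of_filtration`. If `Q(a) v = 0`, then `O[a]
v` is finitely generated and `a` maps it onto itself. So it lies in one step of an exhaustive
filtration; if some power of `a` pushes that step off itself, then `v = 0`. This applies to `cInd W`
and to `O[G / K_H(n)]`, filtered by supports in bounded subsets of `G`: a large power of `δ(ϖ)`
leaves every bounded set. Extending maps into an injective `I` along the monomorphism `Q(t₀)` shows
that `Hom(cInd W, I)` and `I^{K_H(n)} = Hom(O[G / K_H(n)], I)` are divisible. The first of these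
gives (1).

For (2), Hecke operators contract the lower unipotent direction, so that `t₀`-finite elements of
`Ord(V)^H` take values in `V^{K_H(n)}`, and `Ord^H(V) = Γ^ord(V^{K_H(n)})`. The spectral sequence of
this composite has only the columns `0` and `1`, so its differentials vanish and it amounts to short
exact sequences with outer terms `R¹Γ^ord(H^m)` and `Γ^ord(H^{m+1})`. These are universal
coefficient sequences, obtained by cutting a complex of divisible objects into cycles and
boundaries. -/

set_option linter.unusedSectionVars false

namespace PGLOrd

noncomputable section

/-! ### Left exact functors with an acyclic class and their derived functors. -/

section AcyclicClass

variable {C D : Type*} [Category C] [Category D] [Abelian C] [Abelian D]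

/-- A class of objects, containing the injective objects and closed under quotients, such that `Γ`
is right exact on short exact sequences whose kernel belongs to the class. -/
structure IsAcyclicClass (Γ : C ⥤ D) (A : ObjectProperty C) : Prop where
  of_injective (X : C) [Injective X] : A X
  of_epi {X Y : C} (f : X ⟶ Y) [Epi f] : A X → A Y
  epi_map {S : ShortComplex C} : S.ShortExact → A S.X₁ → Epi (Γ.map S.g)

section LeftExact

variable (Γ : C ⥤ D) [Γ.Additive] [PreservesFiniteLimits Γ]

/-- A left exact functor commutes with the formation of cycles. -/
def cyclesMapIso (K : CochainComplex C ℕ) (i : ℕ) :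
    ((Γ.mapHomologicalComplex _).obj K).cycles i ≅ Γ.obj (K.cycles i) :=
  IsLimit.conePointUniqueUpToIso
    (((Γ.mapHomologicalComplex _).obj K).cyclesIsKernel i (i + 1) (by simp))
    (KernelFork.mapIsLimit _ (K.cyclesIsKernel i (i + 1) (by simp)) Γ)

lemma cyclesMapIso_hom_comp (K : CochainComplex C ℕ) (i : ℕ) :
    (cyclesMapIso Γ K i).hom ≫ Γ.map (K.iCycles i) =
      ((Γ.mapHomologicalComplex _).obj K).iCycles i :=
  IsLimit.conePointUniqueUpToIso_hom_comp _ _ WalkingParallelPair.zero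

lemma toCycles_cyclesMapIso_hom (K : CochainComplex C ℕ) (i j : ℕ) :
    ((Γ.mapHomologicalComplex _).obj K).toCycles i j ≫ (cyclesMapIso Γ K j).hom =
      Γ.map (K.toCycles i j) := by
  refine (cancel_mono (Γ.map (K.iCycles j))).1 ?_
  refine (Category.assoc _ _ _).trans ?_
  rw [cyclesMapIso_hom_comp]
  refine (HomologicalComplex.toCycles_i _ _ _).trans (Eq.trans ?_ (Γ.map_comp _ _))
  rw [HomologicalComplex.toCycles_i]
  rfl

/-- The homology of the image of a complex under a left exact functor. -/
def homologySuccIso (K : CochainComplex C ℕ) (i : ℕ) :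
    ((Γ.mapHomologicalComplex _).obj K).homology (i + 1) ≅
      cokernel (Γ.map (K.toCycles i (i + 1))) :=
  (((Γ.mapHomologicalComplex _).obj K).homologyIsCokernel i (i + 1)
    (by simp)).coconePointUniqueUpToIso (cokernelIsCokernel _) ≪≫
    cokernel.mapIso _ _ (Iso.refl _) (cyclesMapIso Γ K (i + 1))
      ((toCycles_cyclesMapIso_hom Γ K i (i + 1)).trans (Category.id_comp _).symm)

/-- A left exact functor commutes with homology in degree zero. -/
def homologyZeroIso (K : CochainComplex C ℕ) :
    ((Γ.mapHomologicalComplex _).obj K).homology 0 ≅ Γ.obj (K.homology 0) :=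
  (CochainComplex.isoHomologyπ₀ _).symm ≪≫ cyclesMapIso Γ K 0 ≪≫
    Γ.mapIso (CochainComplex.isoHomologyπ₀ K)

end LeftExact

namespace IsAcyclicClass

variable {Γ : C ⥤ D} {A : ObjectProperty C} (h : IsAcyclicClass Γ A)

include h

lemma of_iso {X Y : C} (e : X ≅ Y) (hX : A X) : A Y := h.of_epi e.hom hX

lemma epi_map_of_kernel {X Y : C} (f : X ⟶ Y) [Epi f] (hf : A (kernel f)) : Epi (Γ.map f) :=
  h.epi_map (S := ShortComplex.mk (kernel.ι f) f (kernel.condition f))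
    { exact := ShortComplex.exact_kernel f
      mono_f := inferInstanceAs (Mono (kernel.ι f))
      epi_g := inferInstanceAs (Epi f) } hf

variable [Γ.Additive] [PreservesFiniteLimits Γ]

/-- By exactness `K.X i → K.cycles (i + 1)` is an epimorphism, and its kernel is that of the
differential. So `Γ` keeps it epi, and the homology in question is the cokernel of the resulting
map. -/
lemma isZero_homology_succ {K : CochainComplex C ℕ} {i : ℕ} (hK : K.ExactAt (i + 1))
    (hi : A (kernel (K.d i (i + 1)))) :
    IsZero (((Γ.mapHomologicalComplex _).obj K).homology (i + 1)) := by
  have : Epi (K.toCycles i (i + 1)) :=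
    Preadditive.epi_of_isZero_cokernel' _ (K.homologyIsCokernel i (i + 1) (by simp))
      hK.isZero_homology
  have hk : A (kernel (K.toCycles i (i + 1))) :=
    h.of_iso ((kernelIsoOfEq (K.toCycles_i i (i + 1)).symm).trans
      (kernelCompMono (K.toCycles i (i + 1)) (K.iCycles (i + 1)))) hi
  have := h.epi_map_of_kernel _ hk
  exact (isZero_cokernel_of_epi _).of_iso (homologySuccIso Γ K i)

/-- By exactness this kernel is a quotient of the injective object in degree `i`, whatever `X` is.
This is the source of cohomological dimension at most one. -/
lemma kernel_d_succ {X : C} (I : InjectiveResolution X) (i : ℕ) :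
    A (kernel (I.cocomplex.d (i + 1) (i + 2))) :=
  have := (I.exact_succ i).epi_kernelLift
  h.of_epi (kernel.lift _ _ (I.complex_d_comp i)) (h.of_injective _)

lemma kernel_d_zero {X : C} (I : InjectiveResolution X) (hX : A X) :
    A (kernel (I.cocomplex.d 0 1)) :=
  h.of_iso (IsLimit.conePointUniqueUpToIso I.isLimitKernelFork (limit.isLimit _)) hX

variable [EnoughInjectives C]

/-- The objects of an acyclic class are acyclic. -/
lemma isZero_rightDerived {X : C} (hX : A X) (q : ℕ) :
    IsZero ((Γ.rightDerived (q + 1)).obj X) := by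
  let I := injectiveResolution X
  refine IsZero.of_iso ?_ (I.isoRightDerivedObj Γ (q + 1))
  refine h.isZero_homology_succ (I.cocomplex_exactAt_succ q) ?_
  cases q with
  | zero => exact h.kernel_d_zero I hX
  | succ q => exact h.kernel_d_succ I q

/-- A functor with an acyclic class has cohomological dimension at most one. -/
lemma isZero_rightDerived_add_two (X : C) (q : ℕ) :
    IsZero ((Γ.rightDerived (q + 2)).obj X) := by
  let I := injectiveResolution X
  refine IsZero.of_iso ?_ (I.isoRightDerivedObj Γ (q + 2))
  exact h.isZero_homology_succ (I.cocomplex_exactAt_succ (q + 1)) (h.kernel_d_succ I q)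

end IsAcyclicClass

section Pushout

/-- If `q` is a cokernel of `a` and `q'` is a cokernel of `b`, then `b ≫ q` and `a ≫ q'` have
isomorphic cokernels. -/
def cokernelCompIso {X Y P Q Q' : D} {a : X ⟶ P} {b : Y ⟶ P} {q : P ⟶ Q} {q' : P ⟶ Q'}
    (w : a ≫ q = 0) (hq : IsColimit (CokernelCofork.ofπ q w))
    (w' : b ≫ q' = 0) (hq' : IsColimit (CokernelCofork.ofπ q' w')) :
    cokernel (b ≫ q) ≅ cokernel (a ≫ q') :=
  have he : Epi q := epi_of_isColimit_cofork hq
  have he' : Epi q' := epi_of_isColimit_cofork hq'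
  -- Both cokernels are `P` modulo the images of `a` and `b`.
  let u := CokernelCofork.IsColimit.desc' hq (q' ≫ cokernel.π (a ≫ q'))
    ((Category.assoc _ _ _).symm.trans (cokernel.condition _))
  let v := CokernelCofork.IsColimit.desc' hq' (q ≫ cokernel.π (b ≫ q))
    ((Category.assoc _ _ _).symm.trans (cokernel.condition _))
  have hu : q ≫ u.1 = q' ≫ cokernel.π (a ≫ q') := u.2
  have hv : q' ≫ v.1 = q ≫ cokernel.π (b ≫ q) := v.2
  { hom := cokernel.desc _ u.1 (by rw [Category.assoc, hu, ← Category.assoc, w', zero_comp])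
    inv := cokernel.desc _ v.1 (by rw [Category.assoc, hv, ← Category.assoc, w, zero_comp])
    hom_inv_id := by
      rw [← cancel_epi (cokernel.π (b ≫ q)), ← cancel_epi q]
      simp [reassoc_of% hu, hv]
    inv_hom_id := by
      rw [← cancel_epi (cokernel.π (a ≫ q')), ← cancel_epi q']
      simp [reassoc_of% hv, hu] }

/-- The pushout of the monomorphisms of two short exact sequences with the same kernel is an
extension of the third term of the second sequence by the middle term of the first. -/
lemma shortExact_pushout {S S' : ShortComplex C} (hS' : S'.ShortExact)
    {P : C} {l : S.X₂ ⟶ P} {r : S'.X₂ ⟶ P} {e : S.X₁ ⟶ S'.X₁} [Epi e]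
    (hP : IsPushout S.f (e ≫ S'.f) l r) [Mono l] {q : P ⟶ S'.X₃} (hl : l ≫ q = 0)
    (hr : r ≫ q = S'.g) : (ShortComplex.mk l q hl).ShortExact := by
  have : Epi S'.g := hS'.epi_g
  have : Epi q := epi_of_epi_fac hr
  refine { exact := ShortComplex.exact_of_g_is_cokernel _ ?_, mono_f := ‹_›, epi_g := ‹_› }
  refine CokernelCofork.IsColimit.ofπ' _ _ fun {Z} k hk => ?_
  have h0 : S'.f ≫ r ≫ k = 0 := by
    rw [← cancel_epi e, comp_zero, ← Category.assoc, ← Category.assoc, ← hP.w, Category.assoc]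
    exact (congrArg (S.f ≫ ·) hk).trans comp_zero
  refine ⟨(CokernelCofork.IsColimit.desc' hS'.gIsCokernel (r ≫ k) h0).1, ?_⟩
  have h1 := (CokernelCofork.IsColimit.desc' hS'.gIsCokernel (r ≫ k) h0).2
  refine hP.hom_ext ?_ ?_
  · rw [reassoc_of% hl, zero_comp]
    exact hk.symm
  · rw [reassoc_of% hr]
    exact h1

end Pushout

namespace IsAcyclicClass

variable {Γ : C ⥤ D} {A : ObjectProperty C} (h : IsAcyclicClass Γ A) [Γ.Additive]
  [PreservesFiniteLimits Γ]

include h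

lemma map_exact {S : ShortComplex C} (hS : S.ShortExact) (h1 : A S.X₁) :
    (S.map Γ).ShortExact :=
  have := hS.mono_f
  { exact := hS.exact.map_of_mono_of_preservesKernel Γ ‹_› inferInstance
    mono_f := inferInstanceAs (Mono (Γ.map S.f))
    epi_g := h.epi_map hS h1 }

/-- The cokernel of `Γ B → Γ (B / X)` for `B` in an acyclic class depends only on `X`. -/
lemma cokernel_iso {S S' : ShortComplex C} (hS : S.ShortExact) (hS' : S'.ShortExact)
    (e : S.X₁ ≅ S'.X₁) (h2 : A S.X₂) (h2' : A S'.X₂) :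
    Nonempty (cokernel (Γ.map S.g) ≅ cokernel (Γ.map S'.g)) := by
  have := hS.mono_f
  have := hS'.mono_f
  -- `P` is an extension of `S'.X₃` by `S.X₂` and also one of `S.X₃` by `S'.X₂`. `Γ` is exact on
  -- both extensions, so both cokernels are `Γ P` modulo the images of `Γ S.X₂` and `Γ S'.X₂`.
  let P := pushout S.f (e.hom ≫ S'.f)
  let l : S.X₂ ⟶ P := pushout.inl _ _
  let r : S'.X₂ ⟶ P := pushout.inr _ _
  have hP : IsPushout S.f (e.hom ≫ S'.f) l r := IsPushout.of_hasPushout _ _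
  have hP' : IsPushout S'.f (e.inv ≫ S.f) r l := by
    have h1 : IsPushout (e.hom ≫ S'.f) S.f r l := hP.flip
    exact IsPushout.of_iso h1 e (Iso.refl _) (Iso.refl _) (Iso.refl _) (by simp) (by simp)
      (by simp) (by simp)
  have : Mono l := inferInstanceAs (Mono (pushout.inl _ _))
  have : Mono r := inferInstanceAs (Mono (pushout.inr _ _))
  obtain ⟨q, hq1, hq2⟩ : ∃ q : P ⟶ S'.X₃, l ≫ q = 0 ∧ r ≫ q = S'.g :=
    ⟨hP.desc 0 S'.g (by simp), hP.inl_desc _ _ _, hP.inr_desc _ _ _⟩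
  obtain ⟨q', hq1', hq2'⟩ : ∃ q' : P ⟶ S.X₃, r ≫ q' = 0 ∧ l ≫ q' = S.g :=
    ⟨hP.desc S.g 0 (by simp), hP.inr_desc _ _ _, hP.inl_desc _ _ _⟩
  have s1 := h.map_exact (shortExact_pushout hS' hP hq1 hq2) h2
  have s2 := h.map_exact (shortExact_pushout hS hP' hq1' hq2') h2'
  have := s1.epi_g
  have := s2.epi_g
  have E := cokernelCompIso _ s2.exact.gIsCokernel _ s1.exact.gIsCokernel
  refine ⟨cokernelIsoOfEq ?_ ≪≫ E ≪≫ cokernelIsoOfEq ?_⟩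
  · rw [← hq2', Γ.map_comp]
    rfl
  · rw [← hq2, Γ.map_comp]
    rfl

variable [EnoughInjectives C]

/-- The first derived functor computed with a short exact sequence whose middle term belongs to an
acyclic class. -/
lemma rightDerived_one_iso {S : ShortComplex C} (hS : S.ShortExact) (h2 : A S.X₂) :
    Nonempty ((Γ.rightDerived 1).obj S.X₁ ≅ cokernel (Γ.map S.g)) := by
  let I := injectiveResolution S.X₁
  let K := I.cocomplex
  have hz : (I.ι.f 0 : S.X₁ ⟶ K.X 0) ≫ K.toCycles 0 1 = 0 := by
    rw [← cancel_mono (K.iCycles 1), Category.assoc, K.toCycles_i, zero_comp]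
    exact I.ι_f_zero_comp_complex_d
  -- The start `0 → S.X₁ → I⁰ → Z¹ → 0` of the resolution is the sequence to compare with: its
  -- cokernel under `Γ` is the derived functor by definition.
  let S' : ShortComplex C := ShortComplex.mk (I.ι.f 0 : S.X₁ ⟶ K.X 0) (K.toCycles 0 1) hz
  have hS' : S'.ShortExact :=
    { exact := by
        let φ : S' ⟶ ShortComplex.mk (I.ι.f 0 : S.X₁ ⟶ K.X 0) (K.d 0 1)
            I.ι_f_zero_comp_complex_d :=
          { τ₁ := 𝟙 _
            τ₂ := 𝟙 _
            τ₃ := K.iCycles 1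
            comm₁₂ := (Category.id_comp _).trans (Category.comp_id _).symm
            comm₂₃ := by simp [S'] }
        have : Epi φ.τ₁ := inferInstanceAs (Epi (𝟙 S.X₁))
        have : IsIso φ.τ₂ := inferInstanceAs (IsIso (𝟙 (K.X 0)))
        have : Mono φ.τ₃ := inferInstanceAs (Mono (K.iCycles 1))
        exact (ShortComplex.exact_iff_of_epi_of_isIso_of_mono φ).2 I.exact₀
      mono_f := inferInstanceAs (Mono (I.ι.f 0))
      epi_g := Preadditive.epi_of_isZero_cokernel' _ (K.homologyIsCokernel 0 1 (by simp))
        (I.cocomplex_exactAt_succ 0).isZero_homology }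
  obtain ⟨E⟩ := h.cokernel_iso hS hS' (Iso.refl _) h2 (h.of_injective _)
  exact ⟨I.isoRightDerivedObj Γ 1 ≪≫ homologySuccIso Γ K 0 ≪≫ E.symm⟩

/-- The kernel is the image of the incoming differential, hence a quotient of a term of `K`. In
degree `0` the value of `prev` is again `0` and the differential is zero, so no separate case is
needed. -/
lemma epi_map_pOpcycles {K : CochainComplex C ℕ} (hK : ∀ i, A (K.X i)) (i : ℕ) :
    Epi (Γ.map (K.pOpcycles i)) := by
  refine h.epi_map_of_kernel _ ?_
  have hS : (ShortComplex.mk (K.d ((ComplexShape.up ℕ).prev i) i) (K.pOpcycles i)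
      (K.d_pOpcycles _ _)).Exact :=
    ShortComplex.exact_of_g_is_cokernel _ (K.opcyclesIsCokernel _ i rfl)
  have := hS.epi_kernelLift
  exact h.of_epi (kernel.lift _ _ (K.d_pOpcycles ((ComplexShape.up ℕ).prev i) i)) (hK _)

/-- The universal coefficient sequence for the image under `Γ` of a complex whose terms belong to an
acyclic class. -/
lemma exists_shortExact_homology {K : CochainComplex C ℕ} (hK : ∀ i, A (K.X i)) (i : ℕ) :
    ∃ S : ShortComplex D, S.ShortExact ∧
      Nonempty (S.X₁ ≅ (Γ.rightDerived 1).obj (K.homology i)) ∧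
      Nonempty (S.X₂ ≅ ((Γ.mapHomologicalComplex _).obj K).homology (i + 1)) ∧
      Nonempty (S.X₃ ≅ Γ.obj (K.homology (i + 1))) := by
  -- In terms of boundaries `B` and cycles `Z`, the map `f` factors as `Kⁱ/Bⁱ → Bⁱ⁺¹ → Zⁱ⁺¹`. The
  -- first arrow `e` has kernel `Hⁱ`, the second arrow `m` has cokernel `Hⁱ⁺¹`, and `Kⁱ/Bⁱ` and
  -- `Bⁱ⁺¹` are in the class as quotients of `Kⁱ`.
  let f := K.opcyclesToCycles i (i + 1)
  let e := factorThruImage f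
  let m := image.ι f
  have hem : e ≫ m = f := image.fac f
  have := h.epi_map_pOpcycles hK i
  have hop : A (K.opcycles i) := h.of_epi (K.pOpcycles i) (hK i)
  have him : A (image f) := h.of_epi e hop
  have hex := HomologicalComplex.HomologySequence.composableArrows₃_exact K i (i + 1) (by simp)
  have z1 : K.homologyι i ≫ e = 0 := by
    rw [← cancel_mono m, Category.assoc, hem, zero_comp]
    exact K.homologyι_opcyclesToCycles i (i + 1)
  have s1 : (ShortComplex.mk (K.homologyι i) e z1).ShortExact :=
    { exact := by
        let φ : ShortComplex.mk (K.homologyι i) e z1 ⟶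
            ShortComplex.mk (K.homologyι i) f (K.homologyι_opcyclesToCycles i (i + 1)) :=
          { τ₁ := 𝟙 _
            τ₂ := 𝟙 _
            τ₃ := m
            comm₂₃ := (Category.id_comp _).trans hem.symm }
        have : Epi φ.τ₁ := inferInstanceAs (Epi (𝟙 (K.homology i)))
        have : IsIso φ.τ₂ := inferInstanceAs (IsIso (𝟙 (K.opcycles i)))
        have : Mono φ.τ₃ := inferInstanceAs (Mono m)
        exact (ShortComplex.exact_iff_of_epi_of_isIso_of_mono φ).2 (hex.exact 0)
      mono_f := inferInstanceAs (Mono (K.homologyι i))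
      epi_g := inferInstanceAs (Epi e) }
  have z2 : m ≫ K.homologyπ (i + 1) = 0 := by
    rw [← cancel_epi e, ← Category.assoc, hem, comp_zero]
    exact K.opcyclesToCycles_homologyπ i (i + 1)
  have s2 : (ShortComplex.mk m (K.homologyπ (i + 1)) z2).ShortExact :=
    { exact := by
        let φ : ShortComplex.mk f (K.homologyπ (i + 1))
            (K.opcyclesToCycles_homologyπ i (i + 1)) ⟶ ShortComplex.mk m (K.homologyπ (i + 1)) z2 :=
          { τ₁ := e
            τ₂ := 𝟙 _
            τ₃ := 𝟙 _
            comm₁₂ := hem.trans (Category.comp_id _).symm }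
        have : Epi φ.τ₁ := inferInstanceAs (Epi e)
        have : IsIso φ.τ₂ := inferInstanceAs (IsIso (𝟙 (K.cycles (i + 1))))
        have : Mono φ.τ₃ := inferInstanceAs (Mono (𝟙 (K.homology (i + 1))))
        exact (ShortComplex.exact_iff_of_epi_of_isIso_of_mono φ).1 (hex.exact 1)
      mono_f := inferInstanceAs (Mono m)
      epi_g := inferInstanceAs (Epi (K.homologyπ (i + 1))) }
  have s3 := h.map_exact s2 him
  have := s3.epi_g
  -- As `Γ.map m` is mono, the kernel-cokernel sequence of the composite reduces to a short exact
  -- sequence of cokernels. Its terms are `R¹Γ(Hⁱ)`, the homology of `Γ K` (because `Γ Kⁱ →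
  -- Γ(Kⁱ/Bⁱ)` is epi), and `Γ(Hⁱ⁺¹)`.
  have hseq := kernelCokernelCompSequence_exact (Γ.map e) (Γ.map m)
  have hmono : Mono (cokernel.map (Γ.map e) (Γ.map e ≫ Γ.map m) (𝟙 _) (Γ.map m) (by simp)) := by
    refine (hseq.exact 2).mono_g ?_
    exact (isZero_kernel_of_mono (Γ.map m)).eq_of_src _ _
  have hepi : Epi (cokernel.map (Γ.map e ≫ Γ.map m) (Γ.map m) (Γ.map e) (𝟙 _) (by simp)) := by
    infer_instance
  obtain ⟨E1⟩ := h.rightDerived_one_iso s1 hop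
  refine ⟨_, { exact := hseq.exact 3, mono_f := hmono, epi_g := hepi }, ⟨E1.symm⟩, ⟨?_⟩, ⟨?_⟩⟩
  · refine Iso.symm (homologySuccIso Γ K i ≪≫ cokernelIsoOfEq ?_ ≪≫
      cokernelEpiComp (Γ.map (K.pOpcycles i)) (Γ.map e ≫ Γ.map m))
    rw [← Γ.map_comp, ← Γ.map_comp, hem]
    exact congrArg Γ.map (K.pOpcycles_opcyclesToCycles i (i + 1)).symm
  · exact (cokernelIsCokernel (Γ.map m)).coconePointUniqueUpToIso s3.exact.gIsCokernel

variable {B : Type*} [Category B] [Abelian B] [EnoughInjectives B]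

/-- The exact sequence that relates the derived functors of a composite functor to those of the
factors, when the second factor has an acyclic class to which the first one sends injectives. -/
lemma exists_shortExact_rightDerived (G : B ⥤ C) [G.Additive]
    (hG : ∀ I : B, Injective I → A (G.obj I)) (V : B) (i : ℕ) :
    ∃ S : ShortComplex D, S.ShortExact ∧
      Nonempty (S.X₁ ≅ (Γ.rightDerived 1).obj ((G.rightDerived i).obj V)) ∧
      Nonempty (S.X₂ ≅ ((G ⋙ Γ).rightDerived (i + 1)).obj V) ∧
      Nonempty (S.X₃ ≅ (Γ.rightDerived 0).obj ((G.rightDerived (i + 1)).obj V)) := by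
  let I := injectiveResolution V
  -- Applying `Γ` to `K` gives, by definition, the image of the resolution under `G ⋙ Γ`.
  let K := (G.mapHomologicalComplex (ComplexShape.up ℕ)).obj I.cocomplex
  obtain ⟨S, hS, ⟨e1⟩, ⟨e2⟩, ⟨e3⟩⟩ :=
    h.exists_shortExact_homology (K := K) (fun j => hG _ (I.injective j)) i
  exact ⟨S, hS, ⟨e1 ≪≫ (Γ.rightDerived 1).mapIso (I.isoRightDerivedObj G i).symm⟩,
    ⟨e2 ≪≫ (I.isoRightDerivedObj (G ⋙ Γ) (i + 1)).symm⟩,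
    ⟨e3 ≪≫ Γ.mapIso (I.isoRightDerivedObj G (i + 1)).symm ≪≫
      (Γ.rightDerivedZeroIsoSelf.app _).symm⟩⟩

omit h in
lemma rightDerived_zero_iso (G : B ⥤ C) [G.Additive] (V : B) :
    Nonempty (((G ⋙ Γ).rightDerived 0).obj V ≅
      (Γ.rightDerived 0).obj ((G.rightDerived 0).obj V)) := by
  let I := injectiveResolution V
  exact ⟨I.isoRightDerivedObj (G ⋙ Γ) 0 ≪≫ homologyZeroIso Γ
    ((G.mapHomologicalComplex (ComplexShape.up ℕ)).obj I.cocomplex) ≪≫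
    Γ.mapIso (I.isoRightDerivedObj G 0).symm ≪≫ (Γ.rightDerivedZeroIsoSelf.app _).symm⟩

end IsAcyclicClass

end AcyclicClass

/-! ### Two-column spectral sequences. -/

section Degenerate

variable {C : Type*} [Category C] [Abelian C]

/-- The spectral sequence with given second page and zero differentials. If only the columns `0`
and `1` of the second page are nonzero, this is the only possibility, since the differential `d_r`
raises the column by `r ≥ 2`. -/
def degenerate (X : ℕ → ℕ → C) : E₂CohomologicalSpectralSequenceNat C where
  page r _ :=
    { X := fun pq => X pq.1 pq.2
      d := fun _ _ => 0 }
  iso r r' pq _ _ := (ShortComplex.LeftHomologyData.ofZeros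
    (HomologicalComplex.sc (HomologicalComplex.mk (fun pq : ℕ × ℕ => X pq.1 pq.2)
      (fun _ _ => 0)) pq) rfl rfl).homologyIso

lemma subobject_bot_isZero (X : C) : IsZero ((⊥ : Subobject X) : C) :=
  (isZero_zero C).of_iso Subobject.botCoeIsoZero

/-- A spectral sequence with zero differentials and two nonzero columns converges to extensions of
the entries on the antidiagonals. -/
lemma degenerate_convergesTo {X : ℕ → ℕ → C} {Y : ℕ → C}
    (hX : ∀ r s, IsZero (X (r + 2) s)) (h0 : Nonempty (Y 0 ≅ X 0 0))
    (hS : ∀ m, ∃ S : ShortComplex C, S.ShortExact ∧ Nonempty (S.X₁ ≅ X 1 m) ∧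
      Nonempty (S.X₂ ≅ Y (m + 1)) ∧ Nonempty (S.X₃ ≅ X 0 (m + 1))) :
    ConvergesTo (degenerate X) Y := by
  -- `Z` is the contribution of column `1` to `Y m`. Taking `Z = 0` for `m = 0` lets one three-step
  -- filtration serve all degrees.
  have key : ∀ m, ∃ (Z : C) (a : Z ⟶ Y m), Mono a ∧ Nonempty (cokernel a ≅ X 0 m) ∧
      (∀ q, 1 + q = m → Nonempty (Z ≅ X 1 q)) ∧ (m = 0 → IsZero Z) := by
    rintro (_ | m)
    · obtain ⟨e⟩ := h0
      exact ⟨(HasZeroObject.zero' C).zero, 0, inferInstance, ⟨cokernelZeroIsoTarget ≪≫ e⟩,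
        fun q hq => by omega, fun _ => isZero_zero C⟩
    · obtain ⟨S, hS, ⟨e1⟩, ⟨e2⟩, ⟨e3⟩⟩ := hS m
      have := hS.mono_f
      have := hS.epi_g
      refine ⟨S.X₁, S.f ≫ e2.hom, inferInstance, ⟨cokernelCompIsIso _ _ ≪≫
        (cokernelIsCokernel S.f).coconePointUniqueUpToIso hS.exact.gIsCokernel ≪≫ e3⟩,
        fun q hq => ?_, fun h => by omega⟩
      obtain rfl : q = m := by omega
      exact ⟨e1⟩
  intro m
  obtain ⟨Z, a, _, ⟨e⟩, hZ, hZ0⟩ := key m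
  let Fil : ℕ → Subobject (Y m)
    | 0 => ⊤
    | 1 => Subobject.mk a
    | _ + 2 => ⊥
  have hFil : Antitone Fil := antitone_nat_of_succ_le fun p => by
    rcases p with _ | _ | p
    exacts [le_top, bot_le, le_rfl]
  refine ⟨Fil, hFil, rfl, ?_, fun p q hpq r hr hm => ?_⟩
  · rcases m with _ | m
    · exact Subobject.mk_eq_bot_iff_zero.2 ((hZ0 rfl).eq_of_src _ _)
    · rfl
  · rcases p with _ | _ | p
    · obtain rfl : q = m := by omega
      refine ⟨cokernel.mapIso _ a (Subobject.underlyingIso a) (asIso (⊤ : Subobject (Y q)).arrow)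
        ?_ ≪≫ e⟩
      exact (Subobject.ofLE_arrow _).trans (Subobject.underlyingIso_hom_comp_eq_mk a).symm
    · obtain ⟨e1⟩ := hZ q (by omega)
      exact ⟨cokernelIsoOfEq ((subobject_bot_isZero (Y m)).eq_of_src _ 0) ≪≫
        cokernelZeroIsoTarget ≪≫ Subobject.underlyingIso a ≪≫ e1⟩
    · refine ⟨IsZero.iso ?_ (hX p q)⟩
      exact IsZero.of_epi (cokernel.π _) (subobject_bot_isZero (Y m))

end Degenerate

/-! ### Admissible polynomials and an injectivity criterion. -/

section Polynomials

open Polynomial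

variable {O : Type*} [CommRing O] [Nontrivial O] {M N : Type*} [AddCommGroup M] [Module O M]
  [AddCommGroup N] [Module O N]

/-- Monic polynomials with constant coefficient `1`. -/
def IsAdmissible (Q : O[X]) : Prop := Q.Monic ∧ Q.coeff 0 = 1

lemma aeval_comm_apply (f : M →ₗ[O] N) {a : Module.End O M} {b : Module.End O N}
    (hab : ∀ v, f (a v) = b (f v)) (Q : O[X]) (v : M) : f (aeval a Q v) = aeval b Q (f v) := by
  induction Q using Polynomial.induction_on' with
  | add p q hp hq => simp only [map_add, LinearMap.add_apply, hp, hq]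
  | monomial n c =>
    simp only [aeval_monomial, Module.End.mul_apply, Module.algebraMap_end_apply, map_smul]
    congr 1
    induction n with
    | zero => rfl
    | succ n ih => rw [pow_succ', pow_succ', Module.End.mul_apply, Module.End.mul_apply, hab, ih]

lemma aeval_aeval_comm (a : Module.End O M) (p q : O[X]) (v : M) :
    aeval a p (aeval a q v) = aeval a q (aeval a p v) := by
  rw [← Module.End.mul_apply, ← Module.End.mul_apply, ← map_mul, ← map_mul, mul_comm]

lemma aeval_pow_comm (a : Module.End O M) (p : O[X]) (m : ℕ) (v : M) :
    (a ^ m) (aeval a p v) = aeval a p ((a ^ m) v) := by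
  have := aeval_aeval_comm a (X ^ m) p v
  simpa using this

/-- The polynomial `c` such that `X c = 1` modulo `Q`, for `Q` with constant coefficient `1`. -/
def inversePoly (Q : O[X]) : O[X] := -Q.divX

lemma aeval_inversePoly {Q : O[X]} (hQ : IsAdmissible Q) {a : Module.End O M} {v : M}
    (hv : aeval a Q v = 0) : a (aeval a (inversePoly Q) v) = v := by
  have h1 : Q = 1 - X * inversePoly Q := by
    conv_lhs => rw [← divX_mul_X_add Q, hQ.2]
    rw [inversePoly, map_one]
    ring
  rw [h1] at hv
  simp only [map_sub, map_one, map_mul, aeval_X, LinearMap.sub_apply, Module.End.one_apply,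
    Module.End.mul_apply, sub_eq_zero] at hv
  exact hv.symm

/-- The submodule `O[a] v`. -/
def polyOrbit (a : Module.End O M) (v : M) : Submodule O M :=
  LinearMap.range ((LinearMap.applyₗ v).comp (aeval (R := O) a).toLinearMap)

lemma mem_polyOrbit {a : Module.End O M} {v w : M} :
    w ∈ polyOrbit a v ↔ ∃ p : O[X], aeval a p v = w := Iff.rfl

lemma self_mem_polyOrbit (a : Module.End O M) (v : M) : v ∈ polyOrbit a v :=
  mem_polyOrbit.2 ⟨1, by simp⟩

lemma apply_mem_polyOrbit {a : Module.End O M} {v w : M} (hw : w ∈ polyOrbit a v) :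
    a w ∈ polyOrbit a v := by
  obtain ⟨p, rfl⟩ := hw
  exact ⟨X * p, by simp⟩

/-- Division by the monic `Q` leaves remainders of degree below `Q.natDegree`, and these already
give the whole orbit. -/
lemma polyOrbit_fg {Q : O[X]} (hQ : IsAdmissible Q) {a : Module.End O M} {v : M}
    (hv : aeval a Q v = 0) : (polyOrbit a v).FG := by
  have h1 : polyOrbit a v =
      (degreeLT O Q.natDegree).map ((LinearMap.applyₗ v).comp (aeval (R := O) a).toLinearMap) := by
    refine le_antisymm ?_ (by rintro _ ⟨p, _, rfl⟩; exact ⟨p, rfl⟩)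
    rintro _ ⟨p, rfl⟩
    refine ⟨p %ₘ Q, ?_, ?_⟩
    · refine mem_degreeLT.2 ?_
      rw [← degree_eq_natDegree hQ.1.ne_zero]
      exact degree_modByMonic_lt p hQ.1
    · have h2 : aeval a p v = aeval a (p %ₘ Q + Q * (p /ₘ Q)) v := by rw [modByMonic_add_div]
      refine Eq.trans ?_ h2.symm
      rw [map_add, LinearMap.add_apply, mul_comm, map_mul, Module.End.mul_apply, hv, map_zero,
        add_zero]
      rfl
  rw [h1]
  exact Submodule.FG.map _ Submodule.FG.of_finite

/-- On elements killed by `Q(a)`, the operator `inversePoly Q` evaluated at `a` is inverse to `a`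
and does not leave `O[a] v`. -/
lemma exists_apply_eq_of_mem_polyOrbit {Q : O[X]} (hQ : IsAdmissible Q) {a : Module.End O M}
    {v : M} (hv : aeval a Q v = 0) {w : M} (hw : w ∈ polyOrbit a v) (m : ℕ) :
    ∃ w' ∈ polyOrbit a v, (a ^ m) w' = w := by
  induction m with
  | zero => exact ⟨w, hw, rfl⟩
  | succ m ih =>
    obtain ⟨_, ⟨p, rfl⟩, h⟩ := ih
    refine ⟨aeval a (p * inversePoly Q) v, ⟨_, rfl⟩, ?_⟩
    rw [← h, pow_succ, Module.End.mul_apply, map_mul, Module.End.mul_apply]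
    congr 1
    have := aeval_pow_comm a p 1 (aeval a (inversePoly Q) v)
    rw [pow_one, aeval_inversePoly hQ hv] at this
    exact this

lemma exists_le_of_fg {ι : Type*} [Preorder ι] [IsDirectedOrder ι] [Nonempty ι]
    {S : ι → Submodule O M} (hS : Monotone S) (hS' : ∀ v, ∃ i, v ∈ S i) {D : Submodule O M}
    (hD : D.FG) : ∃ i, D ≤ S i := by
  classical
  obtain ⟨s, rfl⟩ := hD
  choose f hf using hS'
  obtain ⟨i, hi⟩ := Finset.exists_le (s.image f)
  exact ⟨i, Submodule.span_le.2 fun v hv =>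
    hS (hi _ (Finset.mem_image_of_mem f hv)) (hf v)⟩

/-- If the powers of `a` move every step of an exhaustive filtration away from itself, then
`Q (a)` is injective for every admissible `Q`. -/
lemma aeval_injective_of_filtration {ι : Type*} [Preorder ι] [IsDirectedOrder ι] [Nonempty ι]
    {S : ι → Submodule O M} (hS : Monotone S) (hS' : ∀ v, ∃ i, v ∈ S i) {a : Module.End O M}
    (ha : ∀ i, ∃ m, ∀ w ∈ S i, (a ^ m) w ∈ S i → (a ^ m) w = 0) {Q : O[X]} (hQ : IsAdmissible Q) :
    Function.Injective (aeval a Q) := by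
  refine (injective_iff_map_eq_zero _).2 fun v hv => ?_
  -- The finitely generated module `O[a] v` lies in one step `S i`. Writing `v = a ^ m w` inside it
  -- puts both `w` and `a ^ m w` in `S i`, so that `ha` applies.
  obtain ⟨i, hi⟩ := exists_le_of_fg hS hS' (polyOrbit_fg hQ hv)
  obtain ⟨m, hm⟩ := ha i
  obtain ⟨w, hw, rfl⟩ := exists_apply_eq_of_mem_polyOrbit hQ hv (self_mem_polyOrbit a v) m
  exact hm w (hi hw) (hi (self_mem_polyOrbit a _))

/-- An invertible endomorphism of a finitely generated module is killed by an admissible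
polynomial. -/
lemma exists_admissible_of_finite [Module.Finite O M] {a b : Module.End O M} (hab : a * b = 1) :
    ∃ Q : O[X], IsAdmissible Q ∧ aeval a Q = 0 := by
  obtain ⟨p, hp, hp0⟩ := LinearMap.exists_monic_and_aeval_eq_zero O a
  obtain ⟨q, hq, hq0⟩ := LinearMap.exists_monic_and_aeval_eq_zero O b
  set d := q.natDegree with hd
  -- The reversed polynomial `X ^ d q(1/X)`: its constant coefficient is the leading coefficient of
  -- `q`, and `r(a) = a ^ d q(b)`.
  let r : O[X] := ∑ i ∈ Finset.range (d + 1), C (q.coeff i) * X ^ (d - i)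
  have hpow : ∀ i, a ^ i * b ^ i = 1 := fun i => by
    induction i with
    | zero => simp
    | succ i ih => rw [pow_succ, pow_succ', mul_assoc, ← mul_assoc a b, hab, one_mul, ih]
  have hr0 : aeval a r = 0 := by
    have h1 : aeval a r = a ^ d * aeval b q := by
      rw [aeval_eq_sum_range (p := q), Finset.mul_sum, map_sum]
      refine Finset.sum_congr rfl fun i hi => ?_
      have hi' : i ≤ d := Nat.lt_succ_iff.1 (Finset.mem_range.1 hi)
      rw [map_mul, aeval_C, map_pow, aeval_X, mul_smul_comm, Algebra.algebraMap_eq_smul_one,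
        smul_one_mul]
      congr 1
      conv_rhs => rw [← Nat.sub_add_cancel hi', pow_add, mul_assoc, hpow, mul_one]
    rw [h1, hq0, mul_zero]
  have hrdeg : r.degree < ((d + 1 : ℕ) : WithBot ℕ) := by
    refine mem_degreeLT.1 (Submodule.sum_mem _ fun i _ => mem_degreeLT.2 ?_)
    refine (degree_C_mul_X_pow_le _ _).trans_lt ?_
    exact_mod_cast Nat.lt_succ_of_le (Nat.sub_le d i)
  have hrc : r.coeff 0 = 1 := by
    rw [finsetSum_coeff, Finset.sum_eq_single d]
    · simp [hd, hq.coeff_natDegree]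
    · intro i hi hne
      have : i < d + 1 := Finset.mem_range.1 hi
      rw [coeff_C_mul_X_pow, if_neg (by omega)]
    · simp
  -- The exponent `d + 1` exceeds the degree of `r`, which keeps the sum monic, and is positive,
  -- which leaves the constant coefficient of `r` unchanged.
  refine ⟨X ^ (d + 1) * p + r, ⟨?_, ?_⟩, ?_⟩
  · refine ((monic_X_pow (d + 1)).mul hp).add_of_left (hrdeg.trans_le ?_)
    rw [degree_eq_natDegree ((monic_X_pow (d + 1)).mul hp).ne_zero,
      (monic_X_pow (d + 1)).natDegree_mul hp, natDegree_X_pow]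
    exact_mod_cast Nat.le_add_right _ _
  · rw [coeff_add, hrc, pow_succ', mul_assoc, coeff_X_mul_zero, zero_add]
  · rw [map_add, map_mul, hp0, mul_zero, hr0, add_zero]

end Polynomials

/-! ### Permutation representations and exactness of sequences of representations. -/

section Permutation

variable (O : Type u) [CommRing O] {M : Type u} [Monoid M] (Y : Type u) [MulAction M Y]

/-- The permutation representation on finitely supported functions. -/
def permRep : Representation O M (Y →₀ O) where
  toFun g := Finsupp.lmapDomain O O (g • ·)
  map_one' := by ext; simp
  map_mul' g g' := by ext; simp [mul_smul]

variable {O Y}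

@[simp]
lemma permRep_single (g : M) (y : Y) (c : O) :
    permRep O Y g (Finsupp.single y c) = Finsupp.single (g • y) c := by
  simp [permRep]

/-- The morphism from a permutation representation given by an equivariant map. -/
def permHom {A : Rep.{u} O M} (f : Y → A) (hf : ∀ g y, f (g • y) = A.ρ g (f y)) :
    Rep.of (permRep O (M := M) Y) ⟶ A :=
  Rep.ofHom
    { toLinearMap := Finsupp.linearCombination O f
      isIntertwining' := fun g => by
        ext y
        simp [hf] }

lemma permHom_single {A : Rep.{u} O M} (f : Y → A) (hf : ∀ g y, f (g • y) = A.ρ g (f y)) (y : Y) :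
    (permHom f hf).hom (Finsupp.single y 1) = f y :=
  (Finsupp.linearCombination_single O 1 y).trans (one_smul O _)

end Permutation

section Exactness

variable {O : Type u} [CommRing O] {M : Type u} [Monoid M]

lemma rep_exact_iff (S : ShortComplex (Rep.{u} O M)) :
    S.Exact ↔ ∀ x : S.X₂, S.g.hom x = 0 → ∃ y : S.X₁, S.f.hom y = x := by
  have : PreservesLimitsOfSize.{0, 0} (forget₂ (Rep.{u} O M) (ModuleCat.{u} O)) :=
    preservesLimitsOfSize_shrink _
  have : PreservesColimitsOfSize.{0, 0} (forget₂ (Rep.{u} O M) (ModuleCat.{u} O)) :=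
    preservesColimitsOfSize_shrink _
  rw [← ShortComplex.exact_map_iff_of_faithful S (forget₂ (Rep.{u} O M) (ModuleCat.{u} O)),
    ShortComplex.moduleCat_exact_iff]
  rfl

end Exactness

/-! ### Divisible representations and the exactness of `Γ^ord`. -/

section GammaOrd

open Polynomial

variable {O : Type u} [CommRing O] [Nontrivial O] {T : Type u} [CommGroup T]

/-- The representations on which all admissible polynomials in `t₀` act surjectively. -/
def divisible {P : Submonoid T} (t₀ : P) : ObjectProperty (Rep.{u} O P) :=
  fun V => ∀ Q : O[X], IsAdmissible Q → Function.Surjective (aeval (V.ρ t₀) Q)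

variable {P : Submonoid T} {t₀ : P}

lemma divisible_of_epi {V W : Rep.{u} O P} (f : V ⟶ W) [Epi f] (hV : divisible t₀ V) :
    divisible t₀ W := by
  intro Q hQ w
  obtain ⟨v, rfl⟩ := (Rep.epi_iff_surjective f).1 ‹_› w
  obtain ⟨v', rfl⟩ := hV Q hQ v
  exact ⟨f.hom v', (aeval_comm_apply f.hom.toLinearMap (Rep.hom_comm_apply f t₀) Q v').symm⟩

/-- Filter by supports in finite sets `C`. As `t₀` has infinite order, some power of it avoids the
finite set `C C⁻¹` and therefore moves `C` off itself. -/
lemma aeval_permRep_injective (ht : ∀ m : ℕ, 0 < m → (t₀ : T) ^ m ≠ 1) {Q : O[X]}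
    (hQ : IsAdmissible Q) : Function.Injective (aeval (permRep O P t₀) Q) := by
  classical
  refine aeval_injective_of_filtration (ι := Finset P)
    (S := fun C => Finsupp.supported O O (C : Set P))
    (fun C C' h => Finsupp.supported_mono (Finset.coe_subset.2 h))
    (fun v => ⟨v.support, fun _ h => h⟩) (fun C => ?_) hQ
  have hinj : Function.Injective fun m : ℕ => (t₀ : T) ^ m := by
    refine injective_pow_iff_not_isOfFinOrder.2 fun h => ?_
    obtain ⟨m, hm, h1⟩ := isOfFinOrder_iff_pow_eq_one.1 h
    exact ht m hm h1
  have hfin : Set.Finite ((fun m : ℕ => (t₀ : T) ^ m) ⁻¹'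
      (((C ×ˢ C).image fun x => (x.1 : T) * (x.2 : T)⁻¹ : Finset T) : Set T)) :=
    (Finset.finite_toSet _).preimage hinj.injOn
  obtain ⟨m, hm⟩ := hfin.exists_notMem
  refine ⟨m, fun w hw hw' => ?_⟩
  rw [← map_pow] at hw' ⊢
  ext p
  by_contra hp
  have hp1 : p ∈ C := hw' (Finsupp.mem_support_iff.2 hp)
  have hp2 := Finsupp.mapDomain_support (Finsupp.mem_support_iff.2 hp)
  obtain ⟨p', hp', hpp⟩ := Finset.mem_image.1 hp2
  refine hm ?_
  simp only [Set.mem_preimage, Finset.mem_coe, Finset.mem_image, Finset.mem_product]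
  refine ⟨(p, p'), ⟨hp1, hw hp'⟩, ?_⟩
  have : (p : T) = (t₀ : T) ^ m * p' := by
    rw [← hpp]
    rfl
  simp [this]

/-- A vector `v` is a map `O[P] → V` with `1 ↦ v`. Extend it along the monomorphism `Q(t₀)` of
`O[P]`; the extension sends `1` to a preimage of `v` under `Q(t₀)`. -/
lemma divisible_of_injective (ht : ∀ m : ℕ, 0 < m → (t₀ : T) ^ m ≠ 1) (V : Rep.{u} O P)
    [Injective V] : divisible t₀ V := by
  intro Q hQ v
  let f : Rep.of (permRep O (M := P) P) ⟶ V :=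
    permHom (fun p => V.ρ p v) fun g y => by
      rw [smul_eq_mul, map_mul, Module.End.mul_apply]
  let q : Rep.of (permRep O (M := P) P) ⟶ Rep.of (permRep O (M := P) P) :=
    Rep.ofHom
      { toLinearMap := aeval (permRep O P t₀) Q
        isIntertwining' := fun g => LinearMap.ext fun w =>
          (aeval_comm_apply (permRep O P g) (fun w => by
            rw [← Module.End.mul_apply, ← Module.End.mul_apply, ← map_mul, ← map_mul,
              mul_comm]) Q w).symm }
  have : Mono q := (Rep.mono_iff_injective q).2 (aeval_permRep_injective ht hQ)
  have hf : f.hom (Finsupp.single 1 1) = v := by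
    refine (permHom_single _ _ _).trans ?_
    rw [map_one, Module.End.one_apply]
  refine ⟨(Injective.factorThru f q).hom (Finsupp.single 1 1), ?_⟩
  rw [← hf]
  conv_rhs => rw [← Injective.comp_factorThru f q]
  exact (aeval_comm_apply (Injective.factorThru f q).hom.toLinearMap
    (Rep.hom_comm_apply _ t₀) Q _).symm

section FinPart

variable [IsNoetherianRing O] {W : Type u} [AddCommGroup W] [Module O W] {ρ : Representation O T W}
  {t : T} {w : W}

/-- A `t`-finite element is killed by an admissible polynomial. -/
lemma exists_admissible_of_mem_finPart (hw : w ∈ (finPart ρ t).toSubmodule) :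
    ∃ Q : O[X], IsAdmissible Q ∧ aeval (ρ t) Q w = 0 := by
  let N := Submodule.span O (Set.range fun i : ℤ => ρ (t ^ i) w)
  have hNfg : N.FG := hw
  have hst : ∀ j : ℤ, ∀ w ∈ N, ρ (t ^ j) w ∈ N := fun j w hw => by
    have : N ≤ N.comap (ρ (t ^ j)) := by
      refine Submodule.span_le.2 ?_
      rintro _ ⟨i, rfl⟩
      refine Submodule.subset_span ⟨j + i, ?_⟩
      simp only [zpow_add, map_mul, Module.End.mul_apply]
    exact this hw
  have : Module.Finite O N := Module.Finite.iff_fg.2 hNfg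
  have h1 : ∀ w ∈ N, ρ t w ∈ N := by simpa using hst 1
  let a : Module.End O N := (ρ t).restrict h1
  let b : Module.End O N := (ρ (t ^ (-1 : ℤ))).restrict (hst (-1))
  have hab : a * b = 1 := by
    refine LinearMap.ext fun w => Subtype.ext ?_
    change ρ t (ρ (t ^ (-1 : ℤ)) w) = w
    rw [← Module.End.mul_apply, ← map_mul]
    simp
  obtain ⟨Q, hQ, hQ0⟩ := exists_admissible_of_finite hab
  refine ⟨Q, hQ, ?_⟩
  have hmem : w ∈ N := Submodule.subset_span ⟨0, by simp⟩
  refine (aeval_comm_apply N.subtype (a := a) (fun _ => rfl) Q ⟨w, hmem⟩).symm.trans ?_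
  rw [hQ0]
  rfl

/-- An element that is killed by an admissible polynomial is `t`-finite. -/
lemma mem_finPart_of_aeval_eq_zero {Q : O[X]} (hQ : IsAdmissible Q)
    (hw : aeval (ρ t) Q w = 0) : w ∈ (finPart ρ t).toSubmodule := by
  refine Submodule.FG.of_le (polyOrbit_fg hQ hw) (Submodule.span_le.2 ?_)
  rintro _ ⟨i, rfl⟩
  change ρ (t ^ i) w ∈ polyOrbit (ρ t) w
  induction i using Int.induction_on with
  | zero => simpa using self_mem_polyOrbit (ρ t) w
  | succ i ih =>
    have := apply_mem_polyOrbit ih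
    rw [← Module.End.mul_apply, ← map_mul] at this
    rwa [add_comm, zpow_add, zpow_one]
  | pred i ih =>
    -- `t` maps `O[t] w` onto itself, so the unique preimage of an element under the invertible `ρ
    -- t` stays in it.
    obtain ⟨w', hw', h⟩ := exists_apply_eq_of_mem_polyOrbit hQ hw ih 1
    have : ρ (t ^ (-(i : ℤ) - 1)) w = w' := by
      rw [sub_eq_add_neg, add_comm, zpow_add, map_mul, Module.End.mul_apply, ← h, pow_one,
        ← Module.End.mul_apply, ← map_mul]
      simp
    rwa [this]

end FinPart

section Coind

variable (V : Rep.{u} O P)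

/-- The representation of `T` coinduced from `V`. -/
abbrev coindRep : Representation O T (Representation.coindV P.subtype V.ρ) :=
  Representation.coind P.subtype V.ρ

variable {V}

lemma coind_mul (p : P) (s : T) (Ψ : Representation.coindV P.subtype V.ρ) :
    Ψ.1 (p * s) = V.ρ p (Ψ.1 s) := Ψ.2 p s

lemma coind_pow_mul (m : ℕ) (s : T) (Ψ : Representation.coindV P.subtype V.ρ) :
    Ψ.1 ((t₀ : T) ^ m * s) = (V.ρ t₀ ^ m) (Ψ.1 s) := by
  rw [← map_pow]
  exact coind_mul (t₀ ^ m) s Ψ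

/-- Evaluation of a coinduced element at `s`. -/
def coindEval (s : T) : Representation.coindV P.subtype V.ρ →ₗ[O] V :=
  (LinearMap.proj s).comp (Submodule.subtype _)

lemma aeval_coind_apply (Q : O[X]) (s : T) (Ψ : Representation.coindV P.subtype V.ρ) :
    (aeval (coindRep V t₀) Q Ψ).1 s = aeval (V.ρ t₀) Q (Ψ.1 s) :=
  aeval_comm_apply (coindEval s) (fun Ψ => (congrArg Ψ.1 (mul_comm _ _)).trans
    (coind_mul t₀ s Ψ)) Q Ψ

/-- A coinduced element that is killed by an admissible polynomial is determined by its value at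
`1`. -/
lemma eq_zero_of_apply_one (hP : ∀ t : T, ∃ m : ℕ, (t₀ : T) ^ m * t ∈ P)
    {Ψ : Representation.coindV P.subtype V.ρ} {Q : O[X]} (hQ : IsAdmissible Q)
    (hΨ : aeval (coindRep V t₀) Q Ψ = 0) (h1 : Ψ.1 1 = 0) : Ψ = 0 := by
  refine Subtype.ext (funext fun t => ?_)
  obtain ⟨m, hm⟩ := hP t
  have h2 : Ψ.1 ((t₀ : T) ^ m * t) = 0 := by
    have := coind_mul ⟨_, hm⟩ 1 Ψ
    rwa [mul_one, h1, map_zero] at this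
  rw [coind_pow_mul] at h2
  have h3 : aeval (V.ρ t₀) Q (Ψ.1 t) = 0 := by
    rw [← aeval_coind_apply, hΨ]
    rfl
  -- `t₀` is injective on the kernel of `Q(t₀)`, since `inversePoly Q` inverts it there from both
  -- sides.
  have key : ∀ (k : ℕ) (v : V), aeval (V.ρ t₀) Q v = 0 → (V.ρ t₀ ^ k) v = 0 → v = 0 := by
    intro k
    induction k with
    | zero => exact fun v _ h => h
    | succ k ih =>
      intro v hv h
      rw [pow_succ, Module.End.mul_apply] at h
      have h4 := ih (V.ρ t₀ v) (by
        have := aeval_pow_comm (V.ρ t₀) Q 1 v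
        rw [pow_one, hv, map_zero] at this
        exact this.symm) h
      have h5 := aeval_aeval_comm (V.ρ t₀) X (inversePoly Q) v
      rw [aeval_X, aeval_inversePoly hQ hv, h4, map_zero] at h5
      exact h5
  exact key m _ h3 h2

/-- Elements killed by an admissible polynomial are values at `1` of coinduced elements. -/
lemma exists_coind_of_aeval_eq_zero (hP : ∀ t : T, ∃ m : ℕ, (t₀ : T) ^ m * t ∈ P) {v : V}
    {Q : O[X]} (hQ : IsAdmissible Q) (hv : aeval (V.ρ t₀) Q v = 0) :
    ∃ Ψ : Representation.coindV P.subtype V.ρ,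
      aeval (coindRep V t₀) Q Ψ = 0 ∧ Ψ.1 1 = v := by
  -- `c` inverts `t₀` on the kernel of `Q(t₀)`. The element sought is `t ↦ (t₀ ^ m t) c ^ m v` for
  -- any `m` with `t₀ ^ m t ∈ P`; by `hval'` the choice of `m` does not matter.
  let c : Module.End O V := aeval (V.ρ t₀) (inversePoly Q)
  have hc : ∀ m, aeval (V.ρ t₀) Q ((c ^ m) v) = 0 := fun m => by
    have h := aeval_aeval_comm (V.ρ t₀) Q (inversePoly Q ^ m) v
    rwa [hv, map_zero, map_pow] at h
  have hXc : ∀ m k, (V.ρ t₀ ^ k) ((c ^ (m + k)) v) = (c ^ m) v := fun m k => by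
    induction k with
    | zero => rfl
    | succ k ih =>
      rw [pow_succ, Module.End.mul_apply, ← add_assoc, pow_succ' c, Module.End.mul_apply,
        aeval_inversePoly hQ (hc _), ih]
  have hval : ∀ (t : T) (m k : ℕ) (hm : (t₀ : T) ^ m * t ∈ P) (hk : (t₀ : T) ^ (m + k) * t ∈ P),
      V.ρ ⟨_, hk⟩ ((c ^ (m + k)) v) = V.ρ ⟨_, hm⟩ ((c ^ m) v) := fun t m k hm hk => by
    have : (⟨_, hk⟩ : P) = ⟨_, hm⟩ * t₀ ^ k := Subtype.ext (by
      simp only [Submonoid.coe_mul, SubmonoidClass.coe_pow, pow_add]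
      exact mul_right_comm _ _ _)
    rw [this, map_mul, Module.End.mul_apply, map_pow, hXc]
  have hval' : ∀ (t : T) (m k : ℕ) (hm : (t₀ : T) ^ m * t ∈ P) (hk : (t₀ : T) ^ k * t ∈ P),
      V.ρ ⟨_, hk⟩ ((c ^ k) v) = V.ρ ⟨_, hm⟩ ((c ^ m) v) := fun t m k hm hk => by
    rcases le_total m k with h | h
    · obtain ⟨j, rfl⟩ := Nat.exists_eq_add_of_le h
      exact hval t m j hm hk
    · obtain ⟨j, rfl⟩ := Nat.exists_eq_add_of_le h
      exact (hval t k j hk hm).symm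
  choose μ hμ using hP
  let Ψ : Representation.coindV P.subtype V.ρ :=
    ⟨fun t => V.ρ ⟨_, hμ t⟩ ((c ^ μ t) v), fun p t => by
      have h1 : (t₀ : T) ^ μ t * ((p : T) * t) ∈ P := by
        rw [mul_left_comm]
        exact mul_mem p.2 (hμ t)
      refine (hval' _ (μ t) (μ (p * t)) h1 (hμ (p * t))).trans ?_
      have h2 : (⟨_, h1⟩ : P) = p * ⟨_, hμ t⟩ := Subtype.ext (mul_left_comm _ _ _)
      rw [h2, map_mul, Module.End.mul_apply]⟩
  refine ⟨Ψ, Subtype.ext (funext fun t => ?_), ?_⟩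
  · rw [aeval_coind_apply]
    have := aeval_comm_apply (V.ρ ⟨_, hμ t⟩) (a := V.ρ t₀) (b := V.ρ t₀) (fun w => by
      rw [← Module.End.mul_apply, ← Module.End.mul_apply, ← map_mul, ← map_mul, mul_comm]) Q
      ((c ^ μ t) v)
    rw [hc, map_zero] at this
    exact this.symm
  · have h1 : (t₀ : T) ^ 0 * 1 ∈ P := by simp [one_mem]
    refine (hval' 1 0 (μ 1) h1 (hμ 1)).trans ?_
    have : (⟨_, h1⟩ : P) = 1 := Subtype.ext (by simp)
    rw [this, map_one]
    rfl

end Coind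

variable [IsNoetherianRing O]

/-- `Γ^ord` is left exact. -/
lemma gammaOrd_preservesFiniteLimits (t : T) :
    PreservesFiniteLimits (GammaOrd (O := O) P t) := by
  refine ((Functor.preservesFiniteLimits_tfae (GammaOrd (O := O) P t)).out 0 3).1 fun S hS => ?_
  have hinj := (Rep.mono_iff_injective S.f).1 hS.mono_f
  refine ⟨(rep_exact_iff _).2 fun Ψ hΨ => ?_, (Rep.mono_iff_injective _).2 fun Ψ Ψ' h => ?_⟩
  · have h0 : ∀ s, S.g.hom (Ψ.1.1 s) = 0 := fun s =>
      congrFun (congrArg (fun Φ => Φ.1.1) hΨ) s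
    choose f hf using fun s => (rep_exact_iff S).1 hS.exact _ (h0 s)
    let Φ : Representation.coindV P.subtype S.X₁.ρ := ⟨f, fun p s => hinj (by
      rw [Rep.hom_comm_apply, hf, hf]
      exact Ψ.1.2 p s)⟩
    let ι := (Representation.coindMap P.subtype S.f.hom).toLinearMap
    have hι : Function.Injective ι := fun a b hab =>
      Subtype.ext (funext fun s => hinj (congrFun (congrArg Subtype.val hab) s))
    have hΦ : ι Φ = Ψ.1 := Subtype.ext (funext hf)
    refine ⟨⟨Φ, ?_⟩, Subtype.ext hΦ⟩
    change (Submodule.span O (Set.range fun i : ℤ => coindRep S.X₁ (t ^ i) Φ)).FG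
    -- Local finiteness descends to `Φ`: the injection `ι` carries the span of its orbit onto that
    -- of `Ψ`.
    refine Submodule.fg_of_fg_map_injective ι hι ?_
    rw [← Submodule.span_image, ← Set.range_comp]
    have h2 : (ι ∘ fun i : ℤ => coindRep S.X₁ (t ^ i) Φ) =
        fun i : ℤ => coindRep S.X₂ (t ^ i) Ψ.1 := funext fun i => by
      rw [← hΦ]
      rfl
    rw [h2]
    exact Ψ.2
  · refine Subtype.ext (Subtype.ext (funext fun s => hinj ?_))
    exact congrFun (congrArg (fun Φ => Φ.1.1) h) s

/-- The divisible representations form an acyclic class for `Γ^ord`. -/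
lemma gammaOrd_isAcyclicClass (hP : ∀ t : T, ∃ m : ℕ, (t₀ : T) ^ m * t ∈ P)
    (ht : ∀ m : ℕ, 0 < m → (t₀ : T) ^ m ≠ 1) :
    IsAcyclicClass (GammaOrd (O := O) P (t₀ : T)) (divisible t₀) where
  of_injective V _ := divisible_of_injective ht V
  of_epi f _ hV := divisible_of_epi f hV
  epi_map {S} hS h1 := by
    refine (Rep.epi_iff_surjective _).2 fun Ψ => ?_
    obtain ⟨Q, hQ, hΨ⟩ := exists_admissible_of_mem_finPart Ψ.2
    -- A snake argument: for a lift `v` of `Ψ(1)`, the vector `Q(t₀) v` comes from `S.X₁`.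
    -- Divisibility of `S.X₁` corrects `v` to a lift killed by `Q(t₀)`, which extends to a coinduced
    -- element.
    obtain ⟨v, hv⟩ := (Rep.epi_iff_surjective S.g).1 hS.epi_g (Ψ.1.1 1)
    have hgQ : ∀ w, S.g.hom (aeval (S.X₂.ρ t₀) Q w) = aeval (S.X₃.ρ t₀) Q (S.g.hom w) :=
      aeval_comm_apply S.g.hom.toLinearMap (Rep.hom_comm_apply S.g t₀) Q
    have hfQ : ∀ w, S.f.hom (aeval (S.X₁.ρ t₀) Q w) = aeval (S.X₂.ρ t₀) Q (S.f.hom w) :=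
      aeval_comm_apply S.f.hom.toLinearMap (Rep.hom_comm_apply S.f t₀) Q
    have h3 : S.g.hom (aeval (S.X₂.ρ t₀) Q v) = 0 := by
      rw [hgQ, hv, ← aeval_coind_apply, hΨ]
      rfl
    obtain ⟨w, hw⟩ := (rep_exact_iff S).1 hS.exact _ h3
    obtain ⟨w', rfl⟩ := h1 Q hQ w
    have h4 : aeval (S.X₂.ρ t₀) Q (v - S.f.hom w') = 0 := by
      rw [map_sub, ← hfQ, hw, sub_self]
    obtain ⟨Φ, hΦ, hΦ1⟩ := exists_coind_of_aeval_eq_zero hP hQ h4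
    let Φ' : (GammaOrd (O := O) P (t₀ : T)).obj S.X₂ := ⟨Φ, mem_finPart_of_aeval_eq_zero hQ hΦ⟩
    -- The image of `Φ` and `Ψ` are both killed by `Q(t₀)` and agree at `1`, which determines them.
    refine ⟨Φ', sub_eq_zero.1 (Subtype.ext ?_)⟩
    refine eq_zero_of_apply_one hP hQ (Subtype.ext (funext fun s => ?_)) ?_
    · rw [aeval_coind_apply]
      change aeval (S.X₃.ρ t₀) Q (S.g.hom (Φ.1 s) - Ψ.1.1 s) = 0
      rw [map_sub, ← hgQ, ← aeval_coind_apply, ← aeval_coind_apply, hΦ, hΨ]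
      exact (sub_zero _).trans (map_zero S.g.hom)
    · change S.g.hom (Φ.1 1) - Ψ.1.1 1 = 0
      have h5 : S.g.hom (S.f.hom w') = 0 :=
        (Rep.comp_apply S.f S.g w').symm.trans (by rw [S.zero]; rfl)
      rw [hΦ1, map_sub, h5, sub_zero, hv, sub_self]

end GammaOrd

/-! ### The valuation ring: denominators and neighbourhoods of zero. -/

section Integers

variable {F : Type u} [Field F] [ValuativeRel F] [TopologicalSpace F]
  [IsNonarchimedeanLocalField F] {π : 𝒪[F]}

lemma exists_pow_mul_mem (hπ : Irreducible π) (x : F) : ∃ N : ℕ, ((π : F) ^ N * x) ∈ 𝒪[F] := by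
  obtain ⟨a, b, hb, rfl⟩ := IsFractionRing.div_surjective (A := 𝒪[F]) x
  have hb0 : b ≠ 0 := nonZeroDivisors.ne_zero hb
  obtain ⟨N, u, hu⟩ := IsDiscreteValuationRing.associated_pow_irreducible hb0 hπ
  have hb1 : ((b : 𝒪[F]) : F) ≠ 0 := fun h => hb0 (Subtype.ext h)
  refine ⟨N, ?_⟩
  have h1 : (π : F) ^ N = (b : F) * ((u : 𝒪[F]) : F) := by
    exact_mod_cast (congrArg Subtype.val hu).symm
  have h2 : (π : F) ^ N * (algebraMap 𝒪[F] F a / algebraMap 𝒪[F] F b) = ((u * a : 𝒪[F]) : F) := by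
    rw [h1]
    change (b : F) * ((u : 𝒪[F]) : F) * ((a : F) / (b : F)) = ((u : 𝒪[F]) : F) * (a : F)
    field_simp
  rw [h2]
  exact Subtype.property _

lemma coe_ne_zero_of_irreducible (hπ : Irreducible π) : (π : F) ≠ 0 := fun h =>
  hπ.ne_zero (Subtype.ext h)

lemma mem_maximalIdeal_pow_iff (hπ : Irreducible π) {n : ℕ} {x : 𝒪[F]} :
    x ∈ 𝓂[F] ^ n ↔ π ^ n ∣ x := by
  rw [hπ.maximalIdeal_eq, Ideal.span_singleton_pow, Ideal.mem_span_singleton]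

lemma valuation_lt_one_of_irreducible (hπ : Irreducible π) : valuation F (π : F) < 1 := by
  refine lt_of_le_of_ne π.2 fun h => hπ.not_isUnit ?_
  refine IsUnit.of_mul_eq_one ⟨(π : F)⁻¹, ?_⟩ (Subtype.ext ?_)
  · change valuation F _ ≤ 1
    rw [map_inv₀, h, inv_one]
  · exact mul_inv_cancel₀ (coe_ne_zero_of_irreducible hπ)

lemma exists_pow_mul_mem_of_mem_nhds (hπ : Irreducible π) {U : Set F} (hU : U ∈ nhds (0 : F)) :
    ∃ N : ℕ, ∀ y : 𝒪[F], ((π : F) ^ N * y) ∈ U := by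
  obtain ⟨γ, hγ⟩ := (IsValuativeTopology.mem_nhds_zero_iff U).1 hU
  obtain ⟨z, hz⟩ := valuation_surjective (γ : ValueGroupWithZero F)
  have hz0 : z ≠ 0 := by
    rintro rfl
    rw [map_zero] at hz
    exact γ.ne_zero hz.symm
  have hπ0 := coe_ne_zero_of_irreducible hπ
  obtain ⟨N, hN⟩ := exists_pow_mul_mem hπ (z⁻¹ * (π : F)⁻¹)
  refine ⟨N, fun y => hγ ?_⟩
  have h1 : (π : F) ^ N * y = z * ((π : F) * (((π : F) ^ N * (z⁻¹ * (π : F)⁻¹)) * y)) := by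
    field_simp
  have h2 : valuation F ((((π : F) ^ N * (z⁻¹ * (π : F)⁻¹)) * y)) ≤ 1 := mul_mem hN y.2
  rw [Set.mem_ofPred_eq, h1, map_mul, hz, map_mul]
  refine mul_lt_of_lt_one_right (zero_lt_iff.2 γ.ne_zero) ?_
  exact (mul_le_of_le_one_right' h2).trans_lt (valuation_lt_one_of_irreducible hπ)

lemma isOpen_pow_mul (hπ : Irreducible π) (n : ℕ) :
    IsOpen {x : F | ∃ y : 𝒪[F], x = (π : F) ^ n * y} := by
  have hπ0 := pow_ne_zero n (coe_ne_zero_of_irreducible hπ)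
  have : {x : F | ∃ y : 𝒪[F], x = (π : F) ^ n * y} =
      (fun x => ((π : F) ^ n)⁻¹ * x) ⁻¹' (𝒪[F] : Set F) := by
    ext x
    constructor
    · rintro ⟨y, rfl⟩
      simp [hπ0]
    · intro h
      exact ⟨⟨_, h⟩, (mul_inv_cancel_left₀ hπ0 x).symm⟩
  rw [this]
  exact Valuation.isOpen_integer.preimage (by fun_prop)

end Integers

/-! ### An exhaustive filtration of `PGL₂(F)` by bounded sets. -/

section Bounded

variable {F : Type u} [Field F] [ValuativeRel F] [TopologicalSpace F]
  [IsNonarchimedeanLocalField F] {π : 𝒪[F]}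

lemma mk_eq_mk_of_smul {γ γ' : GL (Fin 2) F} {c : F} (h : γ'.val = c • γ.val) :
    (γ : PGL2 F) = γ' := by
  refine QuotientGroup.eq.2 (Matrix.GeneralLinearGroup.mem_center_iff_val_mem_range_scalar.2
    ⟨c, ?_⟩)
  rw [Units.val_mul, h, Matrix.mul_smul, ← Units.val_mul, inv_mul_cancel, Units.val_one,
    Matrix.smul_one_eq_diagonal]
  rfl

lemma exists_smul_of_mk_eq_mk {γ γ' : GL (Fin 2) F} (h : (γ : PGL2 F) = γ') :
    ∃ c : F, γ'.val = c • γ.val := by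
  obtain ⟨c, hc⟩ := Matrix.GeneralLinearGroup.mem_center_iff_val_mem_range_scalar.1
    (QuotientGroup.eq.1 h)
  refine ⟨c, ?_⟩
  have h1 : γ'.val = γ.val * (γ⁻¹ * γ').val := by rw [← Units.val_mul, mul_inv_cancel_left]
  rw [h1, ← hc, Matrix.scalar_apply, ← Matrix.smul_one_eq_diagonal, Matrix.mul_smul, mul_one]

/-- The elements of `G` represented by an integral matrix whose determinant divides `π ^ k`. -/
def IsBounded (π : 𝒪[F]) (k : ℕ) (g : PGL2 F) : Prop :=
  ∃ (γ : GL (Fin 2) F) (A : Matrix (Fin 2) (Fin 2) 𝒪[F]), (γ : PGL2 F) = g ∧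
    γ.val = (𝒪[F]).subtype.mapMatrix A ∧ A.det ∣ π ^ k

lemma IsBounded.mono {k l : ℕ} (h : k ≤ l) {g : PGL2 F} : IsBounded π k g → IsBounded π l g := by
  rintro ⟨γ, A, h1, h2, h3⟩
  exact ⟨γ, A, h1, h2, h3.trans (pow_dvd_pow π h)⟩

lemma IsBounded.mul {k l : ℕ} {g g' : PGL2 F} :
    IsBounded π k g → IsBounded π l g' → IsBounded π (k + l) (g * g') := by
  rintro ⟨γ, A, rfl, h2, h3⟩ ⟨γ', A', rfl, h2', h3'⟩
  refine ⟨γ * γ', A * A', rfl, ?_, ?_⟩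
  · rw [Units.val_mul, h2, h2', map_mul]
  · rw [Matrix.det_mul, pow_add]
    exact mul_dvd_mul h3 h3'

lemma IsBounded.inv {k : ℕ} {g : PGL2 F} : IsBounded π k g → IsBounded π k g⁻¹ := by
  rintro ⟨γ, A, rfl, h2, h3⟩
  -- The adjugate `det γ • γ⁻¹` represents the inverse class, is integral and has the same
  -- determinant.
  let γ' : GL (Fin 2) F := Matrix.GeneralLinearGroup.scalar (Fin 2)
    (Matrix.GeneralLinearGroup.det γ) * γ⁻¹
  have h4 : γ'.val = γ.val.det • (γ⁻¹).val := by
    simp [γ', Matrix.smul_eq_diagonal_mul, Matrix.GeneralLinearGroup.scalar]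
  refine ⟨γ', A.adjugate, (mk_eq_mk_of_smul h4).symm, ?_, ?_⟩
  · rw [h4, RingHom.mapMatrix_apply, ← RingHom.mapMatrix_apply, RingHom.map_adjugate, ← h2]
    have h5 := Matrix.mul_adjugate γ.val
    calc γ.val.det • (γ⁻¹).val = (γ⁻¹).val * (γ.val.det • 1) := by
          rw [Matrix.mul_smul, mul_one]
      _ = γ.val.adjugate := by
          rw [← h5, ← mul_assoc, ← Units.val_mul, inv_mul_cancel, Units.val_one, one_mul]
  · rwa [Matrix.det_adjugate, Fintype.card_fin, pow_one]

lemma isBounded_toG (A : GL (Fin 2) 𝒪[F]) (k : ℕ) : IsBounded π k (toG F A) :=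
  ⟨Matrix.GeneralLinearGroup.map (𝒪[F]).subtype A, A.val, rfl, rfl,
    (((Matrix.isUnit_iff_isUnit_det _).1 A.isUnit)).dvd⟩

lemma isBounded_of_mem_K0 {n : ℕ} {g : PGL2 F} (hg : g ∈ K0 F n) (k : ℕ) : IsBounded π k g := by
  obtain ⟨A, -, rfl⟩ := hg
  exact isBounded_toG A k

lemma exists_isBounded (hπ : Irreducible π) (g : PGL2 F) : ∃ k, IsBounded π k g := by
  obtain ⟨γ, rfl⟩ := QuotientGroup.mk_surjective g
  choose N hN using fun i j => exists_pow_mul_mem hπ (γ.val i j)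
  -- The sum dominates every `N i j`, so one power of `π` clears all denominators.
  let M : ℕ := ∑ i, ∑ j, N i j
  have hM : ∀ i j, ((π : F) ^ M * γ.val i j) ∈ 𝒪[F] := fun i j => by
    have h1 : N i j ≤ M := (Finset.single_le_sum (f := fun j => N i j) (fun _ _ => Nat.zero_le _)
      (Finset.mem_univ j)).trans (Finset.single_le_sum (f := fun i => ∑ j, N i j)
      (fun _ _ => Nat.zero_le _) (Finset.mem_univ i))
    rw [← Nat.sub_add_cancel h1, pow_add, mul_assoc]
    exact mul_mem (pow_mem π.2 _) (hN i j)
  let A : Matrix (Fin 2) (Fin 2) 𝒪[F] := fun i j => ⟨_, hM i j⟩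
  let c : Fˣ := Units.mk0 ((π : F) ^ M) (pow_ne_zero _ (coe_ne_zero_of_irreducible hπ))
  let γ' : GL (Fin 2) F := Matrix.GeneralLinearGroup.scalar (Fin 2) c * γ
  have h4 : γ'.val = (c : F) • γ.val := by
    simp [γ', Matrix.smul_eq_diagonal_mul, Matrix.GeneralLinearGroup.scalar]
  have h5 : γ'.val = (𝒪[F]).subtype.mapMatrix A := by
    rw [h4]
    rfl
  have h6 : A.det ≠ 0 := fun h => by
    have h7 : γ'.val.det = 0 := by
      rw [h5, ← RingHom.map_det, h, map_zero]
    exact ((Matrix.isUnit_iff_isUnit_det _).1 γ'.isUnit).ne_zero h7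
  obtain ⟨k, hk⟩ := IsDiscreteValuationRing.associated_pow_irreducible h6 hπ
  exact ⟨k, γ', A, (mk_eq_mk_of_smul h4).symm, h5, hk.dvd⟩

/-- An integral representative is `c diag(π ^ m, 1)` with `c = A 1 1` integral, so `π ^ m` divides
its determinant. This forces high powers of Hecke operators to leave bounded sets. -/
lemma le_of_isBounded_dia (hπ : Irreducible π) {x : Fˣ} {m k : ℕ} (hx : (x : F) = (π : F) ^ m)
    (h : IsBounded π k (dia x)) : m ≤ k := by
  obtain ⟨γ, A, h1, h2, h3⟩ := h
  obtain ⟨c, hc⟩ := exists_smul_of_mk_eq_mk (γ' := γ) (Eq.symm h1)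
  rw [h2] at hc
  have hA : ∀ i j, (A i j : F) = c * (!![(x : F), 0; 0, 1] : Matrix _ _ F) i j := fun i j =>
    congrFun (congrFun hc i) j
  have h00 := hA 0 0
  have h01 := hA 0 1
  have h11 := hA 1 1
  simp only [Matrix.of_apply, Matrix.cons_val', Matrix.cons_val_zero, Matrix.cons_val_one,
    Matrix.cons_val_fin_one, mul_zero, mul_one, hx] at h00 h01 h11
  have e1 : A 0 0 = A 1 1 * π ^ m := Subtype.ext (by
    rw [h00, ← h11]
    rfl)
  have e2 : A 0 1 = 0 := Subtype.ext h01
  rw [Matrix.det_fin_two, e1, e2, zero_mul, sub_zero] at h3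
  refine (pow_dvd_pow_iff hπ.ne_zero hπ.not_isUnit).1 ((Dvd.intro_left (A 1 1 * A 1 1) ?_).trans h3)
  ring

end Bounded

/-! ### Open subgroups and matrix factorizations. -/

section Topology

variable {F : Type u} [Field F] [ValuativeRel F] [TopologicalSpace F]
  [IsNonarchimedeanLocalField F] {π : 𝒪[F]}

lemma isOpen_Kn (n : ℕ) : IsOpen (Kn F n : Set (PGL2 F)) := by
  obtain ⟨π, hπ⟩ := IsDiscreteValuationRing.exists_irreducible 𝒪[F]
  let J : Set F := {x : F | ∃ y : 𝒪[F], x = (π : F) ^ n * y}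
  have hJ : IsOpen J := isOpen_pow_mul hπ n
  -- Conditions on both `γ` and `γ⁻¹` make both matrices integral, so no separate condition on the
  -- determinant is needed.
  let S : Set (GL (Fin 2) F) :=
    ⋂ i, ⋂ j, ({γ | γ.val i j - (1 : Matrix (Fin 2) (Fin 2) F) i j ∈ J} ∩
      {γ | γ⁻¹.val i j - (1 : Matrix (Fin 2) (Fin 2) F) i j ∈ J})
  have hS : IsOpen S := by
    refine isOpen_iInter_of_finite fun i => isOpen_iInter_of_finite fun j => IsOpen.inter ?_ ?_
    · refine hJ.preimage (f := fun γ : GL (Fin 2) F => γ.val i j - _) ?_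
      exact (Units.continuous_val.matrix_elem i j).sub continuous_const
    · refine hJ.preimage (f := fun γ : GL (Fin 2) F => γ⁻¹.val i j - _) ?_
      exact ((Units.continuous_val.comp continuous_inv).matrix_elem i j).sub continuous_const
  have h1 : (1 : GL (Fin 2) F) ∈ S := by
    simp only [S, Set.mem_iInter]
    intro i j
    constructor <;> exact ⟨0, by simp⟩
  have hsub : ∀ γ ∈ S, (γ : PGL2 F) ∈ Kn F n := fun γ hγ => by
    simp only [S, Set.mem_iInter] at hγ
    choose y hy using fun i j => (hγ i j).1
    choose z hz using fun i j => (hγ i j).2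
    let A : Matrix (Fin 2) (Fin 2) 𝒪[F] := fun i j => (1 : Matrix _ _ _) i j + π ^ n * y i j
    let B : Matrix (Fin 2) (Fin 2) 𝒪[F] := fun i j => (1 : Matrix _ _ _) i j + π ^ n * z i j
    have one_coe : ∀ i j, (((1 : Matrix (Fin 2) (Fin 2) 𝒪[F]) i j : 𝒪[F]) : F) =
        (1 : Matrix (Fin 2) (Fin 2) F) i j := fun i j => by
      rw [Matrix.one_apply, Matrix.one_apply]
      split_ifs <;> rfl
    have hA : (𝒪[F]).subtype.mapMatrix A = γ.val := by
      ext i j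
      have := hy i j
      change (((1 : Matrix (Fin 2) (Fin 2) 𝒪[F]) i j : 𝒪[F]) : F) + (π : F) ^ n * y i j = _
      rw [one_coe, ← this]
      ring
    have hB : (𝒪[F]).subtype.mapMatrix B = γ⁻¹.val := by
      ext i j
      have := hz i j
      change (((1 : Matrix (Fin 2) (Fin 2) 𝒪[F]) i j : 𝒪[F]) : F) + (π : F) ^ n * z i j = _
      rw [one_coe, ← this]
      ring
    have hinj : Function.Injective (𝒪[F].subtype.mapMatrix (m := Fin 2)) :=
      Matrix.map_injective Subtype.val_injective
    have hAB : A * B = 1 := hinj (by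
      rw [map_mul, hA, hB, map_one, ← Units.val_mul, mul_inv_cancel, Units.val_one])
    have hBA : B * A = 1 := hinj (by
      rw [map_mul, hA, hB, map_one, ← Units.val_mul, inv_mul_cancel, Units.val_one])
    refine ⟨⟨A, B, hAB, hBA⟩, ?_, ?_⟩
    · refine mem_congruenceGL.2 ?_
      simp only [mem_maximalIdeal_pow_iff hπ, A]
      simp
    · refine congrArg (QuotientGroup.mk' (Subgroup.center (GL (Fin 2) F))) (Units.ext ?_)
      exact hA
  refine Subgroup.isOpen_of_mem_nhds _ (g := 1) ?_
  refine Filter.mem_of_superset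
    ((QuotientGroup.isOpenMap_coe _ hS).mem_nhds ⟨1, h1, rfl⟩) ?_
  rintro _ ⟨γ, hγ, rfl⟩
  exact hsub γ hγ

lemma isOpen_KH (H : Subgroup Fˣ) (n : ℕ) : IsOpen (KH H n : Set (PGL2 F)) :=
  Subgroup.isOpen_mono (le_sup_left.trans le_sup_left) (isOpen_Kn n)

/-- The class in `G` of the lower unipotent matrix with entry `c`. -/
def lowUnip (c : F) : PGL2 F :=
  QuotientGroup.mk' (Subgroup.center (GL (Fin 2) F))
    ⟨!![1, 0; c, 1], !![1, 0; -c, 1], by simp [Matrix.one_fin_two], by simp [Matrix.one_fin_two]⟩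

lemma lowUnip_zero : lowUnip (0 : F) = 1 := by
  refine (congrArg (QuotientGroup.mk' (Subgroup.center (GL (Fin 2) F))) (Units.ext ?_)).trans
    (map_one _)
  exact Matrix.one_fin_two.symm

lemma continuous_lowUnip : Continuous (lowUnip : F → PGL2 F) := by
  refine continuous_quot_mk.comp (Units.continuous_iff.2 ⟨?_, ?_⟩) <;>
  · refine continuous_matrix fun i j => ?_
    fin_cases i <;> fin_cases j <;> simp <;> fun_prop

/-- The matrix identity behind the contracting property of Hecke operators. -/
lemma lowUnip_mul {c y s : F} (x : Fˣ) (e : Fˣ) (hs : s = 1 + c * y) (he : (e : F) = s) :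
    lowUnip c * (unip y * dia x) =
      unip (y * s⁻¹) * dia x * (lowUnip (x * c * s) * dia (e ^ 2)⁻¹) := by
  have hs0 : s ≠ 0 := he ▸ e.ne_zero
  -- The determinants of the two sides are `x` and `x s⁻²`, which accounts for the scalar `s`.
  refine (mk_eq_mk_of_smul (c := s)
    (γ := (_ : GL (Fin 2) F) * _ * (_ * _)) (γ' := _ * (_ * _)) ?_).symm
  ext i j
  fin_cases i <;> fin_cases j <;>
    simp [Matrix.mul_apply, Fin.sum_univ_two, Matrix.GeneralLinearGroup.upperRightHom, he]
  · field_simp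
    rw [hs]
    ring
  · field_simp
  · field_simp
  · rw [hs]
    ring

/-- The factorization of a matrix whose upper left entry is a unit. -/
lemma toG_eq_lowUnip_mul {A : GL (Fin 2) 𝒪[F]} {e : Fˣ} {a : 𝒪[F]} (ha : A.val 0 0 * a = 1)
    {d : 𝒪[F]} (hd : A.val.det * d = 1) (he : (e : F) = (A.val 0 0 * A.val 0 0 * d : 𝒪[F])) :
    toG F A = lowUnip ((A.val 1 0 * a : 𝒪[F]) : F) * dia e * unip ((A.val 0 1 * a : 𝒪[F]) : F) := by
  have ha' : (A.val 0 0 : F) * (a : F) = 1 := by exact_mod_cast congrArg Subtype.val ha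
  rw [Matrix.det_fin_two] at hd
  have hd' : ((A.val 0 0 : F) * (A.val 1 1 : F) - (A.val 0 1 : F) * (A.val 1 0 : F)) * (d : F) =
    1 := by exact_mod_cast congrArg Subtype.val hd
  have he' : (e : F) = (A.val 0 0 : F) * (A.val 0 0 : F) * (d : F) := he
  -- The diagonal factor of `A` is `diag(A₀₀, det A / A₀₀)`; scaling by `A₀₀ / det A` turns it into
  -- `diag(e, 1)`.
  refine mk_eq_mk_of_smul (c := (a : F) * (A.val 0 0 * A.val 0 0 * d : F))
    (γ := Matrix.GeneralLinearGroup.map (𝒪[F]).subtype A) (γ' := (_ : GL (Fin 2) F) * _ * _) ?_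
  ext i j
  fin_cases i <;> fin_cases j <;>
    simp [Matrix.mul_apply, Fin.sum_univ_two, Matrix.GeneralLinearGroup.upperRightHom, he']
  · linear_combination (-(A.val 0 0 : F) * (A.val 0 0 : F) * (d : F)) * ha'
  · ring
  · ring
  · linear_combination ((A.val 1 0 * A.val 0 1 * d : F) * ((A.val 0 0 : F) * a + 1) -
      (A.val 0 0 : F) * d * A.val 1 1) * ha' - hd'

end Topology

/-! ### The class of a uniformizer in `T̄`. -/

section Uniformizer

variable {F : Type u} [Field F] [ValuativeRel F] [TopologicalSpace F]
  [IsNonarchimedeanLocalField F] {x : TPlus F}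

lemma TPlus.bar_pow (H : Subgroup Fˣ) (x : TPlus F) (m : ℕ) :
    TPlus.bar H x ^ m = TPlus.bar H (x ^ m) := rfl

lemma exists_bar_pow_mul_mem (hx : Irreducible (TPlus.int x)) (H : Subgroup Fˣ) (t : TBar H) :
    ∃ m : ℕ, (TPlus.bar H x : TBar H) ^ m * t ∈ TBarPlus H := by
  obtain ⟨s, rfl⟩ := QuotientGroup.mk'_surjective H t
  obtain ⟨m, hm⟩ := exists_pow_mul_mem hx (s : F)
  exact ⟨m, (x : Fˣ) ^ m * s, hm, rfl⟩

lemma bar_pow_ne_one (hx : Irreducible (TPlus.int x)) {H : Subgroup Fˣ} (hH : H ≤ T0 F) (m : ℕ)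
    (hm : 0 < m) : (TPlus.bar H x : TBar H) ^ m ≠ 1 := by
  intro h
  have h1 : (x : Fˣ) ^ m ∈ H := (QuotientGroup.eq_one_iff _).1 h
  have h2 : IsUnit (TPlus.int x ^ m) :=
    IsUnit.of_mul_eq_one ⟨_, (hH h1).2⟩ (Subtype.ext (((x : Fˣ) ^ m).mul_inv))
  exact hx.not_isUnit ((isUnit_pow_iff hm.ne').1 h2)

end Uniformizer

/-! ### Compact inductions: smoothness, and divisibility of their `Hom` into injectives. -/

section CompactInduction

open Polynomial

variable {F : Type u} [Field F] [ValuativeRel F] [TopologicalSpace F]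
  [IsNonarchimedeanLocalField F] {π : 𝒪[F]} {O : Type u} [CommRing O]

/-- The set is stable under right translation by the open subgroup `K(1)`, whose elements are
`0`-bounded. -/
lemma isOpen_isBounded (π : 𝒪[F]) (k : ℕ) : IsOpen {g : PGL2 F | IsBounded π k g} := by
  refine isOpen_iff_mem_nhds.2 fun g hg => ?_
  have h1 : (fun x => g⁻¹ * x) ⁻¹' (Kn F 1 : Set (PGL2 F)) ∈ nhds g := by
    refine ((isOpen_Kn 1).preimage (by fun_prop)).mem_nhds ?_
    simp [one_mem]
  refine Filter.mem_of_superset h1 fun x hx => ?_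
  have h2 := IsBounded.mul hg (isBounded_of_mem_K0 (Kn_le_K0 1 hx) 0)
  rwa [mul_inv_cancel_left] at h2

variable {H : Subgroup Fˣ} {n : ℕ} {W : Rep.{u} O (TBar0 H)}

lemma exists_isBounded_of_mem_cIndV (hπ : Irreducible π) {Φ : PGL2 F → W} (hΦ : Φ ∈ cIndV n W) :
    ∃ k, ∀ g, ¬ IsBounded π k g → Φ g = 0 := by
  obtain ⟨k, hk⟩ := IsCompact.elim_directed_cover (s := tsupport Φ) hΦ.1
    (fun k => {g : PGL2 F | IsBounded π k g}) (isOpen_isBounded π)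
    (fun g _ => Set.mem_iUnion.2 (exists_isBounded hπ g))
    (directed_of_isDirected_le fun _ _ h _ => IsBounded.mono h)
  refine ⟨k, fun g hg => ?_⟩
  by_contra h
  exact hg (hk (subset_tsupport Φ h))

/-- Compact inductions are smooth. -/
lemma isSmooth_cInd (hH : H ≤ T0 F) : isSmooth F O (cInd n W) := by
  intro Φ
  obtain ⟨h1, h2, -⟩ := (mem_cIndV_iff hH).1 Φ.2
  have hleft : ∀ k ∈ KH H n, ∀ g, Φ.1 (k * g) = Φ.1 g := fun k hk g => by
    have := congrFun (h2 _ (inv_mem hk)) g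
    change Φ.1 (k⁻¹⁻¹ * g) = _ at this
    rwa [inv_inv] at this
  -- Finitely many cosets `K_H(n) x` cover the support, and `Φ` is constant on each. So `Φ (h g) = Φ
  -- h` on the support as soon as `x g x⁻¹ ∈ K_H(n)` for these `x`.
  obtain ⟨s, hs⟩ := IsCompact.elim_finite_subcover (s := tsupport Φ.1) h1
    (fun x : PGL2 F => (fun g => g * x⁻¹) ⁻¹' (KH H n : Set (PGL2 F)))
    (fun x => (isOpen_KH H n).preimage (by fun_prop))
    (fun g _ => Set.mem_iUnion.2 ⟨g, by simp [one_mem]⟩)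
  have hright : ∀ g : PGL2 F, (∀ x ∈ s, x * g * x⁻¹ ∈ KH H n) → ∀ h, Φ.1 h ≠ 0 →
      Φ.1 (h * g) = Φ.1 h := fun g hg h hh => by
    obtain ⟨x, hx, hxh⟩ := Set.mem_iUnion₂.1 (hs (subset_tsupport Φ.1 hh))
    have e1 : h * g = (h * x⁻¹) * ((x * g * x⁻¹) * x) := by group
    have e2 : h = (h * x⁻¹) * x := by group
    conv_rhs => rw [e2]
    rw [e1, hleft _ hxh, hleft _ (hg x hx), hleft _ hxh]
  refine Subgroup.isOpen_of_mem_nhds (stab (cInd n W).ρ Φ) (g := 1) ?_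
  -- The condition on `g⁻¹` handles `h` with `Φ h = 0`: if `Φ (h g) ≠ 0`, the previous step applies
  -- to `h g` and `g⁻¹`.
  have h3 : ∀ᶠ g : PGL2 F in nhds 1, ∀ x ∈ s, x * g * x⁻¹ ∈ KH H n ∧ x * g⁻¹ * x⁻¹ ∈ KH H n := by
    refine (Filter.eventually_all_finset s).2 fun x _ => Filter.Eventually.and ?_ ?_
    · exact ((isOpen_KH H n).preimage (f := fun g => x * g * x⁻¹) (by fun_prop)).mem_nhds
        (by simp [one_mem])
    · exact ((isOpen_KH H n).preimage (f := fun g => x * g⁻¹ * x⁻¹) (by fun_prop)).mem_nhds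
        (by simp [one_mem])
  refine Filter.mem_of_superset h3 fun g hg => Subtype.ext (funext fun h => ?_)
  change Φ.1 (h * g) = Φ.1 h
  by_cases hh : Φ.1 h = 0
  · by_contra hne
    rw [hh] at hne
    have := hright g⁻¹ (fun x hx => (hg x hx).2) (h * g) hne
    rw [mul_inv_cancel_right, hh] at this
    exact hne this.symm
  · exact hright g (fun x hx => (hg x hx).1) h hh

variable [Nontrivial O]

/-- Filter by support in the `k`-bounded sets. If `Φ` lies in step `k` and `t₀ ^ m Φ` is nonzero at
a `k`-bounded `g`, then some `δ(x ^ m)⁻¹ n⁻¹ g` with `n ∈ N₀` is `k`-bounded. Hence `δ(x ^ m)` is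
`2k`-bounded and `m ≤ 2k`, so `m = 2k + 1` moves step `k` off itself. -/
lemma aeval_cIndHecke_injective {x : TPlus F} (hx : Irreducible (TPlus.int x)) (hH : H ≤ T0 F)
    (hn : 1 ≤ n) {Q : O[X]} (hQ : IsAdmissible Q) :
    Function.Injective (aeval (cIndHecke hH hn W (TPlus.bar H x)) Q) := by
  let S : ℕ → Submodule O (cIndV n W) := fun k =>
    { carrier := {Φ | ∀ g, ¬ IsBounded (TPlus.int x) k g → Φ.1 g = 0}
      zero_mem' := fun _ _ => rfl
      add_mem' := fun {Φ Ψ} hΦ hΨ g hg => by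
        change Φ.1 g + Ψ.1 g = 0
        rw [hΦ g hg, hΨ g hg, add_zero]
      smul_mem' := fun c Φ hΦ g hg => by
        change c • Φ.1 g = 0
        rw [hΦ g hg, smul_zero] }
  refine aeval_injective_of_filtration (S := S)
    (fun k l h Φ hΦ g hg => hΦ g fun hg' => hg (hg'.mono h))
    (fun Φ => exists_isBounded_of_mem_cIndV hx Φ.2) (fun k => ⟨2 * k + 1, fun Φ hΦ hΦ' => ?_⟩) hQ
  refine Subtype.ext (funext fun g => ?_)
  by_cases hg : IsBounded (TPlus.int x) k g
  · rw [← map_pow, TPlus.bar_pow, cIndHecke_apply]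
    refine Finset.sum_eq_zero fun y _ => hΦ _ fun hb => ?_
    have h1 := ((isBounded_of_mem_K0 (N0_le_K0 1 (inv_mem ⟨Quotient.out y, rfl⟩)) 0).mul hg).mul
      hb.inv
    have h2 : (unip ((Quotient.out y : 𝒪[F]) : F))⁻¹ * g *
        ((dia ((x ^ (2 * k + 1) : TPlus F) : Fˣ))⁻¹ *
          (unip ((Quotient.out y : 𝒪[F]) : F))⁻¹ * g)⁻¹ =
        dia ((x ^ (2 * k + 1) : TPlus F) : Fˣ) := by group
    rw [h2] at h1
    have h3 := le_of_isBounded_dia hx (m := 2 * k + 1) rfl h1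
    omega
  · exact hΦ' g hg

lemma aeval_homRep_apply (hH : H ≤ T0 F) (hn : 1 ≤ n) (V : Rep.{u} O (PGL2 F)) (t : TBarPlus H)
    (Q : O[X]) (f : cInd n W ⟶ V) (Φ : cInd n W) :
    (aeval ((homRep hH hn W V).ρ t) Q f : cInd n W ⟶ V).hom Φ =
      f.hom (aeval (cIndHecke hH hn W t) Q Φ) := by
  induction Q using Polynomial.induction_on' with
  | add p q hp hq =>
    rw [map_add, map_add]
    exact (congrArg₂ (· + ·) hp hq).trans (map_add f.hom _ _).symm
  | monomial m c =>
    rw [aeval_monomial, aeval_monomial, ← map_pow, ← map_pow]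
    exact (map_smul f.hom c _).symm

/-- `Hom_{O[G]}(cInd_{K₀(n)}^G W, I)` is divisible for injective `I`. -/
lemma divisible_homRep {x : TPlus F} (hx : Irreducible (TPlus.int x)) (hH : H ≤ T0 F)
    (hn : 1 ≤ n) (I : SmoothRep F O) [Injective I] :
    divisible (T := TBar H) (P := TBarPlus H) (TPlus.bar H x) (homRep hH hn W I.obj) := by
  intro Q hQ f
  let C : SmoothRep F O := ⟨cInd n W, isSmooth_cInd hH⟩
  let q : cInd n W ⟶ cInd n W := Rep.ofHom
    { toLinearMap := aeval (cIndHecke hH hn W (TPlus.bar H x)) Q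
      isIntertwining' := fun g => LinearMap.ext fun Φ =>
        (aeval_comm_apply ((cInd n W).ρ g)
          (fun Φ => (Rep.hom_comm_apply (cIndHeckeHom hH hn W (TPlus.bar H x)) g Φ).symm)
          Q Φ).symm }
  have : Mono q := (Rep.mono_iff_injective q).2 (aeval_cIndHecke_injective hx hH hn hQ)
  let q' : C ⟶ C := ObjectProperty.homMk q
  have : Mono q' := (isSmooth F O).ι.mono_of_mono_map (f := q') ‹Mono q›
  -- Extending `f` along the monomorphism `Q(t₀)` of `cInd W` gives a preimage of `f` under `Q(t₀)`.
  let f' : C ⟶ I := ObjectProperty.homMk f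
  refine ⟨(Injective.factorThru f' q').hom, Rep.hom_ext (Representation.IntertwiningMap.ext ?_)⟩
  refine LinearMap.ext fun Φ => ?_
  refine (aeval_homRep_apply hH hn I.obj _ Q _ Φ).trans ?_
  exact congrArg (fun k : C ⟶ I => k.hom.hom Φ) (Injective.comp_factorThru f' q')

end CompactInduction

/-! ### The representing object `O[G / K_H(n)]` and divisibility of `I^{K_H(n)}`. -/

section Universal

open Polynomial

variable {F : Type u} [Field F] [ValuativeRel F] [TopologicalSpace F]
  [IsNonarchimedeanLocalField F] {O : Type u} [CommRing O]

variable (O) in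
/-- The permutation representation `O[G / K]`, which represents `V ↦ V^K`. -/
abbrev cosetRep (K : Subgroup (PGL2 F)) : Rep.{u} O (PGL2 F) :=
  Rep.of (permRep O (M := PGL2 F) (PGL2 F ⧸ K))

variable {K : Subgroup (PGL2 F)}

variable (O K) in
/-- The class of the trivial coset. -/
def cosetVec : cosetRep O K := Finsupp.single ((1 : PGL2 F) : PGL2 F ⧸ K) 1

lemma cosetRep_apply_cosetVec (g : PGL2 F) :
    (cosetRep O K).ρ g (cosetVec O K) = Finsupp.single (g : PGL2 F ⧸ K) 1 := by
  refine (permRep_single g _ 1).trans ?_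
  rw [MulAction.Quotient.smul_coe, smul_eq_mul, mul_one]

lemma cosetVec_mem_fixedBy : cosetVec O K ∈ fixedBy (cosetRep O K).ρ K := fun k hk => by
  rw [cosetRep_apply_cosetVec, cosetVec]
  congr 1
  exact QuotientGroup.eq.2 (by simpa using hk)

/-- The morphism from `O[G / K]` given by a vector that is fixed by `K`. -/
def cosetHom {A : Rep.{u} O (PGL2 F)} {w : A} (hw : w ∈ fixedBy A.ρ K) : cosetRep O K ⟶ A :=
  permHom (fun y => Quotient.liftOn' y (fun g => A.ρ g w) fun g g' h => by
      have h1 := hw _ (QuotientGroup.leftRel_apply.1 h)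
      conv_lhs => rw [← h1]
      rw [← Module.End.mul_apply, ← map_mul, mul_inv_cancel_left]) fun g y => by
    induction y using Quotient.inductionOn' with
    | _ h =>
      change A.ρ (g * h) w = A.ρ g (A.ρ h w)
      rw [map_mul, Module.End.mul_apply]

lemma cosetHom_single {A : Rep.{u} O (PGL2 F)} {w : A} (hw : w ∈ fixedBy A.ρ K) (g : PGL2 F) :
    (cosetHom hw).hom (Finsupp.single (g : PGL2 F ⧸ K) 1) = A.ρ g w :=
  permHom_single _ _ _

lemma cosetHom_cosetVec {A : Rep.{u} O (PGL2 F)} {w : A} (hw : w ∈ fixedBy A.ρ K) :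
    (cosetHom hw).hom (cosetVec O K) = w := by
  refine (cosetHom_single hw 1).trans ?_
  rw [map_one, Module.End.one_apply]

lemma isSmooth_cosetRep (hK : IsOpen (K : Set (PGL2 F))) : isSmooth F O (cosetRep O K) := by
  intro v
  change v ∈ (smoothPart (cosetRep O K).ρ).toSubmodule
  induction v using Finsupp.induction_linear with
  | zero => exact zero_mem _
  | add v w hv hw => exact add_mem hv hw
  | single y c =>
    obtain ⟨g, rfl⟩ := QuotientGroup.mk_surjective y
    refine Subgroup.isOpen_of_mem_nhds _ (g := 1) (Filter.mem_of_superset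
      ((hK.preimage (f := fun h => g⁻¹ * h * g) (by fun_prop)).mem_nhds (by simp [one_mem])) ?_)
    intro h hh
    refine (permRep_single h _ c).trans ?_
    congr 1
    refine QuotientGroup.eq.2 ?_
    have := K.inv_mem hh
    change (h * g)⁻¹ * g ∈ K
    convert this using 1
    group

variable {H : Subgroup Fˣ} {n : ℕ}

/-- The endomorphism of `O[G / K_H(n)]` given by the Hecke operator of `x`. -/
def cosetHecke (O : Type u) [CommRing O] (hH : H ≤ T0 F) (hn : 1 ≤ n) (x : TPlus F) :
    cosetRep O (KH H n) ⟶ cosetRep O (KH H n) :=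
  cosetHom (heckeOp_mem_KH _ hH hn x _ cosetVec_mem_fixedBy)

/-- A `G`-equivariant endomorphism commutes with Hecke operators, so each further power adds one
more Hecke operator to the base vector. -/
lemma cosetHecke_pow_cosetVec (hH : H ≤ T0 F) (hn : 1 ≤ n) (x : TPlus F) (m : ℕ) :
    ((cosetHecke O hH hn x).hom.toLinearMap ^ m) (cosetVec O (KH H n)) =
      heckeOp (cosetRep O (KH H n)).ρ (x ^ m) (cosetVec O (KH H n)) := by
  have hN := fixedBy_KH_le (cosetRep O (KH H n)).ρ H n cosetVec_mem_fixedBy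
  induction m with
  | zero =>
    rw [pow_zero, pow_zero, heckeOp_unit _ hN 1 (one_mem _)]
    simp
  | succ m ih =>
    rw [pow_succ' (cosetHecke O hH hn x).hom.toLinearMap, Module.End.mul_apply, ih, pow_succ x,
      heckeOp_mul _ hN]
    refine (map_heckeOp (cosetHecke O hH hn x) _ _).trans ?_
    congr 1
    exact cosetHom_cosetVec _

lemma mem_isBounded_image {π : 𝒪[F]} {k : ℕ} (hK : K ≤ K0 F n) {g : PGL2 F} :
    (g : PGL2 F ⧸ K) ∈ (QuotientGroup.mk '' {g | IsBounded π k g} : Set (PGL2 F ⧸ K)) ↔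
      IsBounded π k g := by
  refine ⟨?_, fun h => ⟨g, h, rfl⟩⟩
  rintro ⟨g', h, h'⟩
  have := IsBounded.mul h (isBounded_of_mem_K0 (hK (QuotientGroup.eq.1 h')) 0)
  rwa [mul_inv_cancel_left] at this

lemma invKH_ρ_bar (hH : H ≤ T0 F) (hn : 1 ≤ n) (V : SmoothRep F O) (x : TPlus F)
    (v : (invKH hH hn).obj V) :
    (((invKH hH hn).obj V).ρ (TPlus.bar H x) v).1 = heckeOp V.obj.ρ x v.1 := by
  change (heckeRepKH V.obj.ρ hH hn (TPlus.bar H x) v).1 = _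
  rw [heckeRepKH, descend_bar]
  rfl

variable [Nontrivial O]

/-- The `m`-th power sends the coset of `g` to a sum of cosets of `g n δ(x ^ m)` with `n ∈ N₀`. If
`g` and `g n δ(x ^ m)` are both `k`-bounded, then `δ(x ^ m)` is `2k`-bounded; this fails for `m = 2k
+ 1`, so functions supported on `B k` are moved to its complement. -/
lemma aeval_cosetHecke_injective {x : TPlus F} (hx : Irreducible (TPlus.int x)) (hH : H ≤ T0 F)
    (hn : 1 ≤ n) {Q : O[X]} (hQ : IsAdmissible Q) :
    Function.Injective (aeval (cosetHecke O hH hn x).hom.toLinearMap Q) := by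
  classical
  let B : ℕ → Set (PGL2 F ⧸ KH H n) := fun k =>
    QuotientGroup.mk '' {g | IsBounded (TPlus.int x) k g}
  have hB : Monotone B := fun k l h => Set.image_mono fun g hg => IsBounded.mono h hg
  have hBiff : ∀ {k} {g : PGL2 F}, (g : PGL2 F ⧸ KH H n) ∈ B k ↔ IsBounded (TPlus.int x) k g :=
    mem_isBounded_image (KH_le_K0 hH n)
  have hS : Monotone fun k => Finsupp.supported O O (B k) := fun k l h =>
    Finsupp.supported_mono (hB h)
  refine aeval_injective_of_filtration hS (fun v => ?_) (fun k => ⟨2 * k + 1, fun w hw hw' => ?_⟩)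
    hQ
  · induction v using Finsupp.induction_linear with
    | zero => exact ⟨0, zero_mem _⟩
    | add v w hv hw =>
      obtain ⟨i, hi⟩ := hv
      obtain ⟨j, hj⟩ := hw
      exact ⟨max i j, add_mem (hS (le_max_left i j) hi) (hS (le_max_right i j) hj)⟩
    | single y c =>
      obtain ⟨g, rfl⟩ := QuotientGroup.mk_surjective y
      obtain ⟨k, hk⟩ := exists_isBounded hx g
      exact ⟨k, Finsupp.single_mem_supported O c (hBiff.2 hk)⟩
  · refine Submodule.disjoint_def.1
      (Finsupp.disjoint_supported_supported (M := O) (R := O) (disjoint_compl_right (a := B k)))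
      _ hw' ?_
    have hle : Finsupp.supported O O (B k) ≤ (Finsupp.supported O O (B k)ᶜ).comap
        ((cosetHecke O hH hn x).hom.toLinearMap ^ (2 * k + 1)) := by
      rw [Finsupp.supported_eq_span_single, Submodule.span_le]
      rintro _ ⟨y, hy, rfl⟩
      obtain ⟨g, rfl⟩ := QuotientGroup.mk_surjective y
      have hg := hBiff.1 hy
      have h1 : ((cosetHecke O hH hn x).hom.toLinearMap ^ (2 * k + 1))
          (Finsupp.single (g : PGL2 F ⧸ KH H n) 1) =
          (cosetRep O (KH H n)).ρ g (heckeOp (cosetRep O (KH H n)).ρ (x ^ (2 * k + 1))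
            (cosetVec O (KH H n))) := by
        rw [← cosetHecke_pow_cosetVec, ← cosetRep_apply_cosetVec]
        have := aeval_comm_apply ((cosetRep O (KH H n)).ρ g)
          (fun v => (Rep.hom_comm_apply (cosetHecke O hH hn x) g v).symm)
          (X ^ (2 * k + 1)) (cosetVec O (KH H n))
        simp only [map_pow, aeval_X] at this
        exact this.symm
      change ((cosetHecke O hH hn x).hom.toLinearMap ^ (2 * k + 1)) _ ∈ Finsupp.supported O O (B k)ᶜ
      rw [h1, heckeOp, LinearMap.sum_apply, map_sum]
      refine sum_mem fun y _ => ?_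
      rw [← Module.End.mul_apply, ← map_mul, cosetRep_apply_cosetVec]
      refine Finsupp.single_mem_supported O 1 fun hb => ?_
      have hb' := ((isBounded_of_mem_K0 (N0_le_K0 1 (inv_mem ⟨Quotient.out y, rfl⟩)) 0).mul
        hg.inv).mul (hBiff.1 hb)
      have h2 : (unip ((Quotient.out y : 𝒪[F]) : F))⁻¹ * g⁻¹ *
          (g * (unip ((Quotient.out y : 𝒪[F]) : F) * dia ((x ^ (2 * k + 1) : TPlus F) : Fˣ))) =
          dia ((x ^ (2 * k + 1) : TPlus F) : Fˣ) := by group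
      rw [h2] at hb'
      have h3 := le_of_isBounded_dia hx (m := 2 * k + 1) rfl hb'
      omega
    exact hle hw

/-- `I^{K_H(n)}` is divisible for injective `I`. -/
lemma divisible_invKH {x : TPlus F} (hx : Irreducible (TPlus.int x)) (hH : H ≤ T0 F)
    (hn : 1 ≤ n) (I : SmoothRep F O) [Injective I] :
    divisible (T := TBar H) (P := TBarPlus H) (TPlus.bar H x) ((invKH hH hn).obj I) := by
  rintro Q hQ ⟨v, hv⟩
  let C : SmoothRep F O := ⟨cosetRep O (KH H n), isSmooth_cosetRep (isOpen_KH H n)⟩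
  let a := (cosetHecke O hH hn x).hom.toLinearMap
  let q : cosetRep O (KH H n) ⟶ cosetRep O (KH H n) := Rep.ofHom
    { toLinearMap := aeval a Q
      isIntertwining' := fun g => LinearMap.ext fun w =>
        (aeval_comm_apply ((cosetRep O (KH H n)).ρ g)
          (fun w => (Rep.hom_comm_apply (cosetHecke O hH hn x) g w).symm) Q w).symm }
  have : Mono q := (Rep.mono_iff_injective q).2 (aeval_cosetHecke_injective hx hH hn hQ)
  let q' : C ⟶ C := ObjectProperty.homMk q
  have : Mono q' := (isSmooth F O).ι.mono_of_mono_map (f := q') ‹Mono q›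
  let f : C ⟶ I := ObjectProperty.homMk (cosetHom hv)
  let f' : cosetRep O (KH H n) ⟶ I.obj := (Injective.factorThru f q').hom
  let v' : (invKH hH hn).obj I :=
    ⟨f'.hom (cosetVec O (KH H n)), map_mem_fixedBy f' cosetVec_mem_fixedBy⟩
  -- Under `Hom_G(O[G / K_H(n)], I) = I^{K_H(n)}`, composition with `cosetHecke` becomes the Hecke
  -- operator.
  have key : ∀ p : O[X], f'.hom (aeval a p (cosetVec O (KH H n))) =
      (aeval (((invKH hH hn).obj I).ρ (TPlus.bar H x)) p v').1 := fun p => by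
    induction p using Polynomial.induction_on' with
    | add p r hp hr =>
      rw [map_add, map_add, LinearMap.add_apply, LinearMap.add_apply]
      exact (map_add f'.hom _ _).trans (congrArg₂ (· + ·) hp hr)
    | monomial m c =>
      rw [aeval_monomial, aeval_monomial, Module.End.mul_apply, Module.End.mul_apply,
        Module.algebraMap_end_apply, Module.algebraMap_end_apply, cosetHecke_pow_cosetVec,
        ← map_pow, TPlus.bar_pow]
      refine (map_smul f'.hom c _).trans (congrArg (c • ·) ((map_heckeOp f' _ _).trans ?_))
      exact (invKH_ρ_bar hH hn I (x ^ m) v').symm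
  refine ⟨v', Subtype.ext ((key Q).symm.trans ?_)⟩
  have h1 := congrArg (fun k : C ⟶ I => k.hom.hom (cosetVec O (KH H n)))
    (Injective.comp_factorThru f q')
  exact h1.trans (cosetHom_cosetVec hv)

end Universal

/-! ### Hecke operators contract the lower unipotent direction. -/

section Contraction

variable {F : Type u} [Field F] [ValuativeRel F] [TopologicalSpace F]
  [IsNonarchimedeanLocalField F] {O : Type u} [CommRing O] {V : Type u} [AddCommGroup V]
  [Module O V] (ρ : Representation O (PGL2 F) V) {H : Subgroup Fˣ} {n : ℕ}

/-- The vectors that are fixed by the lower unipotent elements with entry in `a 𝔭ⁿ`. -/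
def lowFixed (n : ℕ) (a : F) : Submodule O V where
  carrier := {v | ∀ z ∈ 𝓂[F] ^ n, ρ (lowUnip (a * z)) v = v}
  add_mem' := fun ha hb z hz => by rw [map_add, ha z hz, hb z hz]
  zero_mem' := fun _ _ => map_zero _
  smul_mem' := fun c v hv z hz => by rw [map_smul, hv z hz]

lemma lowFixed_pow_mono (π : 𝒪[F]) : Monotone fun j : ℕ => lowFixed ρ n ((π : F) ^ j) := by
  intro i j h v hv z hz
  have h1 := hv (π ^ (j - i) * z) (Ideal.mul_mem_left _ _ hz)
  have h2 : (π : F) ^ i * ((π ^ (j - i) * z : 𝒪[F]) : F) = (π : F) ^ j * z := by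
    conv_rhs => rw [← Nat.add_sub_cancel' h, pow_add, mul_assoc]
    rfl
  rwa [h2] at h1

lemma exists_mem_lowFixed {π : 𝒪[F]} (hπ : Irreducible π) {v : V}
    (hv : IsOpen {g : PGL2 F | ρ g v = v}) : ∃ j : ℕ, v ∈ lowFixed ρ n ((π : F) ^ j) := by
  have h1 : lowUnip ⁻¹' {g : PGL2 F | ρ g v = v} ∈ nhds (0 : F) := by
    refine (hv.preimage continuous_lowUnip).mem_nhds ?_
    simp [lowUnip_zero]
  obtain ⟨N, hN⟩ := exists_pow_mul_mem_of_mem_nhds hπ h1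
  exact ⟨N, fun z _ => hN z⟩

lemma exists_unit_one_add (hn : 1 ≤ n) (hU : higherUnits F n ⊆ (H : Set Fˣ)) {z : 𝒪[F]}
    (hz : z ∈ 𝓂[F] ^ n) :
    ∃ (e : Fˣ) (w : 𝒪[F]), (e : F) = (1 + z : 𝒪[F]) ∧ e ∈ H ∧ (1 + z) * w = 1 := by
  have h1 : IsUnit (1 + z) := by
    by_contra h
    have h2 := sub_mem ((IsLocalRing.mem_maximalIdeal _).2 h) (Ideal.pow_le_self (by omega) hz)
    rw [add_sub_cancel_right] at h2
    exact (Ideal.ne_top_iff_one _).1 (IsLocalRing.maximalIdeal.isMaximal 𝒪[F]).ne_top h2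
  obtain ⟨w, hw⟩ := h1.exists_right_inv
  have h2 : ((1 + z : 𝒪[F]) : F) ≠ 0 := fun h => h1.ne_zero (Subtype.ext h)
  exact ⟨Units.mk0 _ h2, w, rfl, hU ⟨z, hz, rfl⟩, hw⟩

/-- Hecke operators improve the level of vectors. -/
lemma heckeOp_mem_lowFixed (hn : 1 ≤ n) (hU : higherUnits F n ⊆ (H : Set Fˣ)) {v : V}
    (hN : v ∈ fixedBy ρ (N0 F)) (hH : v ∈ fixedBy ρ (H.map dia)) (x : TPlus F)
    (hv : v ∈ lowFixed ρ n ((x : Fˣ) : F)) : heckeOp ρ x v ∈ lowFixed ρ n 1 := by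
  intro c hc
  rw [one_mul]
  choose e w he heH hw using fun y : 𝒪[F] => exists_unit_one_add hn hU (Ideal.mul_mem_right y _ hc)
  have hinv : ∀ y, ((1 + c * y : 𝒪[F]) : F)⁻¹ = (w y : F) := fun y =>
    inv_eq_of_mul_eq_one_right (congrArg Subtype.val (hw y))
  refine Eq.trans ?_ (heckeOp_eq ρ hN x (ι := Idx x)
    (fun y => Quotient.out y * w (Quotient.out y)) ?_).symm
  · rw [heckeOp, LinearMap.sum_apply, map_sum]
    refine Finset.sum_congr rfl fun y _ => ?_
    set y' : 𝒪[F] := Quotient.out y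
    -- Moving the lower unipotent element past `n(y) δ(x)` multiplies its entry `c` by `x s` with `s
    -- = 1 + c y`, replaces `y` by `y / s`, and leaves the factor `δ(s⁻²)`, which lies in the image
    -- of `H`.
    have h1 := lowUnip_mul (c := (c : F)) (y := (y' : F)) (s := ((1 + c * y' : 𝒪[F]) : F))
      (x : Fˣ) (e y') rfl (he y')
    rw [hinv] at h1
    have h2 : ρ (dia (e y' ^ 2)⁻¹) v = v :=
      hH _ ⟨_, H.inv_mem (H.pow_mem (heH y') 2), rfl⟩
    have h3 := hv (c * (1 + c * y')) (Ideal.mul_mem_right _ _ hc)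
    rw [← Module.End.mul_apply, ← map_mul, h1, map_mul, Module.End.mul_apply, map_mul ρ (lowUnip _),
      Module.End.mul_apply, h2, mul_assoc]
    exact congrArg _ h3
  -- `y / (1 + c y) - y' / (1 + c y')` is a unit times `y - y'`, so `y ↦ y / (1 + c y)` permutes the
  -- classes modulo `x`.
  · refine Function.Injective.bijective_of_finite fun a b hab => ?_
    have h1 := (Ideal.Quotient.mk_eq_mk_iff_sub_mem _ _).1 hab
    rw [← mk_out x a, ← mk_out x b]
    refine (Ideal.Quotient.mk_eq_mk_iff_sub_mem _ _).2 ?_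
    have h2 := Ideal.mul_mem_left _
      ((1 + c * Quotient.out a) * (1 + c * Quotient.out b)) h1
    convert h2 using 1
    linear_combination -(Quotient.out a * (1 + c * Quotient.out b)) * hw (Quotient.out a) +
      (Quotient.out b * (1 + c * Quotient.out a)) * hw (Quotient.out b)

/-- By the Iwahori factorization, an element of `K(n)` is a product of a lower unipotent with entry
in `𝔭ⁿ`, an element of `δ(1 + 𝔭ⁿ)` and an element of `N₀`. -/
lemma mem_fixedBy_KH (hn : 1 ≤ n) (hU : higherUnits F n ⊆ (H : Set Fˣ)) {v : V}
    (hN : v ∈ fixedBy ρ (N0 F)) (hH : v ∈ fixedBy ρ (H.map dia)) (hv : v ∈ lowFixed ρ n 1) :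
    v ∈ fixedBy ρ (KH H n) := by
  rw [KH, fixedBy_sup, fixedBy_sup]
  refine ⟨⟨?_, hH⟩, hN⟩
  rintro _ ⟨A, hA, rfl⟩
  obtain ⟨h00, -, h10, h11⟩ := mem_congruenceGL.1 hA
  obtain ⟨-, a, -, -, ha⟩ := exists_unit_one_add hn hU h00
  rw [add_sub_cancel] at ha
  obtain ⟨d, hd⟩ := ((Matrix.isUnit_iff_isUnit_det _).1 A.isUnit).exists_right_inv
  -- This is `(A₀₀ (A₀₀ - A₁₁) + A₀₁ A₁₀) / det A`.
  have hz : A.val 0 0 * A.val 0 0 * d - 1 ∈ 𝓂[F] ^ n := by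
    have h1 := Ideal.mul_mem_left _ d (add_mem (Ideal.mul_mem_left _ (A.val 0 0) (sub_mem h00 h11))
      (Ideal.mul_mem_left _ (A.val 0 1) h10))
    rw [Matrix.det_fin_two] at hd
    convert h1 using 1
    linear_combination hd
  obtain ⟨e, -, he, heH, -⟩ := exists_unit_one_add hn hU hz
  rw [add_sub_cancel] at he
  rw [toG_eq_lowUnip_mul ha hd he, map_mul, map_mul, Module.End.mul_apply, Module.End.mul_apply,
    hN _ ⟨_, rfl⟩, hH _ ⟨e, heH, rfl⟩]
  simpa using hv (A.val 1 0 * a) (Ideal.mul_mem_right _ _ h10)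

end Contraction

/-! ### The isomorphism `Γ^ord(V^{K_H(n)}) ≅ Ord^H(V)`. -/

section Comparison

variable {F : Type u} [Field F] [ValuativeRel F] [TopologicalSpace F]
  [IsNonarchimedeanLocalField F] {O : Type u} [CommRing O] {H : Subgroup Fˣ} {n : ℕ}

/-- Inflation of coinduced elements from `T̄` to `T`. -/
def inflate (hH : H ≤ T0 F) (hn : 1 ≤ n) (V : SmoothRep F O) :
    Representation.coindV (TBarPlus H).subtype ((invKH hH hn).obj V).ρ →ₗ[O]
      Representation.coindV (TPlus F).subtype (invN0.obj V).ρ where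
  toFun Ψ := ⟨fun t => ⟨(Ψ.1 (QuotientGroup.mk' H t)).1, fixedBy_KH_le _ H n (Ψ.1 _).2⟩,
    fun x t => Subtype.ext ((congrArg Subtype.val
      (Ψ.2 (TPlus.bar H x) (QuotientGroup.mk' H t))).trans (invKH_ρ_bar hH hn V x _))⟩
  map_add' _ _ := rfl
  map_smul' _ _ := rfl

lemma inflate_injective (hH : H ≤ T0 F) (hn : 1 ≤ n) (V : SmoothRep F O) :
    Function.Injective (inflate hH hn V) := fun Ψ Φ h => by
  refine Subtype.ext (funext fun t => ?_)
  obtain ⟨t, rfl⟩ := QuotientGroup.mk'_surjective H t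
  exact Subtype.ext (congrArg (fun Θ => (Θ.1 t).1) h)

lemma inflate_coindRep (hH : H ≤ T0 F) (hn : 1 ≤ n) (V : SmoothRep F O) (t : Fˣ)
    (Ψ : Representation.coindV (TBarPlus H).subtype ((invKH hH hn).obj V).ρ) :
    inflate hH hn V (coindRep _ (QuotientGroup.mk' H t) Ψ) =
      coindRep (invN0.obj V) t (inflate hH hn V Ψ) := rfl

variable [IsNoetherianRing O]

lemma inflate_mem_finPart_iff (hH : H ≤ T0 F) (hn : 1 ≤ n) (V : SmoothRep F O) (ϖ : Fˣ)
    {Ψ : Representation.coindV (TBarPlus H).subtype ((invKH hH hn).obj V).ρ} :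
    inflate hH hn V Ψ ∈ (finPart (coindRep (invN0.obj V)) ϖ).toSubmodule ↔
      Ψ ∈ (finPart (coindRep ((invKH hH hn).obj V)) (QuotientGroup.mk' H ϖ)).toSubmodule := by
  change (Submodule.span O (Set.range fun i : ℤ =>
      coindRep (invN0.obj V) (ϖ ^ i) (inflate hH hn V Ψ))).FG ↔
    (Submodule.span O (Set.range fun i : ℤ =>
      coindRep ((invKH hH hn).obj V) (QuotientGroup.mk' H ϖ ^ i) Ψ)).FG
  have h : (Set.range fun i : ℤ => coindRep (invN0.obj V) (ϖ ^ i) (inflate hH hn V Ψ)) =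
      inflate hH hn V '' (Set.range fun i : ℤ =>
        coindRep ((invKH hH hn).obj V) (QuotientGroup.mk' H ϖ ^ i) Ψ) := by
    rw [← Set.range_comp]
    rfl
  rw [h, Submodule.span_image]
  exact ⟨Submodule.fg_of_fg_map_injective _ (inflate_injective hH hn V), Submodule.FG.map _⟩

lemma coindRep_inflate (hH : H ≤ T0 F) (hn : 1 ≤ n) (V : SmoothRep F O)
    (Ψ : Representation.coindV (TBarPlus H).subtype ((invKH hH hn).obj V).ρ) {h : Fˣ}
    (hh : h ∈ H) : coindRep (invN0.obj V) h (inflate hH hn V Ψ) = inflate hH hn V Ψ := by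
  rw [← inflate_coindRep, (QuotientGroup.eq_one_iff h).2 hh |> (id : _ → QuotientGroup.mk' H h = 1),
    map_one, Module.End.one_apply]

/-- The components of the comparison morphism, as linear maps. -/
def ordComparisonApp (hH : H ≤ T0 F) (hn : 1 ≤ n) (ϖ : Fˣ) (V : SmoothRep F O) :
    (finPart (coindRep ((invKH hH hn).obj V)) (QuotientGroup.mk' H ϖ)).toSubmodule →ₗ[O]
      Representation.invariants (((Ord ϖ).obj V).ρ.comp H.subtype) where
  toFun Ψ := ⟨⟨inflate hH hn V Ψ.1, (inflate_mem_finPart_iff hH hn V ϖ).2 Ψ.2⟩,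
    fun h => Subtype.ext (coindRep_inflate hH hn V Ψ.1 h.2)⟩
  map_add' _ _ := rfl
  map_smul' _ _ := rfl

lemma ordComparisonApp_comm (hH : H ≤ T0 F) (hn : 1 ≤ n) (ϖ : Fˣ) (V : SmoothRep F O) (t : TBar H)
    (Ψ : (finPart (coindRep ((invKH hH hn).obj V)) (QuotientGroup.mk' H ϖ)).toSubmodule) :
    ordComparisonApp hH hn ϖ V
        ((finPart (coindRep ((invKH hH hn).obj V)) (QuotientGroup.mk' H ϖ)).toRepresentation t Ψ) =
      ((Ord ϖ).obj V).ρ.quotientToInvariants H t (ordComparisonApp hH hn ϖ V Ψ) := by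
  refine QuotientGroup.induction_on t fun t => Subtype.ext (Subtype.ext ?_)
  exact inflate_coindRep hH hn V t Ψ.1

/-- The comparison morphism `Γ^ord (V^{K_H(n)}) ⟶ Ord^H (V)`. -/
def ordComparison (hH : H ≤ T0 F) (hn : 1 ≤ n) (ϖ : Fˣ) :
    invKH (O := O) hH hn ⋙ GammaOrd (TBarPlus H) (QuotientGroup.mk' H ϖ) ⟶ OrdH H ϖ where
  app V := Rep.ofHom
    { toLinearMap := ordComparisonApp hH hn ϖ V
      isIntertwining' := fun t => LinearMap.ext (ordComparisonApp_comm hH hn ϖ V t) }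
  naturality V W f := by
    refine Rep.hom_ext (Representation.IntertwiningMap.ext (LinearMap.ext fun Ψ => ?_))
    rfl

end Comparison

section Comparison

variable {F : Type u} [Field F] [ValuativeRel F] [TopologicalSpace F]
  [IsNonarchimedeanLocalField F] {O : Type u} [CommRing O] [Nontrivial O]
  [IsNoetherianRing O]
  {H : Subgroup Fˣ} {n : ℕ}

/-- The Hecke operator of a unit `h` is translation by `δ(h)`, so `δ(h) Φ(t) = Φ(h t) = Φ(t)`. -/
lemma apply_mem_fixedBy_of_invariant (hH : H ≤ T0 F) (V : SmoothRep F O)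
    {Φ : Representation.coindV (TPlus F).subtype (invN0.obj V).ρ}
    (hinv : ∀ h ∈ H, coindRep (invN0.obj V) h Φ = Φ) (t : Fˣ) :
    (Φ.1 t).1 ∈ fixedBy V.obj.ρ (H.map dia) := by
  rintro _ ⟨h, hh, rfl⟩
  let h' : TPlus F := ⟨h, T0_le_TPlus (hH hh)⟩
  have h1 : (Φ.1 (h * t)).1 = heckeOp V.obj.ρ h' (Φ.1 t).1 := congrArg Subtype.val (Φ.2 h' t)
  have h2 : Φ.1 (t * h) = Φ.1 t := congrArg (fun Θ => Θ.1 t) (hinv h hh)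
  rw [heckeOp_unit _ (Φ.1 t).2 h' (hH hh), mul_comm, h2] at h1
  exact h1.symm

/-- The values of the `ϖ`-finite elements of `Ord (V)` that are fixed by `H` are fixed by
`K_H(n)`. -/
lemma apply_mem_fixedBy_KH (hH : H ≤ T0 F) (hn : 1 ≤ n) (hU : higherUnits F n ⊆ (H : Set Fˣ))
    {x : TPlus F} (hx : Irreducible (TPlus.int x)) (V : SmoothRep F O)
    {Φ : Representation.coindV (TPlus F).subtype (invN0.obj V).ρ}
    (hfin : Φ ∈ (finPart (coindRep (invN0.obj V)) (x : Fˣ)).toSubmodule)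
    (hinv : ∀ h ∈ H, coindRep (invN0.obj V) h Φ = Φ) (t : Fˣ) :
    (Φ.1 t).1 ∈ fixedBy V.obj.ρ (KH H n) := by
  let ev : Representation.coindV (TPlus F).subtype (invN0.obj V).ρ →ₗ[O] V.obj :=
    (fixedBy V.obj.ρ (N0 F)).subtype.comp (coindEval t)
  have hfg : (Submodule.span O (Set.range fun i : ℤ =>
    coindRep (invN0.obj V) ((x : Fˣ) ^ i) Φ)).FG := hfin
  -- The values `Φ(t x ^ i)`, for all integers `i`, span a finitely generated module, so one `j`
  -- bounds the level of them all, including that of `Φ(t x ^ (-j))`. The Hecke operator of `x ^ j`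
  -- sends the latter to `Φ(t)` and removes exactly this level.
  obtain ⟨j, hj⟩ := exists_le_of_fg (lowFixed_pow_mono V.obj.ρ (n := n) (TPlus.int x))
    (fun v => exists_mem_lowFixed V.obj.ρ hx (V.property v)) (hfg.map ev)
  have h1 : (Φ.1 (t * (x : Fˣ) ^ (-(j : ℤ)))).1 ∈
      lowFixed V.obj.ρ n ((TPlus.int x : F) ^ j) :=
    hj ⟨_, Submodule.subset_span ⟨-(j : ℤ), rfl⟩, rfl⟩
  have h2 : (Φ.1 t).1 = heckeOp V.obj.ρ (x ^ j) (Φ.1 (t * (x : Fˣ) ^ (-(j : ℤ)))).1 := by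
    have h3 := congrArg Subtype.val (Φ.2 (x ^ j) (t * (x : Fˣ) ^ (-(j : ℤ))))
    have h4 : (TPlus F).subtype (x ^ j) * (t * (x : Fˣ) ^ (-(j : ℤ))) = t := by
      rw [map_pow, mul_left_comm, zpow_neg, zpow_natCast]
      exact (congrArg (t * ·) (mul_inv_cancel _)).trans (mul_one t)
    rw [h4] at h3
    exact h3
  refine mem_fixedBy_KH V.obj.ρ hn hU (Φ.1 t).2 (apply_mem_fixedBy_of_invariant hH V hinv t) ?_
  rw [h2]
  exact heckeOp_mem_lowFixed V.obj.ρ hn hU (Φ.1 _).2 (apply_mem_fixedBy_of_invariant hH V hinv _)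
    (x ^ j) h1

/-- Invariance makes `Φ` constant on cosets of `H`, and `apply_mem_fixedBy_KH` puts its values in
the smaller space. -/
lemma exists_inflate_eq (hH : H ≤ T0 F) (hn : 1 ≤ n) (hU : higherUnits F n ⊆ (H : Set Fˣ))
    {x : TPlus F} (hx : Irreducible (TPlus.int x)) (V : SmoothRep F O)
    {Φ : Representation.coindV (TPlus F).subtype (invN0.obj V).ρ}
    (hfin : Φ ∈ (finPart (coindRep (invN0.obj V)) (x : Fˣ)).toSubmodule)
    (hinv : ∀ h ∈ H, coindRep (invN0.obj V) h Φ = Φ) :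
    ∃ Ψ, inflate hH hn V Ψ = Φ := by
  let f : Fˣ → (invKH hH hn).obj V := fun t => ⟨_, apply_mem_fixedBy_KH hH hn hU hx V hfin hinv t⟩
  have hf : ∀ a b : Fˣ, a⁻¹ * b ∈ H → f a = f b := fun a b hab => by
    have h1 : Φ.1 (a * (a⁻¹ * b)) = Φ.1 a := congrArg (fun Θ => Θ.1 a) (hinv _ hab)
    rw [mul_inv_cancel_left] at h1
    exact Subtype.ext (congrArg (fun v => v.1) h1.symm)
  refine ⟨⟨fun t => Quotient.liftOn' t f fun a b hab => hf a b (QuotientGroup.leftRel_apply.1 hab),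
    fun p t => ?_⟩, Subtype.ext (funext fun t => Subtype.ext rfl)⟩
  obtain ⟨y, rfl⟩ := TPlus.bar_surjective H p
  refine QuotientGroup.induction_on t fun t => Subtype.ext ?_
  exact (congrArg Subtype.val (Φ.2 y t)).trans (invKH_ρ_bar hH hn V y (f t)).symm

lemma isIso_ordComparison (hH : H ≤ T0 F) (hn : 1 ≤ n) (hU : higherUnits F n ⊆ (H : Set Fˣ))
    {x : TPlus F} (hx : Irreducible (TPlus.int x)) :
    IsIso (ordComparison (O := O) hH hn (x : Fˣ)) := by
  have h (V : SmoothRep F O) : IsIso ((ordComparison (O := O) hH hn (x : Fˣ)).app V) := by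
    have : Mono ((ordComparison (O := O) hH hn (x : Fˣ)).app V) := by
      refine (Rep.mono_iff_injective _).2 fun Ψ Ψ' h => Subtype.ext ?_
      exact inflate_injective hH hn V (congrArg (fun Θ => Θ.1.1) h)
    have : Epi ((ordComparison (O := O) hH hn (x : Fˣ)).app V) := by
      refine (Rep.epi_iff_surjective _).2 fun Φ => ?_
      obtain ⟨Ψ, hΨ⟩ := exists_inflate_eq hH hn hU hx V Φ.1.2 fun h hh =>
        congrArg Subtype.val (Φ.2 ⟨h, hh⟩)
      refine ⟨⟨Ψ, (inflate_mem_finPart_iff hH hn V _).1 ?_⟩, Subtype.ext (Subtype.ext hΨ)⟩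
      rw [hΨ]
      exact Φ.1.2
    exact isIso_of_mono_of_epi _
  exact NatIso.isIso_of_isIso_app _

end Comparison

/-! ### The spectral sequence of a composite with an acyclic class. -/

section DerivedIso

variable {C D : Type*} [Category C] [Abelian C] [HasInjectiveResolutions C] [Category D] [Abelian D]

/-- The isomorphism of right derived functors given by an isomorphism of functors. -/
def rightDerivedIso {Γ Γ' : C ⥤ D} [Γ.Additive] [Γ'.Additive] (e : Γ ≅ Γ') (m : ℕ) :
    Γ.rightDerived m ≅ Γ'.rightDerived m where
  hom := NatTrans.rightDerived e.hom m
  inv := NatTrans.rightDerived e.inv m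
  hom_inv_id := by rw [← NatTrans.rightDerived_comp, e.hom_inv_id, NatTrans.rightDerived_id]
  inv_hom_id := by rw [← NatTrans.rightDerived_comp, e.inv_hom_id, NatTrans.rightDerived_id]

/-- If a left exact functor `Γ` has an acyclic class that contains the images of injective objects
under `G`, then the spectral sequence of the composite functor `G ⋙ Γ` has two columns, hence zero
differentials. -/
lemma IsAcyclicClass.exists_convergesTo {B : Type*} [Category B] [Abelian B] [EnoughInjectives B]
    [EnoughInjectives C] {Γ : C ⥤ D} [Γ.Additive] [PreservesFiniteLimits Γ] {A : ObjectProperty C}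
    (h : IsAcyclicClass Γ A) (G : B ⥤ C) [G.Additive]
    (hG : ∀ I : B, Injective I → A (G.obj I)) {R : B ⥤ D} [R.Additive] (e : G ⋙ Γ ≅ R) (V : B) :
    ∃ E : E₂CohomologicalSpectralSequenceNat D,
      (∀ r s : ℕ, Nonempty ((E.page 2 le_rfl).X (r, s) ≅
        (Γ.rightDerived r).obj ((G.rightDerived s).obj V))) ∧
      ConvergesTo E fun m => (R.rightDerived m).obj V := by
  -- The derived functors of `Γ` vanish from degree two on, so only columns `0` and `1` survive;
  -- convergence then amounts to the short exact sequences of `exists_shortExact_rightDerived`.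
  refine ⟨degenerate fun r s => (Γ.rightDerived r).obj ((G.rightDerived s).obj V),
    fun r s => ⟨Iso.refl _⟩, degenerate_convergesTo (fun r s => h.isZero_rightDerived_add_two _ r)
      ?_ fun m => ?_⟩
  · obtain ⟨i⟩ := rightDerived_zero_iso (Γ := Γ) G V
    exact ⟨(rightDerivedIso e 0).symm.app V ≪≫ i⟩
  · obtain ⟨S, hS, h1, ⟨i⟩, h3⟩ := h.exists_shortExact_rightDerived G hG V m
    exact ⟨S, hS, h1, ⟨i ≪≫ (rightDerivedIso e (m + 1)).app V⟩, h3⟩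

end DerivedIso

/-! ### The acyclic class for `T̄⁺` and the theorem. -/

section Ordinary

variable {F : Type u} [Field F] [ValuativeRel F] [TopologicalSpace F]
  [IsNonarchimedeanLocalField F] {O : Type u} [CommRing O] [Nontrivial O] [IsNoetherianRing O]
  {H : Subgroup Fˣ} {x : TPlus F}

lemma gammaOrd_bar_isAcyclicClass (hx : Irreducible (TPlus.int x)) (hH : H ≤ T0 F) :
    IsAcyclicClass (GammaOrd (O := O) (TBarPlus H) (QuotientGroup.mk' H (x : Fˣ)))
      (divisible (T := TBar H) (TPlus.bar H x)) :=
  gammaOrd_isAcyclicClass (O := O) (T := TBar H) (P := TBarPlus H) (t₀ := TPlus.bar H x)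
    (exists_bar_pow_mul_mem hx H) (bar_pow_ne_one hx hH)

end Ordinary

end

end PGLOrd

theorem lemma1p15 {F : Type u} [Field F] [ValuativeRel F] [TopologicalSpace F]
    [IsNonarchimedeanLocalField F] [CharZero F]
    {O : Type u} [CommRing O] [IsLocalRing O] [IsNoetherianRing O]
    [IsAdicComplete (IsLocalRing.maximalIdeal O) O] (hO : ringKrullDim O ≤ 1)
    (ϖ : Fˣ) (hϖ : PGLOrd.IsUniformizer ϖ)
    (H : Subgroup Fˣ) (hH : H ≤ PGLOrd.T0 F)
    (n : ℕ) (hn : 1 ≤ n) (hU : PGLOrd.higherUnits F n ⊆ (H : Set Fˣ)) :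
    -- acyclicity of `Hom_{O[G]}(cInd_{K₀(n)}^G W, I)` for `Γ^ord`
    (∀ I : PGLOrd.SmoothRep F O, Injective I →
      ∀ W : Rep.{u} O (PGLOrd.TBar0 H),
        Module.Finite (MonoidAlgebra O (PGLOrd.TBar0 H)) W.ρ.asModule →
        ∀ q : ℕ, 1 ≤ q →
          IsZero (((PGLOrd.GammaOrd (O := O) (PGLOrd.TBarPlus H)
            (QuotientGroup.mk' H ϖ)).rightDerived q).obj (PGLOrd.homRep hH hn W I.obj))) ∧
    -- the spectral sequence `R^r Γ^ord (H^s(K_H(n), V)) ⇒ Ord^{H, r + s}(V)`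
    (∀ V : PGLOrd.SmoothRep F O,
      ∃ E : E₂CohomologicalSpectralSequenceNat (Rep.{u} O (PGLOrd.TBar H)),
        (∀ r s : ℕ, Nonempty ((E.page 2 le_rfl).X (r, s) ≅
          ((PGLOrd.GammaOrd (O := O) (PGLOrd.TBarPlus H) (QuotientGroup.mk' H ϖ)).rightDerived
            r).obj (((PGLOrd.invKH (O := O) hH hn).rightDerived s).obj V))) ∧
        PGLOrd.ConvergesTo E fun m => ((PGLOrd.OrdH (O := O) H ϖ).rightDerived m).obj V) := by
  obtain ⟨hϖ0, hx⟩ := hϖ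
  let x : PGLOrd.TPlus F := ⟨ϖ, hϖ0⟩
  have hac := PGLOrd.gammaOrd_bar_isAcyclicClass (O := O) (x := x) hx hH
  have hlex := PGLOrd.gammaOrd_preservesFiniteLimits (O := O) (P := PGLOrd.TBarPlus H)
    (QuotientGroup.mk' H ϖ)
  refine ⟨fun I hI W _ q hq => ?_, fun V => ?_⟩
  · obtain ⟨q, rfl⟩ := Nat.exists_eq_add_of_le' hq
    exact hac.isZero_rightDerived (PGLOrd.divisible_homRep (x := x) hx hH hn I) q
  -- `Ord^H` is thereby the composite of `V ↦ V^{K_H(n)}`, which sends injectives to divisible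
  -- objects, with `Γ^ord`.
  · have := PGLOrd.isIso_ordComparison (O := O) hH hn hU (x := x) hx
    exact hac.exists_convergesTo (PGLOrd.invKH hH hn)
      (fun I _ => PGLOrd.divisible_invKH (x := x) hx hH hn I)
      (asIso (PGLOrd.ordComparison hH hn ϖ)) V
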